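/- **Setting.** Let $p\ge 1$, let $\mathcal H_1,\dots,\mathcal H_p$ be separable real Hilbert spaces, $\mathcal H=\mathcal H_1\times\cdots\times\mathcal H_p$ the product Hilbert space. An operator matrix $A=[A_{ij}]$ has bounded entries $A_{ij}:\mathcal H_j\to\mathcal H_i$ and is identified with an operator on $\mathcal H$; $A_0$ is its off-diagonal part, $\operatorname{dg}A$ its diagonal part, $\|\cdot\|_2$ the Hilbert–Schmidt norm (with values in $[0,\infty]$), $\|\cdot\|$ the operator norm. Let $X=(X_1,\dots,X_p)$ be a random element of $\mathcal H$ with $\mathbb E\|X\|^2<\infty$ and covariance $C=[C_{ij}]$, $C_{ij}=\mathbb E[(X_i-\mathbb EX_i)\otimes(X_j-\mathbb EX_j)]$. Its correlation operator matrix $R$ has $R_{ii}=I$ and, for $i\ne j$, $R_{ij}$ is the unique bounded operator with $C_{ij}=C_{ii}^{1/2}R_{ij}C_{jj}^{1/2}$ and $R_{ij}=\Pi_iR_{ij}\Pi_j$, where $\Pi_j$ projects onto $\overline{\operatorname{ran}C_{jj}}$. Let $H^*=R^{-1}-I$, let $S=\{(i,j): i=j\text{ or }H^*_{ij}\ne0\}$,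 let $d=\max_i\#\{j:(i,j)\in S\}$ and $\rho=1+\max_i\sum_{j\ne i}\|R_{ij}\|_2$. Let $\Gamma:A\mapsto RAR$ act on arrays $A=[A_{ij}]$ of Hilbert–Schmidt operators, with entries $\Gamma_{(i,j)(k,l)}:A_{kl}\mapsto R_{ik}A_{kl}R_{lj}$ and submatrices $\Gamma_{AB}=[\Gamma_{ee'}]_{e\in A,\,e'\in B}$. For a matrix $M=[M_{ee'}]$ indexed by pairs, each entry $M_{ee'}$ is an operator between spaces of Hilbert–Schmidt operators and $\|M_{ee'}\|$ is its operator norm with respect to the Hilbert–Schmidt norms. Put $\Lambda_{SS}=\Gamma_{SS}^{-1}-I$ and $\gamma=1+\max_{e\in S}\sum_{e'\in S}\|(\Lambda_{SS})_{ee'}\|$. **Assumptions.** 1. Either $X$ is Gaussian and its law is equivalent to (mutually absolutely continuous with) the product $\bigotimes_j\mathbb P_{X_j}$ of the laws of its components; or $R_0$ is Hilbert–Schmidt and, for some $c>0$, every eigenvalue $\mu$ of $R_0$ satisfies $1+\mu\ge c$. 2. (Incoherence.) For some $\alpha>0$, $\sum_{e'\in S}\|(\Gamma_{eS}\Gamma_{SS}^{-1})_{e'}\|\le1-\alpha$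 for every $e\notin S$. 3. (Regularity.) For some $0<\beta\le1$, $R_0=[\operatorname{dg}C]^\beta\,\Phi_0\,[\operatorname{dg}C]^\beta$ with a Hilbert–Schmidt operator matrix $\Phi_0=[\Phi_{ij}]$ whose diagonal entries are zero. Let $\kappa=16\sqrt2\,\max\big\{1,\ \max_{i\ne j}\|R_{ij}\|_2,\ \max_{i\ne j}\|\Phi_{ij}\|_2\cdot\max\{2,2\max_j\|C_{jj}\|\}\big\}$. **Estimator.** For each sample size $n$ let $\hat C=\hat C_n$ be an estimator of $C$ (a random operator matrix) whose diagonal entries are almost surely non-negative operators. Let $\delta_*>0$, let $f:\mathbb N\times(0,\infty)\to[0,\infty)$ be nondecreasing in both arguments, and assume the tail condition $\mathbb P[\|\hat C_{ij}-C_{ij}\|_2\ge\delta]\le1/f(n,\delta)$ for all $i,j$, all $n\ge1$ and $0<\delta<\delta_*$ (with $1/0=\infty$). Put $\bar n_f(\delta,r)=\max\{n:f(n,\delta)\le r\}$ (with $\max\emptyset=0$, and $\infty$ if the set is unbounded) and $\bar\delta_f(n,r)=\max\{\delta>0:f(n,\delta)\le r\}$. For $\epsilon,\lambda>0$ let $\hat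 R_{ii}=I$, $\hat R_{ij}=(\epsilon I+\hat C_{ii})^{-1/2}\hat C_{ij}(\epsilon I+\hat C_{jj})^{-1/2}$ for $i\ne j$, and let $\hat H$ be the minimizer of $$\sum_{i\ne j}\operatorname{tr}(H_{ij}\hat R_{ij}^*)-\log\textstyle\det_2(I+H)+\lambda\sum_{i\ne j}\|H_{ij}\|_2$$ over the self-adjoint Hilbert–Schmidt operators $H$ on $\mathcal H$ with $I+H>0$, where $\det_2(I+H)=\prod_k(1+\lambda_k)e^{-\lambda_k}$ over the eigenvalues $\lambda_k$ of $H$, counted with multiplicity. **Theorem.** Let $\tau>2$, suppose that the maximum $\bar\delta=\bar\delta_f(n,p^\tau)$ exists, and take $\epsilon=\epsilon_n=\bar\delta^{1/(1+\beta)}$ and $\lambda=\lambda_n=\frac8\alpha\kappa\,\bar\delta^{\beta/(1+\beta)}$. If $$n>\bar n_f\!\left(1\Big/\max\Big\{\tfrac1{\delta_*},\Big[12\,d\,\kappa\big(1+\tfrac8\alpha\big)^2\max\{\rho\gamma,\rho^3\gamma^2\}\Big]^{1+1/\beta}\Big\},\ p^\tau\right),$$ then, on an event of probability at least $1-1/p^{\tau-2}$,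 the minimizer $\hat H$ exists and is unique, and 1. $\max_{i,j}\|\hat H_{ij}-H^*_{ij}\|_2\le2\gamma\big(1+\tfrac8\alpha\big)\kappa\,\bar\delta^{\beta/(1+\beta)}$; 2. for all $(i,j)$, if $\|H^*_{ij}\|_2>2\gamma(1+\tfrac8\alpha)\kappa\,\bar\delta^{\beta/(1+\beta)}$, then $\hat H_{ij}\ne0$. -/

import Mathlib

open MeasureTheory ProbabilityTheory
open scoped ENNReal

set_option linter.unusedSectionVars false

namespace FGL

section HilbertSchmidt

variable {E F G : Type*}
  [NormedAddCommGroup E] [InnerProductSpace ℝ E] [CompleteSpace E]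
  [NormedAddCommGroup F] [InnerProductSpace ℝ F] [CompleteSpace F]
  [NormedAddCommGroup G] [InnerProductSpace ℝ G] [CompleteSpace G]

variable (E) in
/-- The index set of a fixed orthonormal (Hilbert) basis of `E`. -/
noncomputable def onbIndex : Set E := (exists_hilbertBasis ℝ E).choose

variable (E) in
/-- A fixed orthonormal (Hilbert) basis of `E`. -/
noncomputable def onb : HilbertBasis (onbIndex E) ℝ E :=
  (exists_hilbertBasis ℝ E).choose_spec.choose

/-- The Hilbert-Schmidt norm of a bounded operator, with values in `[0, ∞]`. -/
noncomputable def hsNorm (A : E →L[ℝ] F) : ℝ≥0∞ :=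
  (∑' k : onbIndex E, ‖A (onb E k)‖ₑ ^ 2) ^ (1 / 2 : ℝ)

/-- Parseval's identity with values in `[0, ∞]`. -/
theorem parseval_enorm {κ : Type*} (b : HilbertBasis κ ℝ E) (x : E) :
    ∑' k, ‖inner ℝ (b k) x‖ₑ ^ 2 = ‖x‖ₑ ^ 2 := by
  have h := lp.norm_rpow_eq_tsum (p := 2) (by norm_num) (b.repr x)
  have hs := lp.memℓp (b.repr x)
  rw [memℓp_gen_iff (by norm_num)] at hs
  simp only [ENNReal.toReal_ofNat, Real.rpow_two, HilbertBasis.repr_apply_apply,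
    LinearIsometryEquiv.norm_map] at h hs
  have e : ∀ y : E, ‖y‖ₑ ^ 2 = ENNReal.ofReal (‖y‖ ^ 2) := fun y => by
    rw [ENNReal.ofReal_pow (norm_nonneg _), ofReal_norm]
  have e' : ∀ y : ℝ, ‖y‖ₑ ^ 2 = ENNReal.ofReal (‖y‖ ^ 2) := fun y => by
    rw [ENNReal.ofReal_pow (norm_nonneg _), ofReal_norm]
  simp_rw [e, e', h]
  rw [ENNReal.ofReal_tsum_of_nonneg (fun _ => by positivity) hs]

/-- The sum of squares defining the Hilbert-Schmidt norm, for an operator and for its adjoint. -/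
theorem tsum_sq_adjoint {κ ν : Type*} (b : HilbertBasis κ ℝ E) (c : HilbertBasis ν ℝ F)
    (A : E →L[ℝ] F) :
    ∑' k, ‖A (b k)‖ₑ ^ 2 = ∑' l, ‖(ContinuousLinearMap.adjoint A) (c l)‖ₑ ^ 2 := by
  calc ∑' k, ‖A (b k)‖ₑ ^ 2 = ∑' k, ∑' l, ‖inner ℝ (c l) (A (b k))‖ₑ ^ 2 := by
        simp_rw [parseval_enorm c]
    _ = ∑' l, ∑' k, ‖inner ℝ (c l) (A (b k))‖ₑ ^ 2 := ENNReal.tsum_comm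
    _ = ∑' l, ∑' k, ‖inner ℝ (b k) ((ContinuousLinearMap.adjoint A) (c l))‖ₑ ^ 2 := by
        simp_rw [ContinuousLinearMap.adjoint_inner_right, real_inner_comm]
    _ = _ := by simp_rw [parseval_enorm b]

/-- The Hilbert-Schmidt norm may be computed in any Hilbert basis. -/
theorem hsNorm_eq {κ : Type*} (b : HilbertBasis κ ℝ E) (A : E →L[ℝ] F) :
    hsNorm A = (∑' k, ‖A (b k)‖ₑ ^ 2) ^ (1 / 2 : ℝ) := by
  rw [hsNorm, tsum_sq_adjoint (onb E) (onb F), ← tsum_sq_adjoint b (onb F)]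

theorem hsNorm_adjoint (A : E →L[ℝ] F) : hsNorm (ContinuousLinearMap.adjoint A) = hsNorm A := by
  rw [hsNorm, hsNorm, tsum_sq_adjoint (onb E) (onb F)]

theorem hsNorm_sq (A : E →L[ℝ] F) : hsNorm A ^ 2 = ∑' k : onbIndex E, ‖A (onb E k)‖ₑ ^ 2 := by
  rw [hsNorm, ← ENNReal.rpow_natCast, ← ENNReal.rpow_mul]; norm_num

theorem hsNorm_comp_left (B : F →L[ℝ] G) (A : E →L[ℝ] F) :
    hsNorm (B ∘L A) ≤ ‖B‖ₑ * hsNorm A := by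
  have : hsNorm (B ∘L A) ^ 2 ≤ (‖B‖ₑ * hsNorm A) ^ 2 := by
    rw [mul_pow, hsNorm_sq, hsNorm_sq, ← ENNReal.tsum_mul_left]
    refine ENNReal.tsum_le_tsum fun k => ?_
    rw [← mul_pow]
    gcongr
    exact B.le_opENorm _
  exact (ENNReal.pow_le_pow_left_iff two_ne_zero).1 this

theorem hsNorm_comp_right (A : F →L[ℝ] G) (C : E →L[ℝ] F) :
    hsNorm (A ∘L C) ≤ hsNorm A * ‖C‖ₑ := by
  have h := hsNorm_comp_left (ContinuousLinearMap.adjoint C) (ContinuousLinearMap.adjoint A)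
  rw [← ContinuousLinearMap.adjoint_comp, hsNorm_adjoint, hsNorm_adjoint] at h
  have e : ‖ContinuousLinearMap.adjoint C‖ₑ = ‖C‖ₑ := by
    rw [← ofReal_norm, ← ofReal_norm, LinearIsometryEquiv.norm_map]
  rwa [e, mul_comm] at h

variable (E F) in
/-- The Hilbert-Schmidt operators, as a subspace of the bounded operators. -/
noncomputable def hsSubmodule : Submodule ℝ (E →L[ℝ] F) where
  carrier := {A | hsNorm A < ∞}
  zero_mem' := by simp [hsNorm]
  add_mem' := by
    intro A B hA hB
    have hA' : hsNorm A ^ 2 < ∞ := ENNReal.pow_lt_top hA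
    have hB' : hsNorm B ^ 2 < ∞ := ENNReal.pow_lt_top hB
    rw [hsNorm_sq] at hA' hB'
    have : hsNorm (A + B) ^ 2 < ∞ := by
      rw [hsNorm_sq]
      calc _ ≤ ∑' k : onbIndex E, (4 * ‖A (onb E k)‖ₑ ^ 2 + 4 * ‖B (onb E k)‖ₑ ^ 2) := by
            refine ENNReal.tsum_le_tsum fun k => ?_
            have h1 : ‖(A + B) (onb E k)‖ₑ ≤ ‖A (onb E k)‖ₑ + ‖B (onb E k)‖ₑ := enorm_add_le _ _
            have h2 : ∀ a b : ℝ≥0∞, (a + b) ^ 2 ≤ 4 * a ^ 2 + 4 * b ^ 2 := by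
              intro a b
              rcases le_total a b with h | h
              · calc (a + b) ^ 2 ≤ (b + b) ^ 2 := by gcongr
                  _ = 4 * b ^ 2 := by ring
                  _ ≤ _ := le_add_self
              · calc (a + b) ^ 2 ≤ (a + a) ^ 2 := by gcongr
                  _ = 4 * a ^ 2 := by ring
                  _ ≤ _ := le_self_add
            exact (pow_le_pow_left' h1 2).trans (h2 _ _)
        _ < ∞ := by
            rw [ENNReal.tsum_add, ENNReal.tsum_mul_left, ENNReal.tsum_mul_left]
            exact ENNReal.add_lt_top.2 ⟨ENNReal.mul_lt_top (by simp) hA',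
              ENNReal.mul_lt_top (by simp) hB'⟩
    exact (ENNReal.pow_lt_top_iff.1 this).resolve_right two_ne_zero
  smul_mem' := by
    intro c A hA
    have := hsNorm_comp_left (c • ContinuousLinearMap.id ℝ F) A
    have e : (c • ContinuousLinearMap.id ℝ F) ∘L A = c • A := by ext; simp
    rw [e] at this
    exact this.trans_lt (ENNReal.mul_lt_top enorm_lt_top hA)

variable (E F) in
/-- The space of Hilbert-Schmidt operators from `E` to `F`, with the Hilbert-Schmidt norm. -/
def HSOp : Type _ := hsSubmodule E F

noncomputable instance : AddCommGroup (HSOp E F) := inferInstanceAs (AddCommGroup (hsSubmodule E F))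

noncomputable instance : Module ℝ (HSOp E F) := inferInstanceAs (Module ℝ (hsSubmodule E F))

/-- The underlying bounded operator of a Hilbert-Schmidt operator. -/
noncomputable def HSOp.toCLM : HSOp E F →ₗ[ℝ] (E →L[ℝ] F) := (hsSubmodule E F).subtype

/-- A bounded operator with finite Hilbert-Schmidt norm. -/
def HSOp.mk (A : E →L[ℝ] F) (hA : hsNorm A < ∞) : HSOp E F := ⟨A, hA⟩

theorem HSOp.hsNorm_lt_top (A : HSOp E F) : hsNorm A.toCLM < ∞ := A.2

@[simp] theorem HSOp.toCLM_mk (A : E →L[ℝ] F) (hA : hsNorm A < ∞) : (HSOp.mk A hA).toCLM = A := rfl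

theorem HSOp.toCLM_injective : Function.Injective (HSOp.toCLM : HSOp E F → E →L[ℝ] F) :=
  Subtype.val_injective

theorem HSOp.memℓp (A : HSOp E F) :
    Memℓp (fun k : onbIndex E => A.toCLM (onb E k)) 2 := by
  have h : hsNorm A.toCLM ^ 2 < ∞ := ENNReal.pow_lt_top A.hsNorm_lt_top
  rw [hsNorm_sq] at h
  rw [memℓp_gen_iff (by norm_num)]
  have := ENNReal.summable_toReal h.ne
  simpa using this

/-- The values of a Hilbert-Schmidt operator on the orthonormal basis. -/
noncomputable def HSOp.toL2 : HSOp E F →ₗ[ℝ] lp (fun _ : onbIndex E => F) 2 where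
  toFun A := ⟨fun k => A.toCLM (onb E k), A.memℓp⟩
  map_add' A B := by ext k; simp; rfl
  map_smul' c A := by ext k; simp

theorem HSOp.toL2_injective : Function.Injective (HSOp.toL2 : HSOp E F → _) := by
  intro A B h
  apply HSOp.toCLM_injective
  have hd : Dense (Submodule.span ℝ (Set.range (onb E)) : Set E) := by
    rw [Submodule.dense_iff_topologicalClosure_eq_top]; exact (onb E).dense_span
  refine ContinuousLinearMap.ext_on hd ?_
  rintro _ ⟨k, rfl⟩
  exact congrFun (congrArg Subtype.val h) k

noncomputable instance : NormedAddCommGroup (HSOp E F) :=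
  NormedAddCommGroup.induced (HSOp E F) (lp (fun _ : onbIndex E => F) 2) HSOp.toL2
    HSOp.toL2_injective

noncomputable instance : NormedSpace ℝ (HSOp E F) :=
  NormedSpace.induced ℝ (HSOp E F) (lp (fun _ : onbIndex E => F) 2) HSOp.toL2

theorem HSOp.norm_eq (A : HSOp E F) : ‖A‖ = (hsNorm A.toCLM).toReal := by
  have h1 : ‖A‖ = ‖HSOp.toL2 A‖ := rfl
  rw [h1, lp.norm_eq_tsum_rpow (by norm_num), hsNorm, ← ENNReal.toReal_rpow,
    ENNReal.tsum_toReal_eq (fun k => by finiteness)]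
  simp [HSOp.toL2]

theorem HSOp.ofReal_norm_eq (A : HSOp E F) : ENNReal.ofReal ‖A‖ = hsNorm A.toCLM := by
  rw [HSOp.norm_eq, ENNReal.ofReal_toReal A.hsNorm_lt_top.ne]

/-- The Hilbert-Schmidt inner product `tr (A B*)`. -/
noncomputable def hsInner (A B : E →L[ℝ] F) : ℝ :=
  ∑' k : onbIndex E, inner ℝ (A (onb E k)) (B (onb E k))

variable {E' F' : Type*}
  [NormedAddCommGroup E'] [InnerProductSpace ℝ E'] [CompleteSpace E']
  [NormedAddCommGroup F'] [InnerProductSpace ℝ F'] [CompleteSpace F']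

theorem hsNorm_sandwich (B : F →L[ℝ] F') (C : E' →L[ℝ] E) (A : E →L[ℝ] F) :
    hsNorm (B ∘L A ∘L C) ≤ ‖B‖ₑ * hsNorm A * ‖C‖ₑ := by
  rw [mul_assoc]
  refine (hsNorm_comp_left _ _).trans ?_
  gcongr
  exact hsNorm_comp_right _ _

/-- The bounded map `A ↦ B A C` between spaces of Hilbert-Schmidt operators. -/
noncomputable def sandwich (B : F →L[ℝ] F') (C : E' →L[ℝ] E) : HSOp E F →L[ℝ] HSOp E' F' :=
  LinearMap.mkContinuous
    { toFun := fun A => HSOp.mk (B ∘L A.toCLM ∘L C)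
        ((hsNorm_sandwich B C A.toCLM).trans_lt
          (ENNReal.mul_lt_top (ENNReal.mul_lt_top enorm_lt_top A.hsNorm_lt_top) enorm_lt_top))
      map_add' := fun A A' => by
        apply HSOp.toCLM_injective
        ext x
        simp
      map_smul' := fun c A => by
        apply HSOp.toCLM_injective
        ext x
        simp }
    (‖B‖ * ‖C‖) (by
      intro A
      have h := hsNorm_sandwich B C A.toCLM
      rw [HSOp.norm_eq, HSOp.norm_eq]
      have h' := ENNReal.toReal_mono (ENNReal.mul_lt_top
        (ENNReal.mul_lt_top enorm_lt_top A.hsNorm_lt_top) enorm_lt_top).ne h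
      simp only [ENNReal.toReal_mul, toReal_enorm] at h'
      simp only [LinearMap.coe_mk, AddHom.coe_mk, HSOp.toCLM_mk]
      linarith)

end HilbertSchmidt

section FunctionalCalculus

variable {E F : Type*}
  [NormedAddCommGroup E] [InnerProductSpace ℝ E] [CompleteSpace E]
  [NormedAddCommGroup F] [InnerProductSpace ℝ F] [CompleteSpace F]

/-- `B = φ(A)` in the continuous functional calculus of the non-negative operator `A`, where `φ` is
continuous on `[0, ‖A‖]`: every polynomial that is uniformly `η`-close to `φ` on `[0, ‖A‖]`,
evaluated at `A`, is `η`-close to `B` in operator norm. -/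
def IsOpFun (φ : ℝ → ℝ) (A B : E →L[ℝ] E) : Prop :=
  ∀ (q : Polynomial ℝ) (η : ℝ), (∀ t ∈ Set.Icc 0 ‖A‖, |q.eval t - φ t| ≤ η) →
    ‖Polynomial.aeval A q - B‖ ≤ η

open Classical in
/-- The operator `φ(A)` for a non-negative operator `A`. -/
noncomputable def opFun (φ : ℝ → ℝ) (A : E →L[ℝ] E) : E →L[ℝ] E :=
  if h : ∃ B, IsOpFun φ A B then h.choose else 0

/-- The power `A ^ s` of a non-negative operator, for `s > 0`. -/
noncomputable def opPow (A : E →L[ℝ] E) (s : ℝ) : E →L[ℝ] E := opFun (fun t => t ^ s) A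

/-- The regularized inverse square root `(ε I + A) ^ (-1/2)` of a non-negative operator. -/
noncomputable def regInvSqrt (ε : ℝ) (A : E →L[ℝ] E) : E →L[ℝ] E :=
  opFun (fun t => (ε + t) ^ (-(1 / 2) : ℝ)) A

/-- The orthogonal projection onto the closure of the range of an operator. -/
noncomputable def rangeProj (A : E →L[ℝ] E) : E →L[ℝ] E :=
  (LinearMap.range (A : E →ₗ[ℝ] E)).topologicalClosure.starProjection

/-- The Carleman-Fredholm determinant `det₂ (I + T)` of a self-adjoint Hilbert-Schmidt operator
`T`: the product of `(1 + μ) exp (-μ)` over the eigenvalues `μ` of `T`, repeated according to their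
multiplicities. All other real `μ` have a zero eigenspace and contribute the factor `1`, and so
does `μ = 0`. -/
noncomputable def det2 (T : E →L[ℝ] E) : ℝ :=
  ∏' μ : ℝ, ((1 + μ) * Real.exp (-μ)) ^
    Module.finrank ℝ (Module.End.eigenspace (T : E →ₗ[ℝ] E) μ)

end FunctionalCalculus

section OperatorMatrices

variable {p : ℕ}

/-- Operator matrices `[A i j]` with entries `A i j : H j → H i`. -/
abbrev OpMat (H : Fin p → Type*) [∀ j, NormedAddCommGroup (H j)]
    [∀ j, InnerProductSpace ℝ (H j)] : Type _ :=
  ∀ i j : Fin p, H j →L[ℝ] H i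

variable {H : Fin p → Type*} [∀ j, NormedAddCommGroup (H j)] [∀ j, InnerProductSpace ℝ (H j)]
  [∀ j, CompleteSpace (H j)]

/-- The canonical embedding of `H j` into the product Hilbert space. -/
noncomputable def incl (j : Fin p) : H j →L[ℝ] PiLp 2 H :=
  ((PiLp.continuousLinearEquiv 2 ℝ H).symm : (∀ j, H j) →L[ℝ] PiLp 2 H) ∘L
    ContinuousLinearMap.single ℝ H j

/-- The operator on the product Hilbert space given by an operator matrix. -/
noncomputable def toOp (A : OpMat H) : PiLp 2 H →L[ℝ] PiLp 2 H :=
  ∑ i, ∑ j, incl i ∘L A i j ∘L PiLp.proj 2 H j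

/-- The entries of an operator on the product Hilbert space. -/
noncomputable def blk (T : PiLp 2 H →L[ℝ] PiLp 2 H) : OpMat H :=
  fun i j => PiLp.proj 2 H i ∘L T ∘L incl j

/-- The off-diagonal part of an operator matrix. -/
noncomputable def offDiag (A : OpMat H) : OpMat H := fun i j => if i = j then 0 else A i j

/-- All entries, equivalently the operator on the product space, are Hilbert-Schmidt. -/
def IsHSMat (A : OpMat H) : Prop := ∀ i j, hsNorm (A i j) < ∞

/-- `B` is the correlation operator of the pair `(i, j)` for the covariance operator matrix `C`:
`C i j = (C i i)^(1/2) B (C j j)^(1/2)` and `B = Π i B Π j`, with `Π` the projections onto the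
closures of the ranges of the diagonal entries. -/
def IsCorr (C : OpMat H) (i j : Fin p) (B : H j →L[ℝ] H i) : Prop :=
  C i j = opPow (C i i) (1 / 2) ∘L B ∘L opPow (C j j) (1 / 2) ∧
    B = rangeProj (C i i) ∘L B ∘L rangeProj (C j j)

open Classical in
/-- The correlation operator matrix `R`, with identities on the diagonal. -/
noncomputable def corr (C : OpMat H) : OpMat H := fun i j =>
  if i = j then blk (1 : PiLp 2 H →L[ℝ] PiLp 2 H) i j
  else if h : ∃ B, IsCorr C i j B then h.choose else 0

/-- The precision operator `H* = R⁻¹ - I` on the product Hilbert space. -/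
noncomputable def precision (R : OpMat H) : PiLp 2 H →L[ℝ] PiLp 2 H := Ring.inverse (toOp R) - 1

open Classical in
/-- The set `S` of pairs of vertices that are adjacent in the graph, every vertex being adjacent to
itself. -/
noncomputable def edgeSet (R : OpMat H) : Finset (Fin p × Fin p) :=
  {e | e.1 = e.2 ∨ blk (precision R) e.1 e.2 ≠ 0}

/-- The maximum degree of the graph, every vertex being adjacent to itself. -/
noncomputable def maxDegree (S : Finset (Fin p × Fin p)) : ℕ :=
  Finset.univ.sup fun i : Fin p => (Finset.univ.filter fun j : Fin p => (i, j) ∈ S).card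

variable (H) in
/-- The space of Hilbert-Schmidt operators `H j → H i` in which the entry at `e = (i, j)` lives. -/
abbrev HSAt (e : Fin p × Fin p) : Type _ := HSOp (H e.2) (H e.1)

/-- The entry of `Γ = R ⊗ R : A ↦ R A R` at the pairs `e = (i, j)` and `e' = (k, l)`, that is,
`A ↦ R i k A R l j`. -/
noncomputable def gammaEntry (R : OpMat H) (e e' : Fin p × Fin p) : HSAt H e' →L[ℝ] HSAt H e :=
  sandwich (R e.1 e'.1) (R e'.2 e.2)

/-- The row `Γ_{eS}`. -/
noncomputable def gammaRow (R : OpMat H) (S : Finset (Fin p × Fin p)) (e : Fin p × Fin p) :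
    (∀ e' : S, HSAt H e'.1) →L[ℝ] HSAt H e :=
  ∑ e' : S, gammaEntry R e e'.1 ∘L ContinuousLinearMap.proj e'

/-- The submatrix `Γ_{SS}`, as an operator on arrays of Hilbert-Schmidt operators indexed by
`S`. -/
noncomputable def gammaSS (R : OpMat H) (S : Finset (Fin p × Fin p)) :
    (∀ e : S, HSAt H e.1) →L[ℝ] (∀ e : S, HSAt H e.1) :=
  ContinuousLinearMap.pi fun e => gammaRow R S e.1

/-- The sum of the norms of the entries of a row operator `L` indexed by `S`. Each entry is an
operator between spaces of Hilbert-Schmidt operators and is measured in its operator norm. -/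
noncomputable def rowSum {S : Finset (Fin p × Fin p)} {e : Fin p × Fin p}
    (L : (∀ e' : S, HSAt H e'.1) →L[ℝ] HSAt H e) : ℝ :=
  ∑ e' : S, ‖L ∘L ContinuousLinearMap.single ℝ (fun e' : S => HSAt H e'.1) e'‖

/-- Incoherence: each row of `Γ_{SᶜS} Γ_{SS}⁻¹` has norm at most `1 - α`. -/
def Incoherence (R : OpMat H) (α : ℝ) : Prop :=
  ∀ e ∉ edgeSet R,
    rowSum (gammaRow R (edgeSet R) e ∘L Ring.inverse (gammaSS R (edgeSet R))) ≤ 1 - α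

/-- `γ = 1 + |||Λ_{SS}|||`, the maximal row sum of `Λ_{SS} = Γ_{SS}⁻¹ - I` plus one. -/
noncomputable def gammaConst (R : OpMat H) : ℝ :=
  1 + ⨆ e : edgeSet R, rowSum (ContinuousLinearMap.proj e ∘L
    (Ring.inverse (gammaSS R (edgeSet R)) - 1))

/-- `ρ = 1 + |||R₀|||`, the maximal row sum of the Hilbert-Schmidt norms plus one. -/
noncomputable def rhoConst (R : OpMat H) : ℝ :=
  1 + ⨆ i, ∑ j, (hsNorm (offDiag R i j)).toReal

/-- The largest Hilbert-Schmidt norm of an off-diagonal entry. -/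
noncomputable def maxOff (A : OpMat H) : ℝ := ⨆ i, ⨆ j, (hsNorm (offDiag A i j)).toReal

/-- The constant `κ`. -/
noncomputable def kappaConst (C Φ : OpMat H) : ℝ :=
  16 * √2 * max (max 1 (maxOff (corr C))) (maxOff Φ * max 2 (2 * ⨆ j, ‖C j j‖))

/-- Regularity: `R₀ = (dg C)^β Φ (dg C)^β` with `Φ` Hilbert-Schmidt with zero diagonal. -/
def Regularity (C : OpMat H) (β : ℝ) (Φ : OpMat H) : Prop :=
  0 < β ∧ β ≤ 1 ∧ IsHSMat Φ ∧ (∀ j, Φ j j = 0) ∧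
    ∀ i j, offDiag (corr C) i j = opPow (C i i) β ∘L Φ i j ∘L opPow (C j j) β

/-- Eigenvalue gap: `R₀` is Hilbert-Schmidt and `1 + μ` is bounded away from `0` over the
eigenvalues `μ` of `R₀`. -/
def EigenvalueGap (R : OpMat H) : Prop :=
  IsHSMat (offDiag R) ∧ ∃ c > 0, ∀ μ : ℝ,
    Module.End.HasEigenvalue (toOp (offDiag R) : PiLp 2 H →ₗ[ℝ] PiLp 2 H) μ → c ≤ 1 + μ

/-- The regularized estimator `R̂` of the correlation operator matrix. -/
noncomputable def corrEst (ε : ℝ) (Chat : OpMat H) : OpMat H := fun i j =>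
  if i = j then blk (1 : PiLp 2 H →L[ℝ] PiLp 2 H) i j
  else regInvSqrt ε (Chat i i) ∘L Chat i j ∘L regInvSqrt ε (Chat j j)

/-- The set over which the objective is minimized: self-adjoint Hilbert-Schmidt operators `T` on
the product space with `I + T > 0`. -/
def Feasible (T : PiLp 2 H →L[ℝ] PiLp 2 H) : Prop :=
  IsSelfAdjoint T ∧ hsNorm T < ∞ ∧ ∀ x, x ≠ 0 → 0 < inner ℝ x (x + T x)

/-- The objective `tr (T R̂₀) - log det₂ (I + T) + lam * ‖T₀‖_{2,1}`, where `tr (T R̂₀)` is the sum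
over `i ≠ j` of `tr (T i j (R̂ i j)*)`. -/
noncomputable def objective (Rhat : OpMat H) (lam : ℝ) (T : PiLp 2 H →L[ℝ] PiLp 2 H) : ℝ :=
  (∑ i, ∑ j, hsInner (offDiag (blk T) i j) (offDiag Rhat i j)) - Real.log (det2 T) +
    lam * ∑ i, ∑ j, (hsNorm (offDiag (blk T) i j)).toReal

/-- `T` minimizes the objective. -/
def IsMinimizer (Rhat : OpMat H) (lam : ℝ) (T : PiLp 2 H →L[ℝ] PiLp 2 H) : Prop :=
  Feasible T ∧ ∀ T', Feasible T' → objective Rhat lam T ≤ objective Rhat lam T'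

end OperatorMatrices

section Probability

variable {p : ℕ} {H : Fin p → Type*} [∀ j, NormedAddCommGroup (H j)]
  [∀ j, InnerProductSpace ℝ (H j)] [∀ j, CompleteSpace (H j)]
  {Ω : Type*} [MeasurableSpace Ω]

/-- The covariance operator matrix `C i j = E[(X i - E X i) ⊗ (X j - E X j)]`, where
`(u ⊗ v) w = ⟪v, w⟫ u`. -/
noncomputable def covOp (P : Measure Ω) (X : Ω → PiLp 2 H) : OpMat H := fun i j =>
  ∫ ω, InnerProductSpace.rankOne ℝ (X ω i - ∫ ω', X ω' i ∂P) (X ω j - ∫ ω', X ω' j ∂P) ∂P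

/-- `X` is Gaussian and its law is equivalent (mutually absolutely continuous) to the product of
the laws of its components. -/
def GaussianEquivalence [∀ j, MeasurableSpace (H j)] (P : Measure Ω) (X : Ω → PiLp 2 H) : Prop :=
  IsGaussian (P.map fun ω j => X ω j) ∧
    P.map (fun ω j => X ω j) ≪ Measure.pi (fun j => P.map fun ω => X ω j) ∧
    Measure.pi (fun j => P.map fun ω => X ω j) ≪ P.map fun ω j => X ω j

/-- The tail condition with parameters `f` and `δs` for estimators `Chat n` of `C`. -/
def TailCondition (P : Measure Ω) (C : OpMat H) (Chat : ℕ → Ω → OpMat H) (f : ℕ → ℝ → ℝ)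
    (δs : ℝ) : Prop :=
  ∀ n, 1 ≤ n → ∀ δ, 0 < δ → δ < δs → ∀ i j,
    P {ω | ENNReal.ofReal δ ≤ hsNorm (Chat n ω i j - C i j)} ≤ (ENNReal.ofReal (f n δ))⁻¹

/-- `f : ℕ × (0, ∞) → [0, ∞)` is monotonically increasing in both arguments. -/
def IsTailFunction (f : ℕ → ℝ → ℝ) : Prop :=
  (∀ n δ, 0 < δ → 0 ≤ f n δ) ∧
    (∀ n m δ, 0 < δ → n ≤ m → f n δ ≤ f m δ) ∧
    ∀ n δ δ', 0 < δ → δ ≤ δ' → f n δ ≤ f n δ'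

/-- `max {n | f n δ ≤ r}`, equal to `⊤` if there are arbitrarily large such `n`. -/
noncomputable def nBar (f : ℕ → ℝ → ℝ) (δ r : ℝ) : ℕ∞ := ⨆ n ∈ {n : ℕ | f n δ ≤ r}, (n : ℕ∞)

/-- `d` is the maximum of `{δ > 0 | f n δ ≤ r}`. -/
def IsDeltaBar (f : ℕ → ℝ → ℝ) (n : ℕ) (r d : ℝ) : Prop := IsGreatest {δ : ℝ | 0 < δ ∧ f n δ ≤ r} d

end Probability

end FGL

/-! The argument is a primal-dual witness construction for operator-valued entries. Write `η = δbar
^ (β/(1+β))`, and let `W` be the symmetric part of the error `R̂₀ - R₀`.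

Stationarity. For a candidate `Ĥ = H* + Δ` with `Δ` supported in `S`, put `J = (R⁻¹ + Δ)⁻¹`. Since
`JΔR = R - J`, and since the gradient of `-log det₂(I + H)` is `I - (I + H)⁻¹`, the optimality
condition becomes `JΔR + W + Y = 0`. Here `Y` has zero diagonal, `‖Y_ij‖₂ ≤ λ`, and `⟨Ĥ, Y⟩` equals
`λ` times the penalty sum of `Ĥ`. Klein's inequality for `-log det₂`, together with its equality
case (`log_det2_le`), shows that such a pair makes `Ĥ` the unique minimizer
(`isMinimizer_of_certificate`). No abstract existence theorem for minimizers is needed.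

Construction of the pair. On `S` put `Y = λZ` with `Z` in the convex set `dualSet S`. For fixed `Z`,
writing `JΔR = RΔR - (R-J)ΔR` turns the equations on `S` into `Γ_SS Δ = remainder - (W + λZ)`. The
remainder is quadratic in `Δ`, so Banach's theorem solves this in the ball of radius `r = 2γ(κη +
λ)` (`exists_gradient_eq`). It remains to choose `Z` so that it is paired optimally with `H* +
Δ(Z)`. This is a variational inequality for `Z ↦ -(H* + Δ(Z))`, and the identity `JΔR - J'Δ'R = J(Δ
- Δ')J'` makes that map cocoercive and expansive, so a projected iteration converges
(`exists_restricted_solution`). Outside `S` the condition dictates `Y = -(W + JΔR)`, and incoherence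
keeps its entries within `λ` (`norm_hblk_off_le`). The error bound is `‖Δ‖ ≤ r`, and an entry of
`H*` larger than `r` cannot be estimated by zero.

Invertibility of `R`. By regularity `R = I + R₀` with `R₀` Hilbert-Schmidt, so `R` is diagonal in an
eigenbasis and is coercive as soon as its eigenvalues are positive and bounded away from zero. This
is immediate under the eigenvalue condition. Under equivalence of laws, `R_ij = U_i* U_j`, where
`U_j` is a contraction into the centered functions of `X_j`. A null vector of `R` gives `∑ g_j(X_j)
= 0` almost surely; this persists under the product law, where independence forces every `g_j` to
vanish (`corr_covOp`).

Statistical error. The choice of `ε` balances the variance `δbar/ε` against the bias `ε^β`; both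
equal `η`. Regularity and a Schur multiplier estimate then give `‖R̂_ij - R_ij‖₂ ≤ κη`
(`norm_estimator_sub_le`) whenever all entries of the covariance estimator are within `δbar`. A
union bound over the `p²` entries controls the exceptional event (`exists_accurate_event`). -/

namespace FGL

/-! ### The Hilbert space of Hilbert-Schmidt operators -/

section HilbertSchmidtSpace

variable {E F G : Type*}
  [NormedAddCommGroup E] [InnerProductSpace ℝ E] [CompleteSpace E]
  [NormedAddCommGroup F] [InnerProductSpace ℝ F] [CompleteSpace F]
  [NormedAddCommGroup G] [InnerProductSpace ℝ G] [CompleteSpace G]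

noncomputable instance : InnerProductSpace ℝ (HSOp E F) where
  inner A B := inner ℝ (HSOp.toL2 A) (HSOp.toL2 B)
  norm_sq_eq_re_inner A := norm_sq_eq_re_inner (𝕜 := ℝ) (HSOp.toL2 A)
  conj_inner_symm A B := inner_conj_symm _ _
  add_left A B C := by rw [map_add, inner_add_left]
  smul_left A B r := by rw [map_smul, inner_smul_left]

theorem HSOp.inner_eq (A B : HSOp E F) : inner ℝ A B = hsInner A.toCLM B.toCLM := by
  have : inner ℝ A B = inner ℝ (HSOp.toL2 A) (HSOp.toL2 B) := rfl
  rw [this, lp.inner_eq_tsum]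
  rfl

theorem hsNorm_zero : hsNorm (0 : E →L[ℝ] F) = 0 := by simp [hsNorm]

theorem HSOp.enorm_eq (A : HSOp E F) : ‖A‖ₑ = hsNorm A.toCLM := by
  rw [← A.ofReal_norm_eq, ofReal_norm]

theorem HSOp.norm_le_iff (A : HSOp E F) {m : ℝ} (hm : 0 ≤ m) :
    ‖A‖ ≤ m ↔ hsNorm A.toCLM ≤ ENNReal.ofReal m := by
  rw [← A.ofReal_norm_eq, ENNReal.ofReal_le_ofReal_iff hm]

/-- The bounded operator norm is dominated by the Hilbert-Schmidt norm. -/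
theorem enorm_le_hsNorm (A : E →L[ℝ] F) : ‖A‖ₑ ≤ hsNorm A := by
  rcases eq_or_ne (hsNorm A) ∞ with h | h
  · rw [h]; exact le_top
  have key : ∀ x, ‖A x‖ ≤ (hsNorm A).toReal * ‖x‖ := by
    intro x
    rcases eq_or_ne x 0 with rfl | hx
    · simp
    -- Testing `A` on the rank-one operator `x ⊗ x` produces `Ax ⊗ x`, whose Hilbert-Schmidt norm is
    -- at least `‖Ax‖ ‖x‖`.
    have h1 := hsNorm_comp_right A (InnerProductSpace.rankOne ℝ x x)
    have h2 : ‖A x‖ₑ * ‖x‖ₑ ≤ hsNorm (A ∘L InnerProductSpace.rankOne ℝ x x) := by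
      have e : A ∘L InnerProductSpace.rankOne ℝ x x = InnerProductSpace.rankOne ℝ (A x) x := by
        ext y; simp
      rw [e]
      refine (ENNReal.pow_le_pow_left_iff two_ne_zero).1 ?_
      rw [hsNorm_sq, mul_pow, ← parseval_enorm (onb E) x, ← ENNReal.tsum_mul_left]
      refine ENNReal.tsum_le_tsum fun k => ?_
      rw [InnerProductSpace.rankOne_apply, enorm_smul, mul_pow, mul_comm, real_inner_comm]
    have h3 : ‖A x‖ₑ * ‖x‖ₑ ≤ hsNorm A * (‖x‖ₑ * ‖x‖ₑ) := by
      refine h2.trans (h1.trans_eq ?_)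
      congr 1
      rw [← ofReal_norm, InnerProductSpace.norm_rankOne, ENNReal.ofReal_mul (norm_nonneg _),
        ofReal_norm]
    have h4 := ENNReal.toReal_mono (by finiteness) h3
    simp only [ENNReal.toReal_mul, toReal_enorm] at h4
    have hx' : 0 < ‖x‖ := norm_pos_iff.2 hx
    nlinarith
  have := A.opNorm_le_bound ENNReal.toReal_nonneg key
  rw [← ofReal_norm]
  exact (ENNReal.ofReal_le_ofReal this).trans (ENNReal.ofReal_toReal h).le

theorem HSOp.opNorm_le (A : HSOp E F) : ‖A.toCLM‖ ≤ ‖A‖ := by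
  have := enorm_le_hsNorm A.toCLM
  rw [← A.ofReal_norm_eq, ← ofReal_norm] at this
  exact (ENNReal.ofReal_le_ofReal_iff (norm_nonneg _)).1 this

variable (E F) in
/-- The inclusion of the Hilbert-Schmidt operators into the bounded operators. -/
noncomputable def HSOp.toCLML : HSOp E F →L[ℝ] (E →L[ℝ] F) :=
  LinearMap.mkContinuous HSOp.toCLM 1 (fun A => by rw [one_mul]; exact A.opNorm_le)

/-- A Cauchy sequence has a limit in operator norm and a limit of its columns in `ℓ²`. The two agree
on the basis, so the operator limit is itself Hilbert-Schmidt. -/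
instance : CompleteSpace (HSOp E F) := by
  refine Metric.complete_of_cauchySeq_tendsto fun u hu => ?_
  let L : HSOp E F →ₗᵢ[ℝ] lp (fun _ : onbIndex E => F) 2 := ⟨HSOp.toL2, fun _ => rfl⟩
  obtain ⟨A, hA⟩ := cauchySeq_tendsto_of_complete
    ((HSOp.toCLML E F).uniformContinuous.comp_cauchySeq hu)
  obtain ⟨v, hv⟩ := cauchySeq_tendsto_of_complete (L.isometry.uniformContinuous.comp_cauchySeq hu)
  have hvA : ∀ k, v k = A (onb E k) := by
    intro k
    have h1 := ((lp.evalCLM ℝ (fun _ : onbIndex E => F) 2 k).continuous.tendsto v).comp hv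
    have h2 := ((ContinuousLinearMap.apply ℝ F (onb E k)).continuous.tendsto A).comp hA
    exact tendsto_nhds_unique h1 h2
  have hfin : hsNorm A < ∞ := by
    have h := lp.memℓp v
    rw [memℓp_gen_iff (by norm_num)] at h
    refine (ENNReal.pow_lt_top_iff.1 (?_ : hsNorm A ^ 2 < ∞)).resolve_right two_ne_zero
    rw [hsNorm_sq]
    simp only [hvA, ENNReal.toReal_ofNat, Real.rpow_two] at h
    have := ENNReal.ofReal_tsum_of_nonneg (fun _ => by positivity) h
    simp only [ENNReal.ofReal_pow (norm_nonneg _), ofReal_norm] at this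
    rw [← this]
    exact ENNReal.ofReal_lt_top
  refine ⟨HSOp.mk A hfin, L.isometry.isUniformInducing.isInducing.tendsto_nhds_iff.2 ?_⟩
  have : L (HSOp.mk A hfin) = v := by
    ext k
    exact (hvA k).symm
  rwa [this]

theorem HSOp.hasSum_norm_sq {κ : Type*} (b : HilbertBasis κ ℝ E) (A : HSOp E F) :
    HasSum (fun k => ‖A.toCLM (b k)‖ ^ 2) (‖A‖ ^ 2) := by
  have h : hsNorm A.toCLM ^ 2 = ∑' k, ‖A.toCLM (b k)‖ₑ ^ 2 := by
    rw [hsNorm_eq b, ← ENNReal.rpow_natCast, ← ENNReal.rpow_mul]; norm_num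
  have hfin : ∑' k, ‖A.toCLM (b k)‖ₑ ^ 2 ≠ ∞ := by
    rw [← h]; exact (ENNReal.pow_lt_top A.hsNorm_lt_top).ne
  have h2 := ENNReal.hasSum_toReal hfin
  rw [← ENNReal.tsum_toReal_eq (fun k => by finiteness), ← h, ← A.enorm_eq] at h2
  simpa using h2

/-- Polarization transfers basis independence from the norm to the inner product. -/
theorem HSOp.hasSum_inner {κ : Type*} (b : HilbertBasis κ ℝ E) (A B : HSOp E F) :
    HasSum (fun k => (inner ℝ (A.toCLM (b k)) (B.toCLM (b k)) : ℝ)) (inner ℝ A B) := by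
  have h := ((HSOp.hasSum_norm_sq b (A + B)).sub (HSOp.hasSum_norm_sq b (A - B))).div_const 4
  have e1 : (fun k => (inner ℝ (A.toCLM (b k)) (B.toCLM (b k)) : ℝ)) =
      fun k => (‖(A + B).toCLM (b k)‖ ^ 2 - ‖(A - B).toCLM (b k)‖ ^ 2) / 4 := by
    funext k
    rw [map_add, map_sub, _root_.add_apply, _root_.sub_apply,
      norm_add_sq_real, norm_sub_sq_real]
    ring
  have e2 : (inner ℝ A B : ℝ) = (‖A + B‖ ^ 2 - ‖A - B‖ ^ 2) / 4 := by
    rw [norm_add_sq_real, norm_sub_sq_real]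
    ring
  rw [e1, e2]
  exact h

variable (E F) in
/-- The adjoint, as a linear isometry between spaces of Hilbert-Schmidt operators. -/
noncomputable def HSOp.adj : HSOp E F →ₗᵢ[ℝ] HSOp F E where
  toFun A := HSOp.mk (ContinuousLinearMap.adjoint A.toCLM) (by
    rw [hsNorm_adjoint]; exact A.hsNorm_lt_top)
  map_add' A B := HSOp.toCLM_injective (by simp)
  map_smul' c A := HSOp.toCLM_injective (by simp)
  norm_map' A := by
    rw [HSOp.norm_eq, HSOp.norm_eq]
    simp [hsNorm_adjoint]

@[simp] theorem HSOp.adj_toCLM (A : HSOp E F) :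
    (HSOp.adj E F A).toCLM = ContinuousLinearMap.adjoint A.toCLM := rfl

variable {E' F' : Type*}
  [NormedAddCommGroup E'] [InnerProductSpace ℝ E'] [CompleteSpace E']
  [NormedAddCommGroup F'] [InnerProductSpace ℝ F'] [CompleteSpace F']

@[simp] theorem sandwich_toCLM (B : F →L[ℝ] F') (C : E' →L[ℝ] E) (A : HSOp E F) :
    (sandwich B C A).toCLM = B ∘L A.toCLM ∘L C := rfl

theorem norm_sandwich_le (B : F →L[ℝ] F') (C : E' →L[ℝ] E) : ‖sandwich B C‖ ≤ ‖B‖ * ‖C‖ :=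
  LinearMap.mkContinuous_norm_le _ (by positivity) _

theorem norm_sandwich_apply_le (B : F →L[ℝ] F') (C : E' →L[ℝ] E) (A : HSOp E F) :
    ‖sandwich B C A‖ ≤ ‖B‖ * ‖A‖ * ‖C‖ := by
  refine ((sandwich B C).le_of_opNorm_le (norm_sandwich_le B C) A).trans_eq ?_
  ring

theorem inner_sandwich_left (B : F →L[ℝ] F') (A : HSOp E F) (D : HSOp E F') :
    inner ℝ (sandwich B (ContinuousLinearMap.id ℝ E) A) D =
      inner ℝ A (sandwich (ContinuousLinearMap.adjoint B) (ContinuousLinearMap.id ℝ E) D) := by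
  refine (HSOp.hasSum_inner (onb E) _ _).unique ?_
  convert HSOp.hasSum_inner (onb E) A _ using 2
  simp [ContinuousLinearMap.adjoint_inner_right]

theorem adj_sandwich (B : F →L[ℝ] F') (C : E' →L[ℝ] E) (A : HSOp E F) :
    HSOp.adj _ _ (sandwich B C A) = sandwich (ContinuousLinearMap.adjoint C)
      (ContinuousLinearMap.adjoint B) (HSOp.adj _ _ A) := by
  apply HSOp.toCLM_injective
  simp [ContinuousLinearMap.adjoint_comp, ContinuousLinearMap.comp_assoc]

theorem sandwich_sandwich {E'' F'' : Type*}
    [NormedAddCommGroup E''] [InnerProductSpace ℝ E''] [CompleteSpace E'']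
    [NormedAddCommGroup F''] [InnerProductSpace ℝ F''] [CompleteSpace F'']
    (B' : F' →L[ℝ] F'') (C' : E'' →L[ℝ] E') (B : F →L[ℝ] F') (C : E' →L[ℝ] E) (A : HSOp E F) :
    sandwich B' C' (sandwich B C A) = sandwich (B' ∘L B) (C ∘L C') A := by
  apply HSOp.toCLM_injective
  simp [ContinuousLinearMap.comp_assoc]

/-- The left factor moves across termwise in a basis sum. The right factor becomes a left factor
after applying the adjoint, which is an isometry of Hilbert-Schmidt operators. -/
theorem inner_sandwich (B : F →L[ℝ] F') (C : E' →L[ℝ] E) (A : HSOp E F) (D : HSOp E' F') :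
    inner ℝ (sandwich B C A) D =
      inner ℝ A (sandwich (ContinuousLinearMap.adjoint B) (ContinuousLinearMap.adjoint C) D) := by
  have e1 : sandwich B C A = sandwich B (ContinuousLinearMap.id ℝ E')
      (sandwich (ContinuousLinearMap.id ℝ F) C A) := by
    rw [sandwich_sandwich]; rfl
  rw [e1, inner_sandwich_left, ← LinearIsometry.inner_map_map (HSOp.adj E' F), adj_sandwich]
  have e2 : ContinuousLinearMap.adjoint (ContinuousLinearMap.id ℝ F) = ContinuousLinearMap.id ℝ F :=
    ContinuousLinearMap.adjoint_id
  rw [e2, inner_sandwich_left, adj_sandwich, sandwich_sandwich,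
    ← LinearIsometry.inner_map_map (HSOp.adj E F), adj_sandwich]
  have e3 : ContinuousLinearMap.adjoint (ContinuousLinearMap.id ℝ E') =
    ContinuousLinearMap.id ℝ E' := ContinuousLinearMap.adjoint_id
  simp [e3]

open Classical in
/-- Hilbert-Schmidt operators are compact. -/
theorem HSOp.isCompactOperator (A : HSOp E F) : IsCompactOperator A.toCLM := by
  let b := onb E
  let AF : Finset (onbIndex E) → (E →L[ℝ] F) :=
    fun s => ∑ k ∈ s, InnerProductSpace.rankOne ℝ (A.toCLM (b k)) (b k)
  have hr : ∀ k l, InnerProductSpace.rankOne ℝ (A.toCLM (b k)) (b k) (b l) =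
      (if l = k then A.toCLM (b k) else 0 : F) := by
    intro k l
    rw [InnerProductSpace.rankOne_apply, orthonormal_iff_ite.1 b.orthonormal]
    simp only [eq_comm (a := l)]
    split_ifs with h1 <;> simp [h1]
  have hv : ∀ s l, (A.toCLM - AF s) (b l) = if l ∈ s then 0 else A.toCLM (b l) := by
    intro s l
    simp only [AF, _root_.sub_apply, _root_.sum_apply, hr, Finset.sum_ite_eq]
    split_ifs <;> simp
  -- Truncating to finitely many basis vectors leaves the tail of a convergent series of squares, so
  -- finite rank operators approximate `A`.
  have hHS : ∀ s, hsNorm (A.toCLM - AF s) ^ 2 ≤ 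
      ENNReal.ofReal (‖A‖ ^ 2 - ∑ k ∈ s, ‖A.toCLM (b k)‖ ^ 2) := by
    intro s
    have h1 := HSOp.hasSum_norm_sq b A
    have h2 : HasSum (fun k => if k ∈ s then ‖A.toCLM (b k)‖ ^ 2 else 0)
        (∑ k ∈ s, ‖A.toCLM (b k)‖ ^ 2) := by
      have := hasSum_sum_of_ne_finset_zero (f := fun k => if k ∈ s then ‖A.toCLM (b k)‖ ^ 2 else 0)
        (s := s) (L := .unconditional _) (fun k hk => by simp [hk])
      rwa [Finset.sum_congr rfl (fun k hk => by rw [if_pos hk])] at this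
    have h3 : HasSum (fun k => ‖A.toCLM (b k)‖ ^ 2 - if k ∈ s then ‖A.toCLM (b k)‖ ^ 2 else 0) _ :=
      h1.sub h2
    rw [hsNorm_sq, ← h3.tsum_eq, ENNReal.ofReal_tsum_of_nonneg _ h3.summable]
    · refine ENNReal.tsum_le_tsum fun k => ?_
      change ‖(A.toCLM - AF s) (b k)‖ₑ ^ 2 ≤ _
      rw [hv]
      split_ifs
      · simp
      · rw [sub_zero, ENNReal.ofReal_pow (norm_nonneg _), ofReal_norm]
    · intro k
      split_ifs <;> simp
  refine isCompactOperator_of_tendsto (F := AF) (l := Filter.atTop) ?_ (.of_forall fun s => ?_)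
  · rw [tendsto_iff_norm_sub_tendsto_zero]
    have h0 : Filter.Tendsto (fun s : Finset (onbIndex E) =>
        √(‖A‖ ^ 2 - ∑ k ∈ s, ‖A.toCLM (b k)‖ ^ 2)) Filter.atTop (nhds 0) := by
      have h1 : Filter.Tendsto (fun s : Finset (onbIndex E) => ∑ k ∈ s, ‖A.toCLM (b k)‖ ^ 2)
        Filter.atTop (nhds (‖A‖ ^ 2)) := HSOp.hasSum_norm_sq b A
      have := (tendsto_const_nhds (x := ‖A‖ ^ 2)).sub h1 |>.sqrt
      simpa using this
    refine squeeze_zero (fun _ => norm_nonneg _) (fun s => ?_) h0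
    refine Real.le_sqrt_of_sq_le ?_
    have h1 : ‖A.toCLM - AF s‖ₑ ^ 2 ≤ _ := (pow_le_pow_left' (enorm_le_hsNorm _) 2).trans (hHS s)
    have h2 : 0 ≤ ‖A‖ ^ 2 - ∑ k ∈ s, ‖A.toCLM (b k)‖ ^ 2 := by
      have h3 := HSOp.hasSum_norm_sq b A
      have h4 : ∑ k ∈ s, ‖A.toCLM (b k)‖ ^ 2 ≤ ‖A‖ ^ 2 :=
        sum_le_hasSum s (fun _ _ => by positivity) h3
      linarith
    rw [← ofReal_norm, ← ENNReal.ofReal_pow (norm_nonneg _), ENNReal.ofReal_le_ofReal_iff h2,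
      norm_sub_rev] at h1
    exact h1
  · have h1 : ∀ k ∈ s, InnerProductSpace.rankOne ℝ (A.toCLM (b k)) (b k) ∈
        compactOperator (RingHom.id ℝ) E F := by
      intro k _
      have h2 : IsCompactOperator (_root_.id : ℝ → ℝ) :=
        (isCompactOperator_id_iff_finiteDimensional (𝕜 := ℝ)).2 inferInstance
      exact (h2.comp_clm (innerSL ℝ (b k))).clm_comp
        (ContinuousLinearMap.toSpanSingleton ℝ (A.toCLM (b k)))
    exact (compactOperator (RingHom.id ℝ) E F).sum_mem h1

end HilbertSchmidtSpace

/-! ### Operators diagonal in a Hilbert basis and their functional calculus -/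

section Diagonal

variable {E F : Type*}
  [NormedAddCommGroup E] [InnerProductSpace ℝ E] [CompleteSpace E]
  [NormedAddCommGroup F] [InnerProductSpace ℝ F] [CompleteSpace F]
  {κ ν : Type*}

/-- The operator `A` is diagonal in the Hilbert basis `b`, with eigenvalues `l`. -/
def IsDiag (b : HilbertBasis κ ℝ E) (A : E →L[ℝ] E) (l : κ → ℝ) : Prop :=
  ∀ k, A (b k) = l k • b k

theorem ext_hilbertBasis (b : HilbertBasis κ ℝ E) {A B : E →L[ℝ] F} (h : ∀ k, A (b k) = B (b k)) :
    A = B := by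
  have hd : Dense (Submodule.span ℝ (Set.range b) : Set E) := by
    rw [Submodule.dense_iff_topologicalClosure_eq_top]; exact b.dense_span
  refine ContinuousLinearMap.ext_on hd ?_
  rintro _ ⟨k, rfl⟩
  exact h k

theorem inner_basis_self (b : HilbertBasis κ ℝ E) (k : κ) : inner ℝ (b k) (b k) = (1 : ℝ) := by
  rw [real_inner_self_eq_norm_sq, b.orthonormal.1 k]; norm_num

theorem hasSum_inner_sq (b : HilbertBasis κ ℝ E) (x : E) :
    HasSum (fun k => (inner ℝ (b k) x : ℝ) ^ 2) (‖x‖ ^ 2) := by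
  have h := b.hasSum_inner_mul_inner x x
  rw [real_inner_self_eq_norm_sq] at h
  have e : (fun k => (inner ℝ (b k) x : ℝ) ^ 2) = fun k => (inner ℝ x (b k) : ℝ) * inner ℝ (b k) x := by
    funext k
    rw [real_inner_comm]; ring
  rw [e]; exact h

namespace IsDiag

variable {b : HilbertBasis κ ℝ E} {A B : E →L[ℝ] E} {l m : κ → ℝ}

theorem eq_of (hA : IsDiag b A l) (hB : IsDiag b B l) : A = B :=
  ext_hilbertBasis b fun k => by rw [hA k, hB k]

/-- Both sides are continuous functionals of `x` that agree on the basis; self-adjointness is a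
consequence, not an assumption. -/
theorem inner_apply (hA : IsDiag b A l) (k : κ) (x : E) :
    inner ℝ (b k) (A x) = l k * (inner ℝ (b k) x : ℝ) := by
  classical
  have h : (innerSL ℝ (b k)) ∘L A = l k • innerSL ℝ (b k) := by
    refine ext_hilbertBasis b fun j => ?_
    have h1 := orthonormal_iff_ite.1 b.orthonormal k j
    simp only [ContinuousLinearMap.comp_apply, innerSL_apply_apply, hA j, inner_smul_right, h1,
      FunLike.coe_smul, Pi.smul_apply, smul_eq_mul]
    split_ifs with h2 <;> simp [h2]
  have := congrArg (fun T => T x) h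
  simpa using this

theorem isSelfAdjoint (hA : IsDiag b A l) : IsSelfAdjoint A := by
  rw [ContinuousLinearMap.isSelfAdjoint_iff']
  refine ext_hilbertBasis b fun k => ext_inner_right ℝ fun x => ?_
  rw [ContinuousLinearMap.adjoint_inner_left, hA.inner_apply, hA k, inner_smul_left]
  rfl

theorem mul (hA : IsDiag b A l) (hB : IsDiag b B m) : IsDiag b (A ∘L B) (fun k => l k * m k) := by
  intro k
  rw [ContinuousLinearMap.comp_apply, hB k, map_smul, hA k, smul_smul, mul_comm]

theorem add (hA : IsDiag b A l) (hB : IsDiag b B m) : IsDiag b (A + B) (fun k => l k + m k) := by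
  intro k
  rw [_root_.add_apply, hA k, hB k, add_smul]

theorem sub (hA : IsDiag b A l) (hB : IsDiag b B m) : IsDiag b (A - B) (fun k => l k - m k) := by
  intro k
  rw [_root_.sub_apply, hA k, hB k, sub_smul]

theorem one (b : HilbertBasis κ ℝ E) : IsDiag b (1 : E →L[ℝ] E) (fun _ => 1) := by
  intro k; simp

theorem norm_le (hA : IsDiag b A l) {M : ℝ} (hM : 0 ≤ M) (h : ∀ k, |l k| ≤ M) : ‖A‖ ≤ M := by
  refine A.opNorm_le_bound hM fun x => ?_
  refine le_of_sq_le_sq ?_ (by positivity)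
  rw [mul_pow]
  refine hasSum_le (fun k => ?_) (hasSum_inner_sq b (A x)) ((hasSum_inner_sq b x).mul_left (M ^ 2))
  rw [hA.inner_apply, mul_pow]
  refine mul_le_mul_of_nonneg_right ?_ (sq_nonneg _)
  rw [← sq_abs (l k)]
  exact pow_le_pow_left₀ (abs_nonneg _) (h k) 2

theorem hasSum_inner (hA : IsDiag b A l) (x : E) :
    HasSum (fun k => l k * (inner ℝ (b k) x : ℝ) ^ 2) (inner ℝ x (A x)) := by
  have h := b.hasSum_inner_mul_inner x (A x)
  have e : (fun k => l k * (inner ℝ (b k) x : ℝ) ^ 2) =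
      fun k => (inner ℝ x (b k) : ℝ) * inner ℝ (b k) (A x) := by
    funext k
    rw [hA.inner_apply, real_inner_comm]; ring
  rw [e]; exact h

theorem le_inner (hA : IsDiag b A l) {c : ℝ} (h : ∀ k, c ≤ l k) (x : E) :
    c * ‖x‖ ^ 2 ≤ inner ℝ x (A x) :=
  hasSum_le (fun k => mul_le_mul_of_nonneg_right (h k) (sq_nonneg _))
    ((hasSum_inner_sq b x).mul_left c) (hA.hasSum_inner x)

theorem eigenvalue_eq (hA : IsDiag b A l) (k : κ) : inner ℝ (b k) (A (b k)) = l k := by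
  rw [hA k, inner_smul_right, inner_basis_self, mul_one]

theorem abs_le_norm (hA : IsDiag b A l) (k : κ) : |l k| ≤ ‖A‖ := by
  have := A.le_opNorm (b k)
  rwa [hA k, norm_smul, b.orthonormal.1 k, mul_one, mul_one, Real.norm_eq_abs] at this

theorem nonneg (hA : IsDiag b A l) (hpos : A.IsPositive) (k : κ) : 0 ≤ l k := by
  rw [← hA.eigenvalue_eq k]
  exact hpos.inner_nonneg_right _

theorem mem_Icc (hA : IsDiag b A l) (hpos : A.IsPositive) (k : κ) : l k ∈ Set.Icc 0 ‖A‖ :=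
  ⟨hA.nonneg hpos k, (le_abs_self _).trans (hA.abs_le_norm k)⟩

theorem aeval (hA : IsDiag b A l) (q : Polynomial ℝ) :
    IsDiag b (Polynomial.aeval A q) (fun k => q.eval (l k)) := by
  induction q using Polynomial.induction_on' with
  | add p q hp hq =>
    simp only [map_add, Polynomial.eval_add]
    exact hp.add hq
  | monomial n a =>
    intro k
    have hpow : ∀ n : ℕ, (A ^ n) (b k) = (l k) ^ n • b k := by
      intro n
      induction n with
      | zero => simp
      | succ n ih => rw [pow_succ', mul_apply_eq_comp, ih, map_smul, hA k, smul_smul,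
          pow_succ]
    beta_reduce
    rw [Polynomial.aeval_monomial, Polynomial.eval_monomial, mul_apply_eq_comp, hpow,
      Algebra.algebraMap_eq_smul_one, FunLike.coe_smul, Pi.smul_apply,
      one_apply_eq_self, smul_smul]

end IsDiag

/-- The operator that is diagonal in the basis `b` with bounded eigenvalues `l`. -/
theorem exists_isDiag (b : HilbertBasis κ ℝ E) (l : κ → ℝ) {M : ℝ} (hM : ∀ k, |l k| ≤ M) :
    ∃ A : E →L[ℝ] E, IsDiag b A l := by
  classical
  have hmem : ∀ x : lp (fun _ : κ => ℝ) 2, Memℓp (fun k => l k * x k) 2 := by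
    intro x
    have h := lp.memℓp x
    rw [memℓp_gen_iff (by norm_num)] at h ⊢
    refine Summable.of_nonneg_of_le (fun _ => by positivity) (fun k => ?_) (h.mul_left (M ^ 2))
    simp only [ENNReal.toReal_ofNat, Real.rpow_two, norm_mul, mul_pow]
    refine mul_le_mul_of_nonneg_right ?_ (sq_nonneg _)
    exact pow_le_pow_left₀ (norm_nonneg _) (hM k) 2
  let T : lp (fun _ : κ => ℝ) 2 →ₗ[ℝ] lp (fun _ : κ => ℝ) 2 :=
    { toFun := fun x => ⟨fun k => l k * x k, hmem x⟩
      map_add' := fun x y => by ext k; simp [mul_add]; rfl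
      map_smul' := fun c x => by ext k; simp; ring }
  have hT : ∀ x, ‖T x‖ ≤ |M| * ‖x‖ := by
    intro x
    have h0 : 0 ≤ |M| * ‖x‖ := by positivity
    refine lp.norm_le_of_tsum_le (by norm_num) h0 ?_
    have hx := lp.norm_rpow_eq_tsum (p := 2) (by norm_num) x
    have h := lp.memℓp x
    have h' := hmem x
    rw [memℓp_gen_iff (by norm_num)] at h h'
    simp only [ENNReal.toReal_ofNat, Real.rpow_two] at hx h h' ⊢
    rw [mul_pow, hx, sq_abs, ← tsum_mul_left]
    refine h'.tsum_le_tsum (fun k => ?_) (h.mul_left (M ^ 2))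
    change ‖l k * x k‖ ^ 2 ≤ _
    rw [norm_mul, mul_pow]
    refine mul_le_mul_of_nonneg_right ?_ (sq_nonneg _)
    exact pow_le_pow_left₀ (norm_nonneg _) (hM k) 2
  let T' := T.mkContinuous |M| hT
  refine ⟨(b.repr.symm.toContinuousLinearEquiv : _ →L[ℝ] E) ∘L T' ∘L
    (b.repr.toContinuousLinearEquiv : E →L[ℝ] _), fun k => ?_⟩
  have : T (lp.single 2 k 1) = l k • lp.single 2 k (1 : ℝ) := by
    ext j
    change l j * (lp.single 2 k (1 : ℝ) : lp (fun _ : κ => ℝ) 2) j = _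
    by_cases h : j = k
    · subst h; simp
    · simp [h]
  change b.repr.symm (T (b.repr (b k))) = _
  rw [b.repr_self, this, map_smul, b.repr_symm_single]

/-- Weierstrass approximation supplies polynomials arbitrarily close to `φ`, and each of them pins
down both candidates. Hence the chosen value in `opFun` is the expected operator. -/
theorem IsOpFun.unique {φ : ℝ → ℝ} {A B B' : E →L[ℝ] E} (hφ : ContinuousOn φ (Set.Icc 0 ‖A‖))
    (hB : IsOpFun φ A B) (hB' : IsOpFun φ A B') : B = B' := by
  rw [← sub_eq_zero, ← norm_le_zero_iff]
  refine le_of_forall_pos_le_add fun η hη => ?_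
  obtain ⟨q, hq⟩ := exists_polynomial_near_of_continuousOn 0 ‖A‖ φ hφ (η / 2) (half_pos hη)
  have h1 := hB q (η / 2) fun t ht => (hq t ht).le
  have h2 := hB' q (η / 2) fun t ht => (hq t ht).le
  calc ‖B - B'‖ = ‖(Polynomial.aeval A q - B') - (Polynomial.aeval A q - B)‖ := by congr 1; abel
    _ ≤ _ := norm_sub_le _ _
    _ ≤ 0 + η := by linarith

/-- The functional calculus of a diagonal operator is diagonal. -/
theorem IsDiag.opFun {b : HilbertBasis κ ℝ E} {A : E →L[ℝ] E} {l : κ → ℝ} (hA : IsDiag b A l)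
    (hpos : A.IsPositive) {φ : ℝ → ℝ} (hφ : ContinuousOn φ (Set.Icc 0 ‖A‖)) :
    IsDiag b (opFun φ A) (fun k => φ (l k)) := by
  obtain ⟨M, hM⟩ := isCompact_Icc.exists_bound_of_continuousOn hφ
  obtain ⟨B, hB⟩ := exists_isDiag b (fun k => φ (l k)) (fun k => hM _ (hA.mem_Icc hpos k))
  have hBf : IsOpFun φ A B := by
    intro q η h
    refine ((hA.aeval q).sub hB).norm_le ?_ fun k => h _ (hA.mem_Icc hpos k)
    exact (abs_nonneg _).trans (h 0 ⟨le_rfl, norm_nonneg _⟩)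
  have hex : ∃ B, IsOpFun φ A B := ⟨B, hBf⟩
  have : FGL.opFun φ A = B := by
    rw [FGL.opFun, dif_pos hex]
    exact hex.choose_spec.unique hφ hBf
  rw [this]; exact hB

theorem IsDiag.opPow {b : HilbertBasis κ ℝ E} {A : E →L[ℝ] E} {l : κ → ℝ} (hA : IsDiag b A l)
    (hpos : A.IsPositive) {s : ℝ} (hs : 0 < s) :
    IsDiag b (opPow A s) (fun k => l k ^ s) :=
  hA.opFun hpos (Real.continuous_rpow_const hs.le).continuousOn

theorem IsDiag.regInvSqrt {b : HilbertBasis κ ℝ E} {A : E →L[ℝ] E} {l : κ → ℝ} (hA : IsDiag b A l)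
    (hpos : A.IsPositive) {ε : ℝ} (hε : 0 < ε) :
    IsDiag b (regInvSqrt ε A) (fun k => (ε + l k) ^ (-(1 / 2) : ℝ)) := by
  refine hA.opFun (φ := fun t => (ε + t) ^ (-(1 / 2) : ℝ)) hpos ?_
  refine ContinuousOn.rpow_const (by fun_prop) fun t ht => Or.inl ?_
  have := ht.1
  positivity

theorem IsDiag.rangeProj {b : HilbertBasis κ ℝ E} {A : E →L[ℝ] E} {l : κ → ℝ} (hA : IsDiag b A l)
    (k : κ) : rangeProj A (b k) = if l k = 0 then 0 else b k := by
  split_ifs with h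
  · refine (Submodule.starProjection_apply_eq_zero_iff _).2 ?_
    rw [Submodule.orthogonal_closure, Submodule.mem_orthogonal]
    rintro _ ⟨x, rfl⟩
    change inner ℝ (A x) (b k) = (0 : ℝ)
    rw [real_inner_comm, hA.inner_apply, h, zero_mul]
  · refine Submodule.starProjection_eq_self_iff.2 (Submodule.le_topologicalClosure _ ?_)
    refine ⟨(l k)⁻¹ • b k, ?_⟩
    change A ((l k)⁻¹ • b k) = _
    rw [map_smul, hA k, smul_smul, inv_mul_cancel₀ h, one_smul]

/-- A Schur multiplier in a pair of Hilbert bases is bounded on Hilbert-Schmidt operators. -/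
theorem hsNorm_le_of_inner_le (b : HilbertBasis κ ℝ E) (c : HilbertBasis ν ℝ F)
    (D D' : E →L[ℝ] F) {M : ℝ} (hM : 0 ≤ M)
    (h : ∀ k j, |(inner ℝ (c j) (D (b k)) : ℝ)| ≤ M * |(inner ℝ (c j) (D' (b k)) : ℝ)|) :
    hsNorm D ≤ ENNReal.ofReal M * hsNorm D' := by
  refine (ENNReal.pow_le_pow_left_iff two_ne_zero).1 ?_
  have e : ∀ T : E →L[ℝ] F, hsNorm T ^ 2 = ∑' k, ∑' j, ‖(inner ℝ (c j) (T (b k)) : ℝ)‖ₑ ^ 2 := by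
    intro T
    rw [hsNorm_eq b, ← ENNReal.rpow_natCast, ← ENNReal.rpow_mul]
    simp_rw [parseval_enorm c]
    norm_num
  rw [mul_pow, e, e, ← ENNReal.tsum_mul_left]
  refine ENNReal.tsum_le_tsum fun k => ?_
  rw [← ENNReal.tsum_mul_left]
  refine ENNReal.tsum_le_tsum fun j => ?_
  rw [← mul_pow]
  gcongr
  rw [← ofReal_norm, ← ofReal_norm, ← ENNReal.ofReal_mul hM]
  exact ENNReal.ofReal_le_ofReal (h k j)

/-- Two-sided multiplication by coercive operators is coercive for the Hilbert-Schmidt inner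
product. -/
theorem le_inner_sandwich {b : HilbertBasis κ ℝ E} {A : F →L[ℝ] F} {B : E →L[ℝ] E} {l : κ → ℝ}
    (hB : IsDiag b B l) {a c : ℝ} (ha : 0 ≤ a) (hA : ∀ x, a * ‖x‖ ^ 2 ≤ inner ℝ x (A x))
    (hc : ∀ k, c ≤ l k) (D : HSOp E F) (hc0 : 0 ≤ c) :
    a * c * ‖D‖ ^ 2 ≤ inner ℝ D (sandwich A B D) := by
  refine hasSum_le (fun k => ?_) ((HSOp.hasSum_norm_sq b D).mul_left (a * c))
    (HSOp.hasSum_inner b D (sandwich A B D))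
  have h1 := hA (D.toCLM (b k))
  have h2 := hc k
  simp only [sandwich_toCLM, ContinuousLinearMap.comp_apply, hB k, map_smul, inner_smul_right]
  calc a * c * ‖D.toCLM (b k)‖ ^ 2 = c * (a * ‖D.toCLM (b k)‖ ^ 2) := by ring
    _ ≤ l k * (a * ‖D.toCLM (b k)‖ ^ 2) := by gcongr
    _ ≤ _ := by gcongr; exact hc0.trans h2

end Diagonal

/-! ### Spectral theorem for compact self-adjoint operators -/

section Eigenbasis

variable {E : Type*} [NormedAddCommGroup E] [InnerProductSpace ℝ E] [CompleteSpace E]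

instance completeSpace_eigenspace (A : E →L[ℝ] E) (μ : ℝ) :
    CompleteSpace (Module.End.eigenspace (A : E →ₗ[ℝ] E) μ) := by
  refine IsClosed.completeSpace_coe (hs := ?_)
  have : (Module.End.eigenspace (A : E →ₗ[ℝ] E) μ : Set E) = {x | A x = μ • x} := by
    ext x
    exact Module.End.mem_eigenspace_iff
  rw [this]
  exact isClosed_eq A.continuous (continuous_const_smul μ)

/-- The index set of a Hilbert basis of eigenvectors. -/
def EigIdx (A : E →L[ℝ] E) : Type _ :=
  Σ μ : ℝ, onbIndex (Module.End.eigenspace (A : E →ₗ[ℝ] E) μ)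

/-- A compact self-adjoint operator has a Hilbert basis of eigenvectors. -/
theorem exists_eigenbasis {A : E →L[ℝ] E} (hA : IsSelfAdjoint A) (hc : IsCompactOperator A) :
    ∃ b : HilbertBasis (EigIdx A) ℝ E, IsDiag b A (fun k => k.1) := by
  have hsymm : (A : E →ₗ[ℝ] E).IsSymmetric := ContinuousLinearMap.isSelfAdjoint_iff_isSymmetric.1 hA
  let v : EigIdx A → E := fun k => ((onb (Module.End.eigenspace (A : E →ₗ[ℝ] E) k.1)) k.2 : E)
  have hv : Orthonormal ℝ v :=
    hsymm.orthogonalFamily_eigenspaces.orthonormal_sigma_orthonormal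
      (v_family := fun μ => onb (Module.End.eigenspace (A : E →ₗ[ℝ] E) μ))
      (fun μ => (onb (Module.End.eigenspace (A : E →ₗ[ℝ] E) μ)).orthonormal)
  -- The eigenspaces have dense sum, and each lies in the closed span of its own Hilbert basis.
  have hbot : (Submodule.span ℝ (Set.range v))ᗮ = ⊥ := by
    rw [eq_bot_iff, ← ContinuousLinearMap.orthogonalComplement_iSup_eigenspaces_eq_bot hc hsymm]
    rw [← Submodule.orthogonal_closure]
    refine Submodule.orthogonal_le (iSup_le fun μ => ?_)
    intro x hx
    have h1 := (onb (Module.End.eigenspace (A : E →ₗ[ℝ] E) μ)).hasSum_repr ⟨x, hx⟩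
    have h2 := h1.mapL (Module.End.eigenspace (A : E →ₗ[ℝ] E) μ).subtypeL
    refine (Submodule.isClosed_topologicalClosure _).mem_of_tendsto h2 (.of_forall fun s => ?_)
    refine Submodule.sum_mem _ fun i _ => ?_
    rw [map_smul]
    refine Submodule.smul_mem _ _ (Submodule.le_topologicalClosure _ (Submodule.subset_span ?_))
    exact ⟨⟨μ, i⟩, rfl⟩
  refine ⟨HilbertBasis.mkOfOrthogonalEqBot hv hbot, fun k => ?_⟩
  rw [HilbertBasis.coe_mkOfOrthogonalEqBot]
  exact Module.End.mem_eigenspace_iff.1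
    ((onb (Module.End.eigenspace (A : E →ₗ[ℝ] E) k.1)) k.2).2

theorem exists_eigenbasis_of_hs {A : E →L[ℝ] E} (hA : IsSelfAdjoint A) (hc : hsNorm A < ∞) :
    ∃ b : HilbertBasis (EigIdx A) ℝ E, IsDiag b A (fun k => k.1) :=
  exists_eigenbasis hA (HSOp.mk A hc).isCompactOperator

end Eigenbasis

/-! ### The Carleman-Fredholm determinant and Klein's inequality -/

section CarlemanFredholm

/-- The function `t ↦ t - log (1 + t)`, whose trace is `-log det₂`. -/
noncomputable def logDefect (t : ℝ) : ℝ := t - Real.log (1 + t)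

theorem logDefect_nonneg {t : ℝ} (ht : 0 < 1 + t) : 0 ≤ logDefect t := by
  have := Real.log_le_sub_one_of_pos ht
  unfold logDefect; linarith

theorem logDefect_le {t c : ℝ} (hc : 0 < c) (ht : c ≤ 1 + t) : logDefect t ≤ c⁻¹ * t ^ 2 := by
  have ht' : 0 < 1 + t := hc.trans_le ht
  have h1 := Real.one_sub_inv_le_log_of_pos ht'
  have h2 : t - (1 - (1 + t)⁻¹) = (1 + t)⁻¹ * t ^ 2 := by field_simp; ring
  calc logDefect t ≤ (1 + t)⁻¹ * t ^ 2 := by unfold logDefect; linarith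
    _ ≤ _ := by gcongr

/-- The gap between `logDefect` and its tangent at `a` is `x - 1 - log x` with `x = (1+b)/(1+a)`,
which vanishes only at `x = 1`. -/
theorem logDefect_tangent {a b : ℝ} (ha : 0 < 1 + a) (hb : 0 < 1 + b) :
    0 ≤ logDefect b - logDefect a - (1 - (1 + a)⁻¹) * (b - a) ∧
      (logDefect b - logDefect a - (1 - (1 + a)⁻¹) * (b - a) = 0 → b = a) := by
  have e : logDefect b - logDefect a - (1 - (1 + a)⁻¹) * (b - a) =
      ((1 + b) / (1 + a) - 1) - Real.log ((1 + b) / (1 + a)) := by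
    rw [Real.log_div hb.ne' ha.ne']
    unfold logDefect
    field_simp
    ring
  have hx : 0 < (1 + b) / (1 + a) := by positivity
  rw [e]
  refine ⟨by linarith [Real.log_le_sub_one_of_pos hx], fun h => ?_⟩
  by_contra hne
  have h1 : (1 + b) / (1 + a) ≠ 1 := by
    rw [Ne, div_eq_one_iff_eq ha.ne']
    intro h; exact hne (by linarith)
  linarith [Real.log_lt_sub_one_of_pos hx h1]

/-- Square summability leaves only finitely many `k` with `|l k| ≥ 1/2`; the remaining values of `1
+ l k` exceed `1/2`. This turns strict positivity into a uniform gap. -/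
theorem exists_pos_le_one_add {κ : Type*} {l : κ → ℝ} (hs : Summable fun k => l k ^ 2)
    (h : ∀ k, 0 < 1 + l k) : ∃ c > 0, ∀ k, c ≤ 1 + l k := by
  have hfin : {k | ¬ l k ^ 2 < 1 / 4}.Finite := by
    have := hs.tendsto_cofinite_zero.eventually (gt_mem_nhds (show (0 : ℝ) < 1 / 4 by norm_num))
    exact this
  have hout : ∀ k, l k ^ 2 < 1 / 4 → 1 / 2 ≤ 1 + l k := by
    intro k hk
    nlinarith [abs_lt_of_sq_lt_sq (show l k ^ 2 < (1 / 2) ^ 2 by linarith) (by norm_num)]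
  rcases hfin.toFinset.eq_empty_or_nonempty with he | hne
  · refine ⟨1 / 2, by norm_num, fun k => hout k ?_⟩
    by_contra hk
    have h1 : k ∈ hfin.toFinset := hfin.mem_toFinset.2 hk
    rw [he] at h1
    exact absurd h1 (Finset.notMem_empty k)
  · obtain ⟨k₀, _, hk₀⟩ := hfin.toFinset.exists_min_image (fun k => 1 + l k) hne
    refine ⟨min (1 / 2) (1 + l k₀), lt_min (by norm_num) (h k₀), fun k => ?_⟩
    by_cases hk : l k ^ 2 < 1 / 4
    · exact (min_le_left _ _).trans (hout k hk)
    · exact (min_le_right _ _).trans (hk₀ k (by simpa using hk))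

variable {E : Type*} [NormedAddCommGroup E] [InnerProductSpace ℝ E] [CompleteSpace E]

theorem IsDiag.summable_sq {κ : Type*} {b : HilbertBasis κ ℝ E} {A : E →L[ℝ] E} {l : κ → ℝ}
    (hA : IsDiag b A l) (hs : hsNorm A < ∞) : Summable fun k => l k ^ 2 := by
  have := (HSOp.hasSum_norm_sq b (HSOp.mk A hs)).summable
  refine this.congr fun k => ?_
  rw [HSOp.toCLM_mk, hA k, norm_smul, b.orthonormal.1 k, mul_one, Real.norm_eq_abs, sq_abs]

theorem IsDiag.one_add_pos {κ : Type*} {b : HilbertBasis κ ℝ E} {A : E →L[ℝ] E} {l : κ → ℝ}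
    (hA : IsDiag b A l) (hpos : ∀ x, x ≠ 0 → 0 < (inner ℝ x (x + A x) : ℝ)) (k : κ) :
    0 < 1 + l k := by
  have hb : b k ≠ 0 := by
    intro h; have := b.orthonormal.1 k; simp [h] at this
  have := hpos (b k) hb
  rwa [inner_add_right, inner_basis_self, hA.eigenvalue_eq] at this

/-- Nonzero eigenvalues of a compact operator have finite multiplicity. The kernel may be
infinite-dimensional, with `finrank` equal to `0` by convention, but there `logDefect 0 = 0`. -/
theorem hasSum_onbIndex_finrank {A : E →L[ℝ] E} (hc : IsCompactOperator A) (μ : ℝ) :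
    HasSum (fun _ : onbIndex (Module.End.eigenspace (A : E →ₗ[ℝ] E) μ) => logDefect μ)
      (Module.finrank ℝ (Module.End.eigenspace (A : E →ₗ[ℝ] E) μ) * logDefect μ) := by
  rcases eq_or_ne μ 0 with rfl | hμ
  · simp [logDefect, hasSum_zero]
  have hfd : FiniteDimensional ℝ (Module.End.eigenspace (A : E →ₗ[ℝ] E) μ) :=
    ContinuousLinearMap.finite_dimensional_eigenspace hc μ hμ
  let b := onb (Module.End.eigenspace (A : E →ₗ[ℝ] E) μ)
  have hfin : Finite (onbIndex (Module.End.eigenspace (A : E →ₗ[ℝ] E) μ)) :=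
    b.orthonormal.linearIndependent.finite
  have := Fintype.ofFinite (onbIndex (Module.End.eigenspace (A : E →ₗ[ℝ] E) μ))
  have h1 := Module.finrank_eq_card_basis b.toOrthonormalBasis.toBasis
  have h2 := hasSum_fintype
    (fun _ : onbIndex (Module.End.eigenspace (A : E →ₗ[ℝ] E) μ) => logDefect μ)
  rw [Finset.sum_const, nsmul_eq_mul, Finset.card_univ, ← h1] at h2
  exact h2

theorem summable_logDefect {κ : Type*} {l : κ → ℝ} (hs : Summable fun k => l k ^ 2)
    (h : ∀ k, 0 < 1 + l k) : Summable fun k => logDefect (l k) := by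
  obtain ⟨c, hc, hck⟩ := exists_pos_le_one_add hs h
  exact Summable.of_nonneg_of_le (fun k => logDefect_nonneg (h k))
    (fun k => logDefect_le hc (hck k)) (hs.mul_left c⁻¹)

/-- The logarithm of the Carleman-Fredholm determinant is the sum of `log (1 + μ) - μ` over the
eigenvalues. -/
theorem log_det2 {A : E →L[ℝ] E} (hs : hsNorm A < ∞)
    (hpos : ∀ x, x ≠ 0 → 0 < (inner ℝ x (x + A x) : ℝ)) {b : HilbertBasis (EigIdx A) ℝ E}
    (hb : IsDiag b A fun k => k.1) :
    Real.log (det2 A) = -∑' k : EigIdx A, logDefect k.1 := by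
  have hc := (HSOp.mk A hs).isCompactOperator
  have hsum := (summable_logDefect (hb.summable_sq hs) (hb.one_add_pos hpos)).hasSum
  have h1 := hsum.sigma (fun μ => hasSum_onbIndex_finrank hc μ)
  have hdim : ∀ μ, Module.finrank ℝ (Module.End.eigenspace (A : E →ₗ[ℝ] E) μ) ≠ 0 → 0 < 1 + μ := by
    intro μ hμ
    have hne : Module.End.eigenspace (A : E →ₗ[ℝ] E) μ ≠ ⊥ := by
      intro h; rw [h] at hμ; simp at hμ
    obtain ⟨x, hx, hx0⟩ := Submodule.exists_mem_ne_zero_of_ne_bot hne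
    have h2 : A x = μ • x := Module.End.mem_eigenspace_iff.1 hx
    have h3 := hpos x hx0
    rw [h2, inner_add_right, inner_smul_right, real_inner_self_eq_norm_sq] at h3
    have h4 : 0 < ‖x‖ ^ 2 := by positivity
    by_contra h5
    nlinarith
  -- Where the `finrank` is zero the factor is `1`, whatever the sign of `1 + μ`; elsewhere `μ` is
  -- an eigenvalue and `1 + μ > 0`.
  have hfac : ∀ μ, 0 < ((1 + μ) * Real.exp (-μ)) ^
      Module.finrank ℝ (Module.End.eigenspace (A : E →ₗ[ℝ] E) μ) := by
    intro μ
    by_cases h : Module.finrank ℝ (Module.End.eigenspace (A : E →ₗ[ℝ] E) μ) = 0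
    · rw [h]; norm_num
    · have := hdim μ h
      positivity
  have hlog : ∀ μ, Real.log (((1 + μ) * Real.exp (-μ)) ^
      Module.finrank ℝ (Module.End.eigenspace (A : E →ₗ[ℝ] E) μ)) =
      -(Module.finrank ℝ (Module.End.eigenspace (A : E →ₗ[ℝ] E) μ) * logDefect μ) := by
    intro μ
    by_cases h : Module.finrank ℝ (Module.End.eigenspace (A : E →ₗ[ℝ] E) μ) = 0
    · rw [h]; norm_num
    · rw [Real.log_pow, Real.log_mul (hdim μ h).ne' (Real.exp_ne_zero _), Real.log_exp, logDefect]
      ring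
  have h2 : HasSum (fun μ => Real.log (((1 + μ) * Real.exp (-μ)) ^
      Module.finrank ℝ (Module.End.eigenspace (A : E →ₗ[ℝ] E) μ)))
      (-∑' k : EigIdx A, logDefect k.1) := by
    simp_rw [hlog]
    exact h1.neg
  have h3 := Real.rexp_tsum_eq_tprod hfac h2.summable
  rw [det2, ← h3, Real.log_exp, h2.tsum_eq]

/-- Averaging a summable sequence with the doubly stochastic weights of two Hilbert bases preserves
its sum. -/
theorem hasSum_inner_sq_mul {κ ν : Type*} (b : HilbertBasis κ ℝ E) (b' : HilbertBasis ν ℝ E)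
    {g : ν → ℝ} (hg0 : ∀ j, 0 ≤ g j) (hg : Summable g) :
    (∀ k, Summable fun j => (inner ℝ (b' j) (b k) : ℝ) ^ 2 * g j) ∧
      HasSum (fun k => ∑' j, (inner ℝ (b' j) (b k) : ℝ) ^ 2 * g j) (∑' j, g j) := by
  have hw2 : ∀ j, HasSum (fun k => (inner ℝ (b' j) (b k) : ℝ) ^ 2 * g j) (g j) := by
    intro j
    have h := (hasSum_inner_sq b (b' j)).mul_right (g j)
    rw [b'.orthonormal.1 j, one_pow, one_mul] at h
    simpa only [real_inner_comm] using h
  -- All terms are nonnegative, so summability over pairs follows from one order of summation and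
  -- permits the other.
  have h1 : Summable fun x : ν × κ => (inner ℝ (b' x.1) (b x.2) : ℝ) ^ 2 * g x.1 := by
    refine (summable_prod_of_nonneg
      (fun x => mul_nonneg (sq_nonneg _) (hg0 x.1))).2 ⟨fun j => (hw2 j).summable, ?_⟩
    exact hg.congr fun j => (hw2 j).tsum_eq.symm
  have h2 := h1.hasSum.prod_fiberwise hw2
  have h3 : Summable fun x : κ × ν => (inner ℝ (b' x.2) (b x.1) : ℝ) ^ 2 * g x.2 :=
    (Equiv.prodComm _ _).summable_iff.2 h1
  have h4 : HasSum (fun x : κ × ν => (inner ℝ (b' x.2) (b x.1) : ℝ) ^ 2 * g x.2) (∑' j, g j) := by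
    rw [h2.tsum_eq]
    exact (Equiv.prodComm κ ν).hasSum_iff.2 h1.hasSum
  exact ⟨fun k => h3.prod_factor k, h4.prod_fiberwise fun k => (h3.prod_factor k).hasSum⟩

/-- Klein's inequality for the trace of `logDefect`, with the case of equality. -/
theorem klein_logDefect {κ ν : Type*} {b : HilbertBasis κ ℝ E} {b' : HilbertBasis ν ℝ E}
    {A A' : E →L[ℝ] E} {l : κ → ℝ} {m : ν → ℝ} (hb : IsDiag b A l) (hb' : IsDiag b' A' m)
    (hl : ∀ k, 0 < 1 + l k) (hm : ∀ j, 0 < 1 + m j)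
    (hS : Summable fun k => logDefect (l k)) (hS' : Summable fun j => logDefect (m j))
    {J : E →L[ℝ] E} (hJ : ∀ x, J (x + A x) = x) {G D : HSOp E E} (hG : G.toCLM = 1 - J)
    (hD : D.toCLM = A' - A) :
    inner ℝ G D ≤ (∑' j, logDefect (m j)) - ∑' k, logDefect (l k) ∧
      (inner ℝ G D = (∑' j, logDefect (m j)) - ∑' k, logDefect (l k) → A' = A) := by
  obtain ⟨ha, hasum⟩ := hasSum_inner_sq_mul b b' (fun j => logDefect_nonneg (hm j)) hS'
  have hw1 : ∀ k, HasSum (fun j => (inner ℝ (b' j) (b k) : ℝ) ^ 2) 1 := by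
    intro k
    have := hasSum_inner_sq b' (b k)
    rwa [b.orthonormal.1 k, one_pow] at this
  have hJb : ∀ k, J (b k) = (1 + l k)⁻¹ • b k := by
    intro k
    have h1 := hJ (b k)
    rw [hb k] at h1
    have h2 : b k + l k • b k = (1 + l k) • b k := by rw [add_smul, one_smul]
    rw [h2, map_smul] at h1
    calc J (b k) = (1 + l k)⁻¹ • (1 + l k) • J (b k) := by
          rw [smul_smul, inv_mul_cancel₀ (hl k).ne', one_smul]
      _ = _ := by rw [h1]
  have hG' : ∀ k, (inner ℝ (G.toCLM (b k)) (D.toCLM (b k)) : ℝ) =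
      (1 - (1 + l k)⁻¹) * (inner ℝ (b k) (A' (b k)) - l k) := by
    intro k
    rw [hG, hD, _root_.sub_apply, _root_.sub_apply, hb k, hJb, one_apply_eq_self]
    have : b k - (1 + l k)⁻¹ • b k = (1 - (1 + l k)⁻¹) • b k := by rw [sub_smul, one_smul]
    rw [this, inner_smul_left, inner_sub_right, inner_smul_right, inner_basis_self]
    simp
  -- The weights `⟪b' j, b k⟫²` sum to `1` over `j` and turn `⟪b k, A' (b k)⟫` into an average of
  -- the `m j`. Averaging the scalar tangent inequality with them gives the trace inequality row by
  -- row.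
  have hrow : ∀ k, HasSum (fun j => (inner ℝ (b' j) (b k) : ℝ) ^ 2 *
      (logDefect (m j) - logDefect (l k) - (1 - (1 + l k)⁻¹) * (m j - l k)))
      ((∑' j, (inner ℝ (b' j) (b k) : ℝ) ^ 2 * logDefect (m j)) - logDefect (l k) -
        inner ℝ (G.toCLM (b k)) (D.toCLM (b k))) := by
    intro k
    have h2 := ((ha k).hasSum.sub ((hw1 k).mul_right (logDefect (l k)))).sub
      (((hb'.hasSum_inner (b k)).sub ((hw1 k).mul_right (l k))).mul_left (1 - (1 + l k)⁻¹))
    rw [one_mul, one_mul] at h2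
    rw [hG']
    have e : (fun j => (inner ℝ (b' j) (b k) : ℝ) ^ 2 *
        (logDefect (m j) - logDefect (l k) - (1 - (1 + l k)⁻¹) * (m j - l k))) = fun j =>
        (inner ℝ (b' j) (b k) : ℝ) ^ 2 * logDefect (m j) -
          (inner ℝ (b' j) (b k) : ℝ) ^ 2 * logDefect (l k) -
          (1 - (1 + l k)⁻¹) * (m j * (inner ℝ (b' j) (b k) : ℝ) ^ 2 -
            (inner ℝ (b' j) (b k) : ℝ) ^ 2 * l k) := by
      funext j; ring
    rw [e]
    exact h2
  have hrow0 : ∀ k j, 0 ≤ (inner ℝ (b' j) (b k) : ℝ) ^ 2 *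
      (logDefect (m j) - logDefect (l k) - (1 - (1 + l k)⁻¹) * (m j - l k)) := fun k j =>
    mul_nonneg (sq_nonneg _) (logDefect_tangent (hl k) (hm j)).1
  have hall : HasSum (fun k => (∑' j, (inner ℝ (b' j) (b k) : ℝ) ^ 2 * logDefect (m j)) -
      logDefect (l k) - inner ℝ (G.toCLM (b k)) (D.toCLM (b k)))
      ((∑' j, logDefect (m j)) - (∑' k, logDefect (l k)) - inner ℝ G D) :=
    (hasum.sub hS.hasSum).sub (HSOp.hasSum_inner b G D)
  have hnn : ∀ k, 0 ≤ (∑' j, (inner ℝ (b' j) (b k) : ℝ) ^ 2 * logDefect (m j)) -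
      logDefect (l k) - inner ℝ (G.toCLM (b k)) (D.toCLM (b k)) :=
    fun k => (hrow k).nonneg (hrow0 k)
  refine ⟨by linarith [hall.nonneg hnn], fun heq => ?_⟩
  have h0 : (∑' j, logDefect (m j)) - (∑' k, logDefect (l k)) - inner ℝ G D = 0 := by
    linarith
  rw [h0] at hall
  have hz := (hasSum_zero_iff_of_nonneg hnn).1 hall
  refine ext_hilbertBasis b fun k => b'.repr.injective ?_
  ext j
  rw [b'.repr_apply_apply, b'.repr_apply_apply, hb'.inner_apply, hb k, inner_smul_right]
  have h1 := hrow k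
  rw [congrFun hz k] at h1
  have h2 := congrFun ((hasSum_zero_iff_of_nonneg (hrow0 k)).1 h1) j
  -- In the equality case each pair of basis vectors is either orthogonal or belongs to equal
  -- eigenvalues. Either way `A'` and `A` have the same matrix coefficient.
  rcases mul_eq_zero.1 h2 with h3 | h3
  · rw [pow_eq_zero_iff two_ne_zero] at h3
    rw [h3, mul_zero, mul_zero]
  · rw [(logDefect_tangent (hl k) (hm j)).2 h3]

/-- Klein's inequality for `-log det₂`, with the case of equality. -/
theorem log_det2_le {A A' : E →L[ℝ] E} (hA : IsSelfAdjoint A) (hA' : IsSelfAdjoint A')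
    (hs : hsNorm A < ∞) (hs' : hsNorm A' < ∞)
    (hpos : ∀ x, x ≠ 0 → 0 < (inner ℝ x (x + A x) : ℝ))
    (hpos' : ∀ x, x ≠ 0 → 0 < (inner ℝ x (x + A' x) : ℝ))
    {J : E →L[ℝ] E} (hJ : ∀ x, J (x + A x) = x) {G D : HSOp E E} (hG : G.toCLM = 1 - J)
    (hD : D.toCLM = A' - A) :
    inner ℝ G D ≤ Real.log (det2 A) - Real.log (det2 A') ∧
      (inner ℝ G D = Real.log (det2 A) - Real.log (det2 A') → A' = A) := by
  obtain ⟨b, hb⟩ := exists_eigenbasis_of_hs hA hs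
  obtain ⟨b', hb'⟩ := exists_eigenbasis_of_hs hA' hs'
  rw [log_det2 hs hpos hb, log_det2 hs' hpos' hb']
  have hl := hb.one_add_pos hpos
  have hm := hb'.one_add_pos hpos'
  have h := klein_logDefect hb hb' hl hm (summable_logDefect (hb.summable_sq hs) hl)
    (summable_logDefect (hb'.summable_sq hs') hm) hJ hG hD
  rw [neg_sub_neg]
  exact h

end CarlemanFredholm

/-! ### Block entries on the product space and the row-sum norm -/

section Blocks

variable {p : ℕ} {H : Fin p → Type*} [∀ j, NormedAddCommGroup (H j)]
  [∀ j, InnerProductSpace ℝ (H j)] [∀ j, CompleteSpace (H j)]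

theorem incl_apply (i j : Fin p) (x : H j) : (incl j x : PiLp 2 H) i = Pi.single j x i := rfl

@[simp] theorem incl_apply_same (j : Fin p) (x : H j) : (incl j x : PiLp 2 H) j = x := by
  rw [incl_apply, Pi.single_eq_same]

theorem incl_apply_ne {i j : Fin p} (h : i ≠ j) (x : H j) : (incl j x : PiLp 2 H) i = 0 := by
  rw [incl_apply, Pi.single_eq_of_ne h]

theorem proj_comp_incl_same (j : Fin p) :
    PiLp.proj 2 H j ∘L incl j = ContinuousLinearMap.id ℝ (H j) := by
  ext x; exact incl_apply_same j x

theorem proj_comp_incl_ne {i j : Fin p} (h : i ≠ j) :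
    PiLp.proj 2 H i ∘L incl j = (0 : H j →L[ℝ] H i) := by
  ext x; exact incl_apply_ne h x

theorem sum_incl_apply (x : PiLp 2 H) : ∑ i, incl i (x i) = x := by
  ext k
  rw [WithLp.ofLp_sum, Finset.sum_apply, Finset.sum_eq_single k]
  · exact incl_apply_same k _
  · intro j _ h; exact incl_apply_ne h.symm _
  · simp

theorem inner_incl_left (j : Fin p) (x : H j) (y : PiLp 2 H) :
    inner ℝ (incl j x) y = (inner ℝ x (y j) : ℝ) := by
  rw [PiLp.inner_apply, Finset.sum_eq_single j]
  · rw [incl_apply_same]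
  · intro i _ h; rw [incl_apply_ne h, inner_zero_left]
  · simp

theorem adjoint_proj (j : Fin p) : ContinuousLinearMap.adjoint (PiLp.proj (𝕜 := ℝ) 2 H j) = incl j := by
  ext1 x
  refine ext_inner_right ℝ fun y => ?_
  rw [ContinuousLinearMap.adjoint_inner_left, inner_incl_left]
  rfl

theorem adjoint_incl (j : Fin p) :
    ContinuousLinearMap.adjoint (incl j : H j →L[ℝ] PiLp 2 H) = PiLp.proj 2 H j := by
  rw [← adjoint_proj, ContinuousLinearMap.adjoint_adjoint]

theorem blk_apply (T : PiLp 2 H →L[ℝ] PiLp 2 H) (i j : Fin p) (x : H j) :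
    blk T i j x = T (incl j x) i := rfl

theorem apply_eq_sum_blk (T : PiLp 2 H →L[ℝ] PiLp 2 H) (x : PiLp 2 H) (i : Fin p) :
    T x i = ∑ j, blk T i j (x j) := by
  conv_lhs => rw [← sum_incl_apply x]
  rw [map_sum, WithLp.ofLp_sum, Finset.sum_apply]
  rfl

theorem blk_injective : Function.Injective (blk : (PiLp 2 H →L[ℝ] PiLp 2 H) → OpMat H) := by
  intro S T h
  ext1 x
  ext i
  rw [apply_eq_sum_blk, apply_eq_sum_blk, h]

@[simp] theorem blk_toOp (A : OpMat H) : blk (toOp A) = A := by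
  funext i j
  ext x
  rw [blk_apply, toOp, _root_.sum_apply, WithLp.ofLp_sum, Finset.sum_apply,
    Finset.sum_eq_single i, _root_.sum_apply, WithLp.ofLp_sum, Finset.sum_apply,
    Finset.sum_eq_single j]
  · change (incl i (A i j ((incl j x : PiLp 2 H) j)) : PiLp 2 H) i = _
    rw [incl_apply_same, incl_apply_same]
  · intro k _ h
    change (incl i (A i k ((incl j x : PiLp 2 H) k)) : PiLp 2 H) i = _
    rw [incl_apply_ne h, map_zero, map_zero]; rfl
  · simp
  · intro k _ h
    rw [_root_.sum_apply, WithLp.ofLp_sum, Finset.sum_apply]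
    exact Finset.sum_eq_zero fun l _ => incl_apply_ne h.symm _
  · simp

@[simp] theorem toOp_blk (T : PiLp 2 H →L[ℝ] PiLp 2 H) : toOp (blk T) = T :=
  blk_injective (blk_toOp _)

theorem blk_add (S T : PiLp 2 H →L[ℝ] PiLp 2 H) (i j : Fin p) :
    blk (S + T) i j = blk S i j + blk T i j := by ext x; rfl

theorem blk_comp (S T : PiLp 2 H →L[ℝ] PiLp 2 H) (i j : Fin p) :
    blk (S ∘L T) i j = ∑ k, blk S i k ∘L blk T k j := by
  ext x
  rw [blk_apply, ContinuousLinearMap.comp_apply, apply_eq_sum_blk, _root_.sum_apply]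
  rfl

theorem blk_adjoint (T : PiLp 2 H →L[ℝ] PiLp 2 H) (i j : Fin p) :
    blk (ContinuousLinearMap.adjoint T) i j = ContinuousLinearMap.adjoint (blk T j i) := by
  simp only [blk, ContinuousLinearMap.adjoint_comp, adjoint_proj, adjoint_incl,
    ContinuousLinearMap.comp_assoc]

theorem blk_one_same (i : Fin p) : blk (1 : PiLp 2 H →L[ℝ] PiLp 2 H) i i = 1 :=
  proj_comp_incl_same i

theorem blk_one_ne {i j : Fin p} (h : i ≠ j) : blk (1 : PiLp 2 H →L[ℝ] PiLp 2 H) i j = 0 :=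
  proj_comp_incl_ne h

theorem norm_blk_selfAdjoint {T : PiLp 2 H →L[ℝ] PiLp 2 H} (hT : IsSelfAdjoint T) (i j : Fin p) :
    ‖blk T i j‖ = ‖blk T j i‖ := by
  rw [ContinuousLinearMap.isSelfAdjoint_iff'] at hT
  conv_lhs => rw [← hT, blk_adjoint]
  exact LinearIsometryEquiv.norm_map _ _

/-- The Hilbert-Schmidt entries of a Hilbert-Schmidt operator on the product space. -/
noncomputable def hblk (i j : Fin p) : HSOp (PiLp 2 H) (PiLp 2 H) →L[ℝ] HSOp (H j) (H i) :=
  sandwich (PiLp.proj 2 H i) (incl j)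

/-- The operator on the product space with a single Hilbert-Schmidt entry. -/
noncomputable def hinc (i j : Fin p) : HSOp (H j) (H i) →L[ℝ] HSOp (PiLp 2 H) (PiLp 2 H) :=
  sandwich (incl i) (PiLp.proj 2 H j)

@[simp] theorem hblk_toCLM (i j : Fin p) (A : HSOp (PiLp 2 H) (PiLp 2 H)) :
    (hblk i j A).toCLM = blk A.toCLM i j := rfl

theorem hblk_hinc_same (i j : Fin p) (A : HSOp (H j) (H i)) : hblk i j (hinc i j A) = A := by
  apply HSOp.toCLM_injective
  ext x
  change (incl i (A.toCLM ((incl j x : PiLp 2 H) j)) : PiLp 2 H) i = _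
  rw [incl_apply_same, incl_apply_same]

theorem hblk_hinc_ne {i j k l : Fin p} (h : ¬(i = k ∧ j = l)) (A : HSOp (H l) (H k)) :
    hblk i j (hinc k l A) = 0 := by
  apply HSOp.toCLM_injective
  ext x
  change (incl k (A.toCLM ((incl j x : PiLp 2 H) l)) : PiLp 2 H) i = 0
  by_cases h1 : i = k
  · have h2 : l ≠ j := fun h3 => h ⟨h1, h3.symm⟩
    rw [incl_apply_ne h2, map_zero, map_zero]; rfl
  · exact incl_apply_ne h1 _

theorem inner_hinc (i j : Fin p) (A : HSOp (H j) (H i)) (B : HSOp (PiLp 2 H) (PiLp 2 H)) :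
    inner ℝ (hinc i j A) B = (inner ℝ A (hblk i j B) : ℝ) := by
  rw [hinc, inner_sandwich, adjoint_incl, adjoint_proj]; rfl

theorem sum_hinc_hblk (A : HSOp (PiLp 2 H) (PiLp 2 H)) : ∑ i, ∑ j, hinc i j (hblk i j A) = A := by
  apply HSOp.toCLM_injective
  rw [map_sum]
  simp_rw [map_sum]
  exact toOp_blk A.toCLM

theorem hsop_ext {A B : HSOp (PiLp 2 H) (PiLp 2 H)} (h : ∀ i j, hblk i j A = hblk i j B) :
    A = B := by
  rw [← sum_hinc_hblk A, ← sum_hinc_hblk B]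
  simp_rw [h]

theorem inner_eq_sum_hblk (A B : HSOp (PiLp 2 H) (PiLp 2 H)) :
    inner ℝ A B = ∑ i, ∑ j, (inner ℝ (hblk i j A) (hblk i j B) : ℝ) := by
  conv_lhs => rw [← sum_hinc_hblk A]
  rw [sum_inner]
  simp_rw [sum_inner, inner_hinc]

theorem hblk_adj (i j : Fin p) (A : HSOp (PiLp 2 H) (PiLp 2 H)) :
    hblk i j (HSOp.adj _ _ A) = HSOp.adj _ _ (hblk j i A) := by
  apply HSOp.toCLM_injective
  rw [hblk_toCLM, HSOp.adj_toCLM, blk_adjoint]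
  rfl

theorem hblk_sandwich (S T : PiLp 2 H →L[ℝ] PiLp 2 H) (A : HSOp (PiLp 2 H) (PiLp 2 H))
    (i j : Fin p) :
    hblk i j (sandwich S T A) = ∑ k, ∑ l, sandwich (blk S i k) (blk T l j) (hblk k l A) := by
  conv_lhs => rw [← sum_hinc_hblk A]
  simp only [map_sum]
  refine Finset.sum_congr rfl fun k _ => Finset.sum_congr rfl fun l _ => ?_
  apply HSOp.toCLM_injective
  rfl

theorem hsNorm_toOp_lt_top {A : OpMat H} (hA : IsHSMat A) : hsNorm (toOp A) < ∞ := by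
  have : toOp A = (∑ i, ∑ j, hinc i j (HSOp.mk (A i j) (hA i j))).toCLM := by
    rw [map_sum]
    simp_rw [map_sum]
    rfl
  rw [this]
  exact HSOp.hsNorm_lt_top _

/-- The maximal row sum of the operator norms of the entries. -/
noncomputable def rowNorm (T : PiLp 2 H →L[ℝ] PiLp 2 H) : ℝ := ⨆ i, ∑ j, ‖blk T i j‖

theorem rowNorm_le {T : PiLp 2 H →L[ℝ] PiLp 2 H} {a : ℝ} (ha : 0 ≤ a)
    (h : ∀ i, ∑ j, ‖blk T i j‖ ≤ a) : rowNorm T ≤ a := Real.iSup_le h ha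

theorem sum_blk_le_rowNorm (T : PiLp 2 H →L[ℝ] PiLp 2 H) (i : Fin p) :
    ∑ j, ‖blk T i j‖ ≤ rowNorm T :=
  le_ciSup (f := fun i => ∑ j, ‖blk T i j‖) (Set.finite_range _).bddAbove i

theorem rowNorm_nonneg (T : PiLp 2 H →L[ℝ] PiLp 2 H) : 0 ≤ rowNorm T :=
  Real.iSup_nonneg fun _ => Finset.sum_nonneg fun _ _ => norm_nonneg _

theorem rowNorm_add (S T : PiLp 2 H →L[ℝ] PiLp 2 H) : rowNorm (S + T) ≤ rowNorm S + rowNorm T := by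
  refine rowNorm_le (add_nonneg (rowNorm_nonneg _) (rowNorm_nonneg _)) fun i => ?_
  refine le_trans ?_ (add_le_add (sum_blk_le_rowNorm S i) (sum_blk_le_rowNorm T i))
  rw [← Finset.sum_add_distrib]
  exact Finset.sum_le_sum fun j _ => by rw [blk_add]; exact norm_add_le _ _

theorem rowNorm_neg (T : PiLp 2 H →L[ℝ] PiLp 2 H) : rowNorm (-T) = rowNorm T := by
  have : ∀ i j, ‖blk (-T) i j‖ = ‖blk T i j‖ := by
    intro i j
    have : blk (-T) i j = -blk T i j := by ext x; rfl
    rw [this, norm_neg]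
  simp only [rowNorm, this]

theorem rowNorm_comp (S T : PiLp 2 H →L[ℝ] PiLp 2 H) :
    rowNorm (S ∘L T) ≤ rowNorm S * rowNorm T := by
  refine rowNorm_le (mul_nonneg (rowNorm_nonneg _) (rowNorm_nonneg _)) fun i => ?_
  calc ∑ j, ‖blk (S ∘L T) i j‖ ≤ ∑ j, ∑ k, ‖blk S i k‖ * ‖blk T k j‖ := by
        refine Finset.sum_le_sum fun j _ => ?_
        rw [blk_comp]
        exact (norm_sum_le _ _).trans
          (Finset.sum_le_sum fun k _ => ContinuousLinearMap.opNorm_comp_le _ _)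
    _ = ∑ k, ‖blk S i k‖ * ∑ j, ‖blk T k j‖ := by
        rw [Finset.sum_comm]; simp_rw [Finset.mul_sum]
    _ ≤ ∑ k, ‖blk S i k‖ * rowNorm T := by
        gcongr with k; exact sum_blk_le_rowNorm T k
    _ ≤ _ := by
        rw [← Finset.sum_mul]
        gcongr
        · exact rowNorm_nonneg T
        · exact sum_blk_le_rowNorm S i

theorem norm_sq_eq_sum (x : PiLp 2 H) : ‖x‖ ^ 2 = ∑ i, ‖x i‖ ^ 2 := PiLp.norm_sq_eq_of_L2 H x

/-- The Schur test for self-adjoint operators. -/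
theorem abs_inner_le_rowNorm {T : PiLp 2 H →L[ℝ] PiLp 2 H} (hT : IsSelfAdjoint T) (x : PiLp 2 H) :
    |(inner ℝ x (T x) : ℝ)| ≤ rowNorm T * ‖x‖ ^ 2 := by
  have h1 : (inner ℝ x (T x) : ℝ) = ∑ i, ∑ j, (inner ℝ (x i) (blk T i j (x j)) : ℝ) := by
    rw [PiLp.inner_apply]
    refine Finset.sum_congr rfl fun i _ => ?_
    rw [apply_eq_sum_blk, inner_sum]
  have h2 : ∀ i j, |(inner ℝ (x i) (blk T i j (x j)) : ℝ)| ≤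
      (‖blk T i j‖ * ‖x i‖ ^ 2 + ‖blk T i j‖ * ‖x j‖ ^ 2) / 2 := by
    intro i j
    calc |(inner ℝ (x i) (blk T i j (x j)) : ℝ)| ≤ ‖x i‖ * (‖blk T i j‖ * ‖x j‖) :=
          (abs_real_inner_le_norm _ _).trans
            (mul_le_mul_of_nonneg_left ((blk T i j).le_opNorm _) (norm_nonneg _))
      _ ≤ _ := by nlinarith [sq_nonneg (‖x i‖ - ‖x j‖), norm_nonneg (blk T i j)]
  have h3 : ∑ i, ∑ j, ‖blk T i j‖ * ‖x i‖ ^ 2 ≤ rowNorm T * ‖x‖ ^ 2 := by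
    rw [norm_sq_eq_sum, Finset.mul_sum]
    refine Finset.sum_le_sum fun i _ => ?_
    rw [← Finset.sum_mul]
    exact mul_le_mul_of_nonneg_right (sum_blk_le_rowNorm T i) (sq_nonneg _)
  have h4 : ∑ i, ∑ j, ‖blk T i j‖ * ‖x j‖ ^ 2 ≤ rowNorm T * ‖x‖ ^ 2 := by
    rw [Finset.sum_comm]
    refine le_trans (le_of_eq ?_) h3
    refine Finset.sum_congr rfl fun j _ => Finset.sum_congr rfl fun i _ => ?_
    rw [norm_blk_selfAdjoint hT]
  rw [h1]
  calc _ ≤ ∑ i, ∑ j, (‖blk T i j‖ * ‖x i‖ ^ 2 + ‖blk T i j‖ * ‖x j‖ ^ 2) / 2 :=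
        (Finset.abs_sum_le_sum_abs _ _).trans (Finset.sum_le_sum fun i _ =>
          (Finset.abs_sum_le_sum_abs _ _).trans (Finset.sum_le_sum fun j _ => h2 i j))
    _ = ((∑ i, ∑ j, ‖blk T i j‖ * ‖x i‖ ^ 2) + ∑ i, ∑ j, ‖blk T i j‖ * ‖x j‖ ^ 2) / 2 := by
        simp_rw [← Finset.sum_div, Finset.sum_add_distrib]
    _ ≤ _ := by linarith

/-- The entries of `S A T` are controlled by the row sums of `S` and `T` when `T` is
self-adjoint. -/
theorem norm_hblk_sandwich_le {S T : PiLp 2 H →L[ℝ] PiLp 2 H} (hT : IsSelfAdjoint T)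
    {A : HSOp (PiLp 2 H) (PiLp 2 H)} {m : ℝ} (hA : ∀ k l, ‖hblk k l A‖ ≤ m) (i j : Fin p) :
    ‖hblk i j (sandwich S T A)‖ ≤ rowNorm S * m * rowNorm T := by
  have hm : 0 ≤ m := (norm_nonneg _).trans (hA i j)
  rw [hblk_sandwich]
  calc _ ≤ ∑ k, ∑ l, ‖blk S i k‖ * m * ‖blk T j l‖ := by
        refine (norm_sum_le _ _).trans (Finset.sum_le_sum fun k _ =>
          (norm_sum_le _ _).trans (Finset.sum_le_sum fun l _ => ?_))
        refine (norm_sandwich_apply_le _ _ _).trans ?_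
        -- The natural bound contains a column sum of `T`; self-adjointness replaces it by a row
        -- sum.
        rw [norm_blk_selfAdjoint hT l j]
        gcongr
        exact hA k l
    _ = (∑ k, ‖blk S i k‖) * m * ∑ l, ‖blk T j l‖ := by
        simp_rw [← Finset.mul_sum, ← Finset.sum_mul]
    _ ≤ _ := by
        gcongr
        · exact mul_nonneg (rowNorm_nonneg _) hm
        · exact sum_blk_le_rowNorm S i
        · exact sum_blk_le_rowNorm T j

end Blocks

/-! ### Coercive operators and variational inequalities -/

section HilbertSpace

variable {E : Type*} [NormedAddCommGroup E] [InnerProductSpace ℝ E] [CompleteSpace E]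

theorem isUnit_of_coercive {L : E →L[ℝ] E} {c : ℝ} (hc : 0 < c)
    (h : ∀ x, c * ‖x‖ ^ 2 ≤ inner ℝ x (L x)) : IsUnit L := by
  refine ContinuousLinearMap.isUnit_of_forall_le_norm_inner_map L (c := ⟨c, hc.le⟩) hc fun x => ?_
  have h1 := h x
  rw [real_inner_comm] at h1
  calc ‖x‖ ^ 2 * c = c * ‖x‖ ^ 2 := mul_comm _ _
    _ ≤ _ := h1
    _ ≤ _ := Real.le_norm_self _

/-- A variational inequality for a cocoercive and expansive map on a closed convex set is
solvable. -/
theorem exists_variational_inequality {K : Set E} (hconv : Convex ℝ K) (hne : K.Nonempty)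
    (hcl : IsClosed K) (f : E → E) {c L : ℝ} (hc : 0 < c)
    (hmono : ∀ z ∈ K, ∀ z' ∈ K, c * ‖f z - f z'‖ ^ 2 ≤ inner ℝ (f z - f z') (z - z'))
    (hexp : ∀ z ∈ K, ∀ z' ∈ K, ‖z - z'‖ ≤ L * ‖f z - f z'‖) :
    ∃ z ∈ K, ∀ z' ∈ K, 0 ≤ (inner ℝ (f z) (z' - z) : ℝ) := by
  have hproj : ∀ u, ∃ v ∈ K, ∀ w ∈ K, (inner ℝ (u - v) (w - v) : ℝ) ≤ 0 := by
    intro u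
    obtain ⟨v, hv, hv'⟩ := exists_norm_eq_iInf_of_complete_convex hne hcl.isComplete hconv u
    exact ⟨v, hv, (norm_eq_iInf_iff_real_inner_le_zero hconv hv).1 hv'⟩
  choose P hPK hP using hproj
  have hPn : ∀ u v, ‖P u - P v‖ ^ 2 ≤ ‖u - v‖ ^ 2 := by
    intro u v
    have h1 := hP u (P v) (hPK v)
    have h2 := hP v (P u) (hPK u)
    have h3 : ‖P u - P v‖ ^ 2 ≤ inner ℝ (u - v) (P u - P v) := by
      have e : (inner ℝ (u - v) (P u - P v) : ℝ) = ‖P u - P v‖ ^ 2 -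
          inner ℝ (u - P u) (P v - P u) - inner ℝ (v - P v) (P u - P v) := by
        rw [← real_inner_self_eq_norm_sq]
        simp only [inner_sub_left, inner_sub_right]
        ring
      linarith
    have h4 := real_inner_le_norm (u - v) (P u - P v)
    nlinarith [sq_nonneg (‖u - v‖ - ‖P u - P v‖), norm_nonneg (u - v), norm_nonneg (P u - P v)]
  -- Expanding the square, cocoercivity bounds the squared norm of `(z - z') - c(f z - f z')` by `‖z
  -- - z'‖² - c²‖f z - f z'‖²`. Expansiveness bounds this by `(1 - (c/M)²)‖z - z'‖²`. The extra
  -- summands in `M` only ensure `0 < c/M < 1`.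
  let M := |L| + c + 1
  have hM : 0 < M := by positivity
  have hcM : c < M := by have := abs_nonneg L; simp only [M]; linarith
  let q := 1 - (c / M) ^ 2
  have hcM1 : c / M < 1 := (div_lt_one hM).2 hcM
  have hcM0 : 0 < c / M := by positivity
  have hq0 : 0 ≤ q := by simp only [q]; nlinarith
  have hq1 : q < 1 := by simp only [q]; nlinarith
  have hK : CompleteSpace K := hcl.completeSpace_coe
  have hKne : Nonempty K := hne.to_subtype
  let g : K → K := fun z => ⟨P (z - c • f z), hPK _⟩
  have hg : ContractingWith (Real.toNNReal √q) g := by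
    refine ⟨?_, LipschitzWith.of_dist_le_mul fun z z' => ?_⟩
    · rw [← NNReal.coe_lt_coe, Real.coe_toNNReal _ (Real.sqrt_nonneg _), NNReal.coe_one,
        Real.sqrt_lt' one_pos]
      simpa using hq1
    · change dist (P (z - c • f z)) (P (z' - c • f z')) ≤ (Real.toNNReal √q : ℝ) * dist (z : E) z'
      rw [Real.coe_toNNReal _ (Real.sqrt_nonneg _), dist_eq_norm, dist_eq_norm]
      refine abs_le_of_sq_le_sq' ?_ (by positivity) |>.2
      rw [mul_pow, Real.sq_sqrt hq0]
      refine (hPn _ _).trans ?_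
      have e : (z : E) - c • f z - (z' - c • f z') = (z - z') - c • (f z - f z') := by
        rw [smul_sub]; abel
      have h1 := hmono z z.2 z' z'.2
      have h2 := hexp z z.2 z' z'.2
      have h3 : ‖(z : E) - z'‖ ≤ M * ‖f z - f z'‖ := h2.trans <| by
        gcongr
        have := le_abs_self L
        simp only [M]; linarith
      rw [e, norm_sub_sq_real, inner_smul_right, norm_smul, mul_pow, Real.norm_eq_abs, sq_abs,
        real_inner_comm]
      have h4 : (c / M) ^ 2 * ‖(z : E) - z'‖ ^ 2 ≤ c ^ 2 * ‖f z - f z'‖ ^ 2 := by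
        have : ‖(z : E) - z'‖ ^ 2 ≤ M ^ 2 * ‖f z - f z'‖ ^ 2 := by
          rw [← mul_pow]; gcongr
        calc (c / M) ^ 2 * ‖(z : E) - z'‖ ^ 2 ≤ (c / M) ^ 2 * (M ^ 2 * ‖f z - f z'‖ ^ 2) := by gcongr
          _ = _ := by field_simp
      have h5 : c * (c * ‖f z - f z'‖ ^ 2) ≤ c * inner ℝ (f z - f z') (z - z') := by gcongr
      simp only [q]
      linarith
  let z := ContractingWith.fixedPoint g hg
  have hz : P (z - c • f z) = z := congrArg Subtype.val (hg.fixedPoint_isFixedPt)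
  refine ⟨z, z.2, fun w hw => ?_⟩
  have h1 := hP (z - c • f z) w hw
  rw [hz] at h1
  have e : (z : E) - c • f z - z = -(c • f z) := by abel
  rw [e, inner_neg_left, inner_smul_left] at h1
  have h2 : 0 ≤ c * (inner ℝ (f z) (w - z) : ℝ) := by simpa using h1
  exact nonneg_of_mul_nonneg_right h2 hc

/-- An invertible Hilbert-Schmidt perturbation of the identity is diagonal together with its
inverse. -/
theorem exists_isDiag_inverse {K T J : E →L[ℝ] E} (hK : IsSelfAdjoint K) (hs : hsNorm K < ∞)
    (hT : T = 1 + K) {m : ℝ} (hm : 0 < m) (hc : ∀ x, m * ‖x‖ ^ 2 ≤ inner ℝ x (T x))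
    (hJ : J * T = 1) :
    ∃ (b : HilbertBasis (EigIdx K) ℝ E) (l : EigIdx K → ℝ), IsDiag b T l ∧
      IsDiag b J (fun k => (l k)⁻¹) ∧ ∀ k, m ≤ l k ∧ l k ≤ ‖T‖ := by
  obtain ⟨b, hb⟩ := exists_eigenbasis_of_hs hK hs
  have hTd : IsDiag b T (fun k => 1 + k.1) := by rw [hT]; exact (IsDiag.one b).add hb
  have hl : ∀ k : EigIdx K, m ≤ 1 + k.1 := by
    intro k
    have := hc (b k)
    rwa [hTd.eigenvalue_eq, b.orthonormal.1 k, one_pow, mul_one] at this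
  refine ⟨b, _, hTd, fun k => ?_, fun k => ⟨hl k, (le_abs_self _).trans (hTd.abs_le_norm k)⟩⟩
  have h1 : J (T (b k)) = b k := congrArg (fun A => A (b k)) hJ
  rw [hTd k, map_smul] at h1
  have h0 : (1 + k.1 : ℝ) ≠ 0 := (hm.trans_le (hl k)).ne'
  calc J (b k) = (1 + k.1 : ℝ)⁻¹ • (1 + k.1 : ℝ) • J (b k) := by
        rw [smul_smul, inv_mul_cancel₀ h0, one_smul]
    _ = _ := by rw [h1]

end HilbertSpace

/-! ### Arrays indexed by pairs and the invertibility of `Γ_SS` -/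

section Arrays

variable {p : ℕ} {H : Fin p → Type*} [∀ j, NormedAddCommGroup (H j)]
  [∀ j, InnerProductSpace ℝ (H j)] [∀ j, CompleteSpace (H j)] (S : Finset (Fin p × Fin p))

/-- The entries in `S` of a Hilbert-Schmidt operator on the product space. -/
noncomputable def resS : HSOp (PiLp 2 H) (PiLp 2 H) →L[ℝ] (∀ e : S, HSAt H e.1) :=
  ContinuousLinearMap.pi fun e => hblk e.1.1 e.1.2

/-- The operator on the product space whose entries in `S` are given and whose other entries
vanish. -/
noncomputable def incS : (∀ e : S, HSAt H e.1) →L[ℝ] HSOp (PiLp 2 H) (PiLp 2 H) :=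
  ∑ e : S, hinc e.1.1 e.1.2 ∘L ContinuousLinearMap.proj e

variable {S}

theorem incS_apply (v : ∀ e : S, HSAt H e.1) : incS S v = ∑ e : S, hinc e.1.1 e.1.2 (v e) := by
  rw [incS, _root_.sum_apply]; rfl

theorem resS_apply (A : HSOp (PiLp 2 H) (PiLp 2 H)) (e : S) : resS S A e = hblk e.1.1 e.1.2 A := rfl

theorem hblk_incS_mem (v : ∀ e : S, HSAt H e.1) (e : S) : hblk e.1.1 e.1.2 (incS S v) = v e := by
  rw [incS_apply, map_sum, Finset.sum_eq_single e]
  · exact hblk_hinc_same _ _ _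
  · intro e' _ hne
    exact hblk_hinc_ne (fun h => hne (Subtype.ext (Prod.ext h.1.symm h.2.symm))) _
  · simp

theorem hblk_incS_notMem (v : ∀ e : S, HSAt H e.1) {i j : Fin p} (h : (i, j) ∉ S) :
    hblk i j (incS S v) = 0 := by
  rw [incS_apply, map_sum]
  refine Finset.sum_eq_zero fun e _ => hblk_hinc_ne (fun h' => h ?_) _
  have : (i, j) = e.1 := Prod.ext h'.1 h'.2
  rw [this]; exact e.2

theorem norm_hblk_incS_le (v : ∀ e : S, HSAt H e.1) (i j : Fin p) :
    ‖hblk i j (incS S v)‖ ≤ ‖v‖ := by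
  by_cases h : (i, j) ∈ S
  · rw [hblk_incS_mem v ⟨(i, j), h⟩]; exact norm_le_pi_norm v _
  · rw [hblk_incS_notMem v h, norm_zero]; exact norm_nonneg _

theorem resS_incS (v : ∀ e : S, HSAt H e.1) : resS S (incS S v) = v := by
  funext e; exact hblk_incS_mem v e

theorem incS_resS {A : HSOp (PiLp 2 H) (PiLp 2 H)} (h : ∀ i j, (i, j) ∉ S → hblk i j A = 0) :
    incS S (resS S A) = A := by
  refine hsop_ext fun i j => ?_
  by_cases hS : (i, j) ∈ S
  · rw [hblk_incS_mem _ ⟨(i, j), hS⟩]; rfl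
  · rw [hblk_incS_notMem _ hS, h i j hS]

theorem inner_incS (v : ∀ e : S, HSAt H e.1) (A : HSOp (PiLp 2 H) (PiLp 2 H)) :
    inner ℝ (incS S v) A = ∑ e : S, (inner ℝ (v e) (resS S A e) : ℝ) := by
  rw [incS_apply, sum_inner]
  exact Finset.sum_congr rfl fun e _ => inner_hinc _ _ _ _

theorem inner_incS_congr (v : ∀ e : S, HSAt H e.1) {A B : HSOp (PiLp 2 H) (PiLp 2 H)}
    (h : resS S A = resS S B) : inner ℝ (incS S v) A = (inner ℝ (incS S v) B : ℝ) := by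
  rw [inner_incS, inner_incS, h]

theorem norm_resS_le {A : HSOp (PiLp 2 H) (PiLp 2 H)} {m : ℝ} (hm : 0 ≤ m)
    (h : ∀ i j, ‖hblk i j A‖ ≤ m) : ‖resS S A‖ ≤ m :=
  (pi_norm_le_iff_of_nonneg hm).2 fun _ => h _ _

theorem gammaRow_blk (R : PiLp 2 H →L[ℝ] PiLp 2 H) (e : Fin p × Fin p) (v : ∀ e : S, HSAt H e.1) :
    gammaRow (blk R) S e v = hblk e.1 e.2 (sandwich R R (incS S v)) := by
  rw [gammaRow, incS_apply, _root_.sum_apply, map_sum, map_sum]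
  refine Finset.sum_congr rfl fun e' _ => ?_
  apply HSOp.toCLM_injective
  rfl

/-- This identifies `Γ_SS` with the compression of `A ↦ RAR` to arrays supported in `S`, so
coercivity on the full space can be used. -/
theorem gammaSS_blk (R : PiLp 2 H →L[ℝ] PiLp 2 H) (v : ∀ e : S, HSAt H e.1) :
    gammaSS (blk R) S v = resS S (sandwich R R (incS S v)) := by
  funext e
  exact gammaRow_blk R e.1 v

/-- Arrays carry the maximum norm over entries, for which row sums of entry norms control a row
operator. -/
theorem norm_apply_le_rowSum {e : Fin p × Fin p} (L : (∀ e' : S, HSAt H e'.1) →L[ℝ] HSAt H e)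
    (v : ∀ e : S, HSAt H e.1) : ‖L v‖ ≤ rowSum L * ‖v‖ := by
  classical
  have hv : v = ∑ e' : S, ContinuousLinearMap.single ℝ (fun e' : S => HSAt H e'.1) e' (v e') := by
    funext e'
    rw [Finset.sum_apply, Finset.sum_eq_single e']
    · simp
    · intro k _ hk; simp [Pi.single_eq_of_ne hk.symm]
    · simp
  conv_lhs => rw [hv, map_sum]
  rw [rowSum, Finset.sum_mul]
  refine (norm_sum_le _ _).trans (Finset.sum_le_sum fun e' _ => ?_)
  refine ((L ∘L ContinuousLinearMap.single ℝ (fun e' : S => HSAt H e'.1) e').le_opNorm (v e')).trans ?_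
  gcongr
  exact norm_le_pi_norm v e'

/-- For a coercive `R`, the submatrix `Γ_{SS}` is invertible. -/
theorem isUnit_gammaSS {R : PiLp 2 H →L[ℝ] PiLp 2 H} {c : ℝ} (hc : 0 < c)
    (h : ∀ A : HSOp (PiLp 2 H) (PiLp 2 H), c * ‖A‖ ^ 2 ≤ inner ℝ A (sandwich R R A)) :
    IsUnit (gammaSS (blk R) S) := by
  have hinj : Function.Injective (gammaSS (blk R) S) := by
    rw [injective_iff_map_eq_zero]
    intro v hv
    rw [gammaSS_blk] at hv
    have h1 := h (incS S v)
    rw [inner_incS_congr v (B := 0) (by rw [hv, map_zero]), inner_zero_right] at h1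
    have h2 : ‖incS S v‖ = 0 := by
      by_contra h3
      have : 0 < ‖incS S v‖ ^ 2 := by positivity
      nlinarith
    rw [← resS_incS v, norm_eq_zero.1 h2, map_zero]
  have hsurj : Function.Surjective (gammaSS (blk R) S) := by
    intro v
    -- The array space is not a Hilbert space, so Lax-Milgram is applied on the Hilbert-Schmidt
    -- operators. `Q` is the orthogonal projection onto those supported in `S`, and `QΓQ + (1 - Q)`
    -- is coercive and preserves the splitting.
    let Q := incS S ∘L resS (H := H) S
    let L := Q ∘L sandwich R R ∘L Q + (1 - Q)
    have hQQ : ∀ A, Q (Q A) = Q A := fun A => by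
      change incS S (resS S (incS S (resS S A))) = _
      rw [resS_incS]; rfl
    have hQi : ∀ A B, (inner ℝ (Q A) B : ℝ) = inner ℝ (Q A) (Q B) := fun A B =>
      inner_incS_congr _ (by change _ = resS S (incS S (resS S B)); rw [resS_incS])
    have hL : ∀ A, min c 1 * ‖A‖ ^ 2 ≤ inner ℝ A (L A) := by
      intro A
      have e1 : (inner ℝ A (Q (sandwich R R (Q A))) : ℝ) = inner ℝ (Q A) (sandwich R R (Q A)) := by
        rw [real_inner_comm, hQi, real_inner_comm, ← hQi]
      have e2 : (inner ℝ A (A - Q A) : ℝ) = ‖A - Q A‖ ^ 2 := by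
        rw [← real_inner_self_eq_norm_sq, inner_sub_left (A) (Q A), hQi A (A - Q A), map_sub, hQQ,
          sub_self, inner_zero_right, sub_zero]
      have e3 : ‖A‖ ^ 2 = ‖Q A‖ ^ 2 + ‖A - Q A‖ ^ 2 := by
        have : A = Q A + (A - Q A) := by abel
        conv_lhs => rw [this]
        rw [norm_add_sq_real, hQi A (A - Q A), map_sub, hQQ, sub_self, inner_zero_right]
        ring
      have e4 : (inner ℝ A (L A) : ℝ) =
          inner ℝ A (Q (sandwich R R (Q A))) + inner ℝ A (A - Q A) := by
        rw [← inner_add_right]; rfl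
      have h1 := h (Q A)
      rw [e4, e1, e2, e3]
      have h2 := min_le_left c 1
      have h3 := min_le_right c 1
      nlinarith [sq_nonneg ‖Q A‖, sq_nonneg ‖A - Q A‖]
    obtain ⟨u, hu⟩ := isUnit_of_coercive (lt_min hc one_pos) hL
    let A := (↑u⁻¹ : HSOp (PiLp 2 H) (PiLp 2 H) →L[ℝ] HSOp (PiLp 2 H) (PiLp 2 H)) (incS S v)
    have hA : L A = incS S v := by
      have : L * ↑u⁻¹ = 1 := by rw [← hu]; exact u.mul_inv
      exact congrArg (fun T => T (incS S v)) this
    have hQv : Q (incS S v) = incS S v := by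
      change incS S (resS S (incS S v)) = _
      rw [resS_incS]
    have h1 : Q (L A) = Q (sandwich R R (Q A)) := by
      change Q (Q (sandwich R R (Q A)) + (A - Q A)) = _
      rw [map_add, hQQ, map_sub, hQQ, sub_self, add_zero]
    refine ⟨resS S A, ?_⟩
    rw [gammaSS_blk]
    rw [hA, hQv] at h1
    have h2 := congrArg (resS S) h1
    rw [resS_incS] at h2
    rw [h2]
    exact (resS_incS _).symm
  let e := ContinuousLinearEquiv.ofBijective (gammaSS (blk R) S)
    (LinearMap.ker_eq_bot.2 hinj) (LinearMap.range_eq_top.2 hsurj)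
  refine ⟨ContinuousLinearEquiv.toUnit e, ?_⟩
  ext1 x
  rfl

end Arrays

/-! ### The inner fixed point: solving the gradient equation on `S` -/

section PrimalDual

variable {p : ℕ} {H : Fin p → Type*} [∀ j, NormedAddCommGroup (H j)]
  [∀ j, InnerProductSpace ℝ (H j)] [∀ j, CompleteSpace (H j)] {S : Finset (Fin p × Fin p)}

theorem isSelfAdjoint_toCLM {A : HSOp (PiLp 2 H) (PiLp 2 H)} (h : HSOp.adj _ _ A = A) :
    IsSelfAdjoint A.toCLM := by
  rw [ContinuousLinearMap.isSelfAdjoint_iff', ← HSOp.adj_toCLM, h]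

theorem selfAdjoint_of_mul_eq_one {E : Type*} [NormedAddCommGroup E] [InnerProductSpace ℝ E]
    [CompleteSpace E] {T J : E →L[ℝ] E} (hT : IsSelfAdjoint T) (h2 : T * J = 1) :
    IsSelfAdjoint J := by
  have h3 : star J * T = 1 := by
    have := congrArg star h2
    rwa [star_mul, hT.star_eq, star_one] at this
  calc star J = star J * (T * J) := by rw [h2, mul_one]
    _ = J := by rw [← mul_assoc, h3, one_mul]

/-- The inverse of a small self-adjoint perturbation of `R⁻¹`. -/
theorem perturbed_inverse {R Rinv D : PiLp 2 H →L[ℝ] PiLp 2 H} (hR : R * Rinv = 1)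
    (hR' : Rinv * R = 1) (hRsa : IsSelfAdjoint R) {ρ y : ℝ} (hρ1 : 1 ≤ ρ) (hρ : rowNorm R ≤ ρ)
    (hlow : ∀ x, ρ⁻¹ * ‖x‖ ^ 2 ≤ inner ℝ x (Rinv x)) (hD : IsSelfAdjoint D) (hDy : rowNorm D ≤ y)
    (hy : ρ * y ≤ 1 / 6) :
    IsSelfAdjoint (Rinv + D) ∧ (∀ x, 5 / 6 * ρ⁻¹ * ‖x‖ ^ 2 ≤ inner ℝ x ((Rinv + D) x)) ∧
      Ring.inverse (Rinv + D) * (Rinv + D) = 1 ∧ (Rinv + D) * Ring.inverse (Rinv + D) = 1 ∧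
      IsSelfAdjoint (Ring.inverse (Rinv + D)) ∧ rowNorm (Ring.inverse (Rinv + D)) ≤ 6 / 5 * ρ ∧
      Ring.inverse (Rinv + D) * D * R = R - Ring.inverse (Rinv + D) ∧
      rowNorm (R - Ring.inverse (Rinv + D)) ≤ 6 / 5 * ρ * (ρ * y) := by
  have hρ0 : 0 < ρ := by linarith
  have hsa : IsSelfAdjoint (Rinv + D) := (selfAdjoint_of_mul_eq_one hRsa hR).add hD
  have hy' : y ≤ 1 / 6 * ρ⁻¹ := by
    rw [← div_eq_mul_inv, le_div_iff₀ hρ0]; linarith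
  have hcoer : ∀ x, 5 / 6 * ρ⁻¹ * ‖x‖ ^ 2 ≤ inner ℝ x ((Rinv + D) x) := by
    intro x
    have h1 := hlow x
    have h2 := (abs_le.1 (abs_inner_le_rowNorm hD x)).1
    have h3 : rowNorm D * ‖x‖ ^ 2 ≤ 1 / 6 * ρ⁻¹ * ‖x‖ ^ 2 := by
      gcongr; exact hDy.trans hy'
    rw [_root_.add_apply, inner_add_right]
    linarith
  have hu := isUnit_of_coercive (by positivity) hcoer
  have h1 := Ring.inverse_mul_cancel _ hu
  have h2 := Ring.mul_inverse_cancel _ hu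
  set J := Ring.inverse (Rinv + D)
  have hJDR : J * D * R = R - J := by
    calc J * D * R = J * (Rinv + D) * R - J * (Rinv * R) := by noncomm_ring
      _ = _ := by rw [h1, hR', one_mul, mul_one]
  have hJDR' : rowNorm (J * D * R) ≤ rowNorm J * (ρ * y) := by
    calc rowNorm (J * D * R) ≤ rowNorm (J * D) * rowNorm R := rowNorm_comp _ _
      _ ≤ (rowNorm J * rowNorm D) * rowNorm R := by
          gcongr
          · exact rowNorm_nonneg _
          · exact rowNorm_comp _ _
      _ ≤ (rowNorm J * y) * ρ := by
          have := rowNorm_nonneg J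
          have := rowNorm_nonneg R
          have := rowNorm_nonneg D
          gcongr
          exact mul_nonneg ‹_› (by linarith)
      _ = _ := by ring
  -- Invertibility is already known from coercivity, so `J = R - JDR` gives `rowNorm J ≤ ρ + rowNorm
  -- J / 6`, which can be solved for `rowNorm J` without a Neumann series.
  have hJ : rowNorm J ≤ 6 / 5 * ρ := by
    have e : J = R + -(J * D * R) := by rw [hJDR]; abel
    have h3 : rowNorm J ≤ rowNorm R + rowNorm (J * D * R) := by
      conv_lhs => rw [e]
      exact (rowNorm_add _ _).trans (by rw [rowNorm_neg])
    have := rowNorm_nonneg J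
    nlinarith
  refine ⟨hsa, hcoer, h1, h2, selfAdjoint_of_mul_eq_one hsa h2, hJ, hJDR, ?_⟩
  rw [← hJDR]
  refine hJDR'.trans ?_
  have hy0 : 0 ≤ y := (rowNorm_nonneg D).trans hDy
  gcongr

theorem resS_adj_congr (hS : ∀ i j, (i, j) ∈ S → (j, i) ∈ S) {A B : HSOp (PiLp 2 H) (PiLp 2 H)}
    (h : resS S A = resS S B) : resS S (HSOp.adj _ _ A) = resS S (HSOp.adj _ _ B) := by
  funext e
  rw [resS_apply, resS_apply, hblk_adj, hblk_adj]
  have h1 := congrFun h ⟨(e.1.2, e.1.1), hS _ _ e.2⟩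
  rw [resS_apply, resS_apply] at h1
  rw [h1]

theorem incS_resS_adj_incS (hS : ∀ i j, (i, j) ∈ S → (j, i) ∈ S) (v : ∀ e : S, HSAt H e.1) :
    incS S (resS S (HSOp.adj _ _ (incS S v))) = HSOp.adj _ _ (incS S v) := by
  refine incS_resS fun i j hij => ?_
  rw [hblk_adj, hblk_incS_notMem _ (fun h => hij (hS _ _ h)), map_zero]

theorem adj_incS_resS (hS : ∀ i j, (i, j) ∈ S → (j, i) ∈ S) {A : HSOp (PiLp 2 H) (PiLp 2 H)}
    (hA : HSOp.adj _ _ A = A) : HSOp.adj _ _ (incS S (resS S A)) = incS S (resS S A) := by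
  have h1 : resS S (HSOp.adj _ _ (incS S (resS S A))) = resS S A := by
    rw [resS_adj_congr hS (B := A) (by rw [resS_incS]), hA]
  rw [← incS_resS_adj_incS hS, h1]

/-- The inverse of `Γ_{SS}` preserves self-adjointness. -/
theorem adj_incS_inverse_gammaSS (hS : ∀ i j, (i, j) ∈ S → (j, i) ∈ S)
    {R : PiLp 2 H →L[ℝ] PiLp 2 H} (hRsa : IsSelfAdjoint R) (hΓ : IsUnit (gammaSS (blk R) S))
    {v : ∀ e : S, HSAt H e.1} (hv : HSOp.adj _ _ (incS S v) = incS S v) :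
    HSOp.adj _ _ (incS S (Ring.inverse (gammaSS (blk R) S) v)) =
      incS S (Ring.inverse (gammaSS (blk R) S) v) := by
  have hΓ1 : ∀ v, Ring.inverse (gammaSS (blk R) S) (gammaSS (blk R) S v) = v := fun v =>
    congrArg (fun T => T v) (Ring.inverse_mul_cancel _ hΓ)
  have hY : gammaSS (blk R) S (Ring.inverse (gammaSS (blk R) S) v) = v :=
    congrArg (fun T => T v) (Ring.mul_inverse_cancel _ hΓ)
  set Y := Ring.inverse (gammaSS (blk R) S) v
  -- Taking adjoints commutes with `A ↦ RAR` and with restriction to the symmetric set `S`. Hence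
  -- `Y` and its adjoint have the same image under the injective `Γ_SS`.
  have h2 : gammaSS (blk R) S (resS S (HSOp.adj _ _ (incS S Y))) = v := by
    have e : sandwich R R (HSOp.adj _ _ (incS S Y)) = HSOp.adj _ _ (sandwich R R (incS S Y)) := by
      rw [adj_sandwich, (ContinuousLinearMap.isSelfAdjoint_iff').1 hRsa]
    have h3 : resS S (sandwich R R (incS S Y)) = resS S (incS S v) := by
      rw [resS_incS, ← gammaSS_blk, hY]
    rw [gammaSS_blk, incS_resS_adj_incS hS, e, resS_adj_congr hS h3, hv, resS_incS]
  have h3 : resS S (HSOp.adj _ _ (incS S Y)) = Y := by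
    rw [← hΓ1 (resS S (HSOp.adj _ _ (incS S Y))), h2]
  rw [← incS_resS_adj_incS hS, h3]

/-- Exhibits `(R-J)AR` as what remains of `R - J` after its linear part `RAR`, up to sign; it is
therefore of second order in `A`. -/
theorem remainder_toCLM {R J : PiLp 2 H →L[ℝ] PiLp 2 H} {A : HSOp (PiLp 2 H) (PiLp 2 H)}
    (h : J * A.toCLM * R = R - J) :
    (sandwich (R - J) R A).toCLM = R * A.toCLM * R - (R - J) := by
  change (R - J) * (A.toCLM * R) = _
  rw [sub_mul, ← mul_assoc, ← mul_assoc, h]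

/-- The resolvent identity `J' - J = J(A - A')J'` reduces the difference to `R(A-A')R - J(A-A')J'`.
Telescoping leaves a small factor `R - J` or `R - J'` in each term, hence a small Lipschitz
constant. -/
theorem remainder_sub {R Rinv J J' : PiLp 2 H →L[ℝ] PiLp 2 H} {A A' : HSOp (PiLp 2 H) (PiLp 2 H)}
    (h : J * A.toCLM * R = R - J) (h' : J' * A'.toCLM * R = R - J')
    (h1 : J * (Rinv + A.toCLM) = 1) (h2 : (Rinv + A'.toCLM) * J' = 1) :
    sandwich (R - J) R A - sandwich (R - J') R A' =
      sandwich (R - J) R (A - A') + sandwich J (R - J') (A - A') := by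
  apply HSOp.toCLM_injective
  have hJJ : J' - J = J * (A.toCLM - A'.toCLM) * J' := by
    calc J' - J = (J * (Rinv + A.toCLM)) * J' - J * ((Rinv + A'.toCLM) * J') := by
          rw [h1, h2, one_mul, mul_one]
      _ = _ := by
          simp only [sub_mul, mul_sub, mul_add, add_mul, mul_assoc]; abel
  rw [map_sub, map_add, remainder_toCLM h, remainder_toCLM h', sandwich_toCLM, sandwich_toCLM,
    map_sub]
  change _ = (R - J) * ((A.toCLM - A'.toCLM) * R) + J * ((A.toCLM - A'.toCLM) * (R - J'))
  calc _ = R * (A.toCLM - A'.toCLM) * R - (J' - J) := by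
        simp only [sub_mul, mul_sub, mul_assoc]; abel
    _ = _ := by
        rw [hJJ]
        simp only [sub_mul, mul_sub, mul_assoc]; abel

theorem adj_remainder {R J : PiLp 2 H →L[ℝ] PiLp 2 H} {A : HSOp (PiLp 2 H) (PiLp 2 H)}
    (h : J * A.toCLM * R = R - J) (hR : IsSelfAdjoint R) (hJ : IsSelfAdjoint J)
    (hA : HSOp.adj _ _ A = A) :
    HSOp.adj _ _ (sandwich (R - J) R A) = sandwich (R - J) R A := by
  apply HSOp.toCLM_injective
  have h1 : IsSelfAdjoint (R * A.toCLM * R - (R - J)) :=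
    ((isSelfAdjoint_toCLM hA).conjugate_self hR).sub (hR.sub hJ)
  rw [HSOp.adj_toCLM, remainder_toCLM h, ContinuousLinearMap.isSelfAdjoint_iff'.1 h1]

set_option maxHeartbeats 1000000 in
/-- The inner fixed point problem: the gradient equation on the entries in `S`. -/
theorem exists_gradient_eq {R Rinv : PiLp 2 H →L[ℝ] PiLp 2 H} (hR : R * Rinv = 1)
    (hR' : Rinv * R = 1) (hRsa : IsSelfAdjoint R) {ρ γ d r : ℝ} (hρ1 : 1 ≤ ρ) (hρ : rowNorm R ≤ ρ)
    (hlow : ∀ x, ρ⁻¹ * ‖x‖ ^ 2 ≤ inner ℝ x (Rinv x))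
    (hS : ∀ i j, (i, j) ∈ S → (j, i) ∈ S) (hΓ : IsUnit (gammaSS (blk R) S))
    (hγ0 : 0 < γ) (hγ : ∀ v, ‖Ring.inverse (gammaSS (blk R) S) v‖ ≤ γ * ‖v‖)
    (hd0 : 0 ≤ d) (hd : ∀ v : (∀ e : S, HSAt H e.1), rowNorm (incS S v).toCLM ≤ d * ‖v‖)
    (hr : 0 ≤ r) (hx : ρ * (d * r) ≤ 1 / 6) (hx' : γ * ρ ^ 3 * d * r ≤ 1 / 6)
    (G : ∀ e : S, HSAt H e.1) (hG : HSOp.adj _ _ (incS S G) = incS S G) (hGr : γ * ‖G‖ ≤ r / 2) :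
    ∃ Δ : (∀ e : S, HSAt H e.1), ‖Δ‖ ≤ r ∧ HSOp.adj _ _ (incS S Δ) = incS S Δ ∧
      resS S (sandwich (Ring.inverse (Rinv + (incS S Δ).toCLM)) R (incS S Δ)) = -G := by
  let J : (∀ e : S, HSAt H e.1) → (PiLp 2 H →L[ℝ] PiLp 2 H) :=
    fun Δ => Ring.inverse (Rinv + (incS S Δ).toCLM)
  let s : Set (∀ e : S, HSAt H e.1) := {Δ | ‖Δ‖ ≤ r ∧ HSOp.adj _ _ (incS S Δ) = incS S Δ}
  have hP : ∀ Δ ∈ s, _ := fun Δ hΔ => perturbed_inverse hR hR' hRsa hρ1 hρ hlow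
    (isSelfAdjoint_toCLM hΔ.2) ((hd Δ).trans (mul_le_mul_of_nonneg_left hΔ.1 hd0)) hx
  let rem : (∀ e : S, HSAt H e.1) → HSOp (PiLp 2 H) (PiLp 2 H) :=
    fun Δ => sandwich (R - J Δ) R (incS S Δ)
  have hcl : IsClosed s := by
    refine (isClosed_le continuous_norm continuous_const).inter (isClosed_eq ?_ ?_)
    · exact (HSOp.adj _ _).continuous.comp (incS S).continuous
    · exact (incS S).continuous
  have h0s : (0 : ∀ e : S, HSAt H e.1) ∈ s := ⟨by simpa using hr, by simp⟩
  -- Fixed points of `F` are the solutions of `Γ_SS Δ = rem Δ - G`, which is the gradient equation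
  -- because `RΔR - rem Δ = JΔR`.
  let F : (∀ e : S, HSAt H e.1) → (∀ e : S, HSAt H e.1) :=
    fun Δ => Ring.inverse (gammaSS (blk R) S) (resS S (rem Δ) - G)
  have hΓ1 : ∀ v, Ring.inverse (gammaSS (blk R) S) (gammaSS (blk R) S v) = v := fun v =>
    congrArg (fun T => T v) (Ring.inverse_mul_cancel _ hΓ)
  have hΓ2 : ∀ v, gammaSS (blk R) S (Ring.inverse (gammaSS (blk R) S) v) = v := fun v =>
    congrArg (fun T => T v) (Ring.mul_inverse_cancel _ hΓ)
  have hremadj : ∀ Δ ∈ s, HSOp.adj _ _ (rem Δ) = rem Δ := by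
    intro Δ hΔ
    obtain ⟨-, -, -, -, hJ, -, hJDR, -⟩ := hP Δ hΔ
    exact adj_remainder hJDR hRsa hJ hΔ.2
  have hlip : ∀ Δ ∈ s, ∀ Δ' ∈ s, ‖F Δ - F Δ'‖ ≤ 22 / 50 * ‖Δ - Δ'‖ := by
    intro Δ hΔ Δ' hΔ'
    obtain ⟨-, -, h1, -, -, hJ, hJDR, hRJ⟩ := hP Δ hΔ
    obtain ⟨-, -, -, h2', hJsa', -, hJDR', hRJ'⟩ := hP Δ' hΔ'
    have e : rem Δ - rem Δ' = sandwich (R - J Δ) R (incS S (Δ - Δ')) +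
        sandwich (J Δ) (R - J Δ') (incS S (Δ - Δ')) := by
      rw [map_sub]
      exact remainder_sub hJDR hJDR' h1 h2'
    have hJsa : IsSelfAdjoint (J Δ') := hJsa'
    have hsa : IsSelfAdjoint (R - J Δ') := 
      IsSelfAdjoint.sub (R := PiLp 2 H →L[ℝ] PiLp 2 H) hRsa hJsa
    -- The two terms of `remainder_sub` contribute `6/5` and `(6/5)²`, whose sum is `66/25`. The
    -- smallness hypothesis supplies `1/6`, giving the contraction constant `22/50`.
    have hb : ∀ i j, ‖hblk i j (rem Δ - rem Δ')‖ ≤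
        66 / 25 * ρ ^ 2 * (ρ * (d * r)) * ‖Δ - Δ'‖ := by
      intro i j
      rw [e, map_add]
      have b1 := norm_hblk_sandwich_le (S := R - J Δ) hRsa (norm_hblk_incS_le (Δ - Δ')) i j
      have b2 := norm_hblk_sandwich_le (S := J Δ) hsa
        (norm_hblk_incS_le (Δ - Δ')) i j
      have hn := norm_nonneg (Δ - Δ')
      have hx0 : 0 ≤ ρ * (d * r) := by positivity
      have b1' : rowNorm (R - J Δ) * ‖Δ - Δ'‖ * rowNorm R ≤
          6 / 5 * ρ * (ρ * (d * r)) * ‖Δ - Δ'‖ * ρ := by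
        have := rowNorm_nonneg R
        gcongr
      have b2' : rowNorm (J Δ) * ‖Δ - Δ'‖ * rowNorm (R - J Δ') ≤
          6 / 5 * ρ * ‖Δ - Δ'‖ * (6 / 5 * ρ * (ρ * (d * r))) := by
        have := rowNorm_nonneg (R - J Δ')
        gcongr
      refine (norm_add_le _ _).trans ((add_le_add (b1.trans b1') (b2.trans b2')).trans_eq ?_)
      ring
    have hb' := norm_resS_le (S := S) (by positivity) hb
    have e3 : F Δ - F Δ' = Ring.inverse (gammaSS (blk R) S) (resS S (rem Δ - rem Δ')) := by
      simp only [F]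
      rw [← map_sub, map_sub (resS S)]
      congr 1
      abel
    rw [e3]
    calc _ ≤ γ * ‖resS S (rem Δ - rem Δ')‖ := hγ _
      _ ≤ γ * (66 / 25 * ρ ^ 2 * (ρ * (d * r)) * ‖Δ - Δ'‖) := by gcongr
      _ = 66 / 25 * (γ * ρ ^ 3 * d * r) * ‖Δ - Δ'‖ := by ring
      _ ≤ 66 / 25 * (1 / 6) * ‖Δ - Δ'‖ := by gcongr
      _ = _ := by ring
  have hF0 : ‖F 0‖ ≤ r / 2 := by
    have : F 0 = Ring.inverse (gammaSS (blk R) S) (-G) := by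
      simp only [F, rem]
      rw [map_zero, map_zero, map_zero, zero_sub]
    rw [this]
    refine (hγ _).trans ?_
    rwa [norm_neg]
  have hmaps : Set.MapsTo F s s := by
    intro Δ hΔ
    refine ⟨?_, ?_⟩
    -- The ball is preserved because `22/50 + 1/2 ≤ 1`.
    · have h1 := hlip Δ hΔ 0 h0s
      rw [sub_zero] at h1
      have h2 : ‖F Δ‖ ≤ ‖F Δ - F 0‖ + ‖F 0‖ := by
        have := norm_add_le (F Δ - F 0) (F 0); rwa [sub_add_cancel] at this
      have h3 := hΔ.1
      linarith
    · refine adj_incS_inverse_gammaSS hS hRsa hΓ ?_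
      rw [map_sub, map_sub, hG, adj_incS_resS hS (hremadj Δ hΔ)]
  have hsc : CompleteSpace s := hcl.completeSpace_coe
  have hsne : Nonempty s := ⟨⟨0, h0s⟩⟩
  let g : s → s := hmaps.restrict F s s
  have hg : ContractingWith (Real.toNNReal (22 / 50)) g := by
    refine ⟨?_, LipschitzWith.of_dist_le_mul fun z z' => ?_⟩
    · rw [← NNReal.coe_lt_coe, Real.coe_toNNReal _ (by norm_num), NNReal.coe_one]
      norm_num
    · rw [Real.coe_toNNReal _ (by norm_num)]
      change dist (F z) (F z') ≤ _ * dist (z : ∀ e : S, HSAt H e.1) z'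
      rw [dist_eq_norm, dist_eq_norm]
      exact hlip z z.2 z' z'.2
  let Δ := ContractingWith.fixedPoint g hg
  have hΔ : F Δ = Δ := congrArg Subtype.val hg.fixedPoint_isFixedPt
  refine ⟨Δ, Δ.2.1, Δ.2.2, ?_⟩
  have h1 := congrArg (gammaSS (blk R) S) hΔ
  simp only [F] at h1
  rw [hΓ2, gammaSS_blk] at h1
  have h2 : rem Δ = sandwich R R (incS S Δ) - sandwich (J Δ) R (incS S Δ) := by
    apply HSOp.toCLM_injective
    rw [map_sub]
    exact sub_mul R (J Δ) ((incS S (Δ : ∀ e : S, HSAt H e.1)).toCLM * R)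
  rw [h2, map_sub] at h1
  change resS S (sandwich (J Δ) R (incS S Δ)) = -G
  have h3 : ∀ a b c : (∀ e : S, HSAt H e.1), a - b - c = a → b = -c := by
    intro a b c h
    have : b = a - (a - b - c) - c := by abel
    rw [this, h]; abel
  exact h3 _ _ _ h1

end PrimalDual

/-! ### The outer fixed point: choosing the dual variable -/

section DualWitness

variable {p : ℕ} {H : Fin p → Type*} [∀ j, NormedAddCommGroup (H j)]
  [∀ j, InnerProductSpace ℝ (H j)] [∀ j, CompleteSpace (H j)] {S : Finset (Fin p × Fin p)}

/-- Two-sided multiplication by the inverses of coercive perturbations of the identity. -/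
theorem inverse_sandwich_bounds {T T' J J' : PiLp 2 H →L[ℝ] PiLp 2 H}
    {K K' : HSOp (PiLp 2 H) (PiLp 2 H)} (hT : T = 1 + K.toCLM) (hT' : T' = 1 + K'.toCLM)
    (hK : HSOp.adj _ _ K = K) (hK' : HSOp.adj _ _ K' = K') {m M : ℝ} (hm : 0 < m)
    (hc : ∀ x, m * ‖x‖ ^ 2 ≤ inner ℝ x (T x)) (hc' : ∀ x, m * ‖x‖ ^ 2 ≤ inner ℝ x (T' x))
    (hJ : J * T = 1) (hJ' : J' * T' = 1) (hM : 0 < M) (hTM : ‖T‖ ≤ M) (hTM' : ‖T'‖ ≤ M)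
    (D : HSOp (PiLp 2 H) (PiLp 2 H)) :
    M⁻¹ * M⁻¹ * ‖D‖ ^ 2 ≤ inner ℝ D (sandwich J J' D) ∧
      ‖sandwich J J' D‖ ≤ m⁻¹ * m⁻¹ * ‖D‖ := by
  obtain ⟨b, l, -, hbJ, hl⟩ :=
    exists_isDiag_inverse (isSelfAdjoint_toCLM hK) K.hsNorm_lt_top hT hm hc hJ
  obtain ⟨b', l', -, hbJ', hl'⟩ :=
    exists_isDiag_inverse (isSelfAdjoint_toCLM hK') K'.hsNorm_lt_top hT' hm hc' hJ'
  have hlM : ∀ k, M⁻¹ ≤ (l k)⁻¹ := fun k =>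
    inv_anti₀ (hm.trans_le (hl k).1) ((hl k).2.trans hTM)
  have hlM' : ∀ k, M⁻¹ ≤ (l' k)⁻¹ := fun k =>
    inv_anti₀ (hm.trans_le (hl' k).1) ((hl' k).2.trans hTM')
  have hM' : 0 ≤ M⁻¹ := by positivity
  have hm' : 0 ≤ m⁻¹ := by positivity
  refine ⟨le_inner_sandwich hbJ' hM' (hbJ.le_inner hlM) hlM' D hM', ?_⟩
  have hJn : ‖J‖ ≤ m⁻¹ := hbJ.norm_le hm' fun k => by
    rw [abs_of_nonneg (hM'.trans (hlM k))]; exact inv_anti₀ hm (hl k).1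
  have hJn' : ‖J'‖ ≤ m⁻¹ := hbJ'.norm_le hm' fun k => by
    rw [abs_of_nonneg (hM'.trans (hlM' k))]; exact inv_anti₀ hm (hl' k).1
  refine (norm_sandwich_apply_le _ _ _).trans ?_
  calc ‖J‖ * ‖D‖ * ‖J'‖ ≤ m⁻¹ * ‖D‖ * m⁻¹ := by gcongr
    _ = _ := by ring

/-- Both gradients are `R` minus an inverse, so their difference is `J' - J`, to which the resolvent
identity applies. The result is exact, which makes the dependence on the dual variable monotone. -/
theorem gradient_sub {R Rinv J J' : PiLp 2 H →L[ℝ] PiLp 2 H} {A A' : HSOp (PiLp 2 H) (PiLp 2 H)}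
    (h : J * A.toCLM * R = R - J) (h' : J' * A'.toCLM * R = R - J')
    (h1 : J * (Rinv + A.toCLM) = 1) (h2 : (Rinv + A'.toCLM) * J' = 1) :
    sandwich J R A - sandwich J' R A' = sandwich J J' (A - A') := by
  apply HSOp.toCLM_injective
  rw [map_sub, sandwich_toCLM, sandwich_toCLM, sandwich_toCLM, map_sub]
  change J * (A.toCLM * R) - J' * (A'.toCLM * R) = J * ((A.toCLM - A'.toCLM) * J')
  rw [← mul_assoc, ← mul_assoc, h, h']
  calc R - J - (R - J') = (J * (Rinv + A.toCLM)) * J' - J * ((Rinv + A'.toCLM) * J') := by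
        rw [h1, h2, one_mul, mul_one]; abel
    _ = _ := by
        simp only [sub_mul, mul_sub, mul_add, add_mul, mul_assoc]; abel

/-- The dual feasible set: self-adjoint operators with off-diagonal entries in the unit balls,
supported in `S`. -/
def dualSet (S : Finset (Fin p × Fin p)) : Set (HSOp (PiLp 2 H) (PiLp 2 H)) :=
  {Z | HSOp.adj _ _ Z = Z ∧ ∀ i j, (i = j ∨ (i, j) ∉ S → hblk i j Z = 0) ∧ ‖hblk i j Z‖ ≤ 1}

theorem convex_dualSet : Convex ℝ (dualSet (H := H) S) := by
  intro Z hZ Z' hZ' a b ha hb hab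
  refine ⟨by rw [map_add, map_smul, map_smul, hZ.1, hZ'.1], fun i j => ⟨fun h => ?_, ?_⟩⟩
  · rw [map_add, map_smul, map_smul, (hZ.2 i j).1 h, (hZ'.2 i j).1 h, smul_zero, smul_zero, add_zero]
  · rw [map_add, map_smul, map_smul]
    refine (norm_add_le _ _).trans ?_
    rw [norm_smul, norm_smul, Real.norm_of_nonneg ha, Real.norm_of_nonneg hb]
    nlinarith [(hZ.2 i j).2, (hZ'.2 i j).2]

theorem isClosed_dualSet : IsClosed (dualSet (H := H) S) := by
  have e : dualSet (H := H) S = {Z | HSOp.adj _ _ Z = Z} ∩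
      ⋂ i, ⋂ j, ({Z | i = j ∨ (i, j) ∉ S → hblk i j Z = 0} ∩ {Z | ‖hblk i j Z‖ ≤ 1}) := by
    ext Z; simp [dualSet]
  rw [e]
  refine (isClosed_eq (HSOp.adj _ _).continuous continuous_id).inter
    (isClosed_iInter fun i => isClosed_iInter fun j => IsClosed.inter ?_ ?_)
  · by_cases h : i = j ∨ (i, j) ∉ S
    · simp only [h, true_imp_iff]
      exact isClosed_eq (hblk i j).continuous continuous_const
    · simp only [h, false_imp_iff, Set.ofPred_true, isClosed_univ]
  · exact isClosed_le (hblk i j).continuous.norm continuous_const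

theorem zero_mem_dualSet : (0 : HSOp (PiLp 2 H) (PiLp 2 H)) ∈ dualSet S :=
  ⟨map_zero _, fun i j => ⟨fun _ => map_zero _, by rw [map_zero, norm_zero]; exact zero_le_one⟩⟩

/-- The normalized off-diagonal entries of an operator supported in `S` form a dual feasible
operator attaining the sum of the norms. -/
theorem exists_dual_attaining {A : HSOp (PiLp 2 H) (PiLp 2 H)} (hA : HSOp.adj _ _ A = A)
    (hAS : ∀ i j, (i, j) ∉ S → hblk i j A = 0) :
    ∃ Z ∈ dualSet S, inner ℝ A Z = ∑ i, ∑ j, if i = j then 0 else ‖hblk i j A‖ := by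
  let z : ∀ i j, HSOp (H j) (H i) := fun i j =>
    -- A vanishing entry is normalized to zero, since the inverse of `0` is `0`.
    if i = j then 0 else ‖hblk i j A‖⁻¹ • hblk i j A
  let Z := ∑ i, ∑ j, hinc i j (z i j)
  have hz : ∀ i j, hblk i j Z = z i j := by
    intro i j
    simp only [Z, map_sum]
    rw [Finset.sum_eq_single i, Finset.sum_eq_single j]
    · exact hblk_hinc_same _ _ _
    · intro l _ hl; exact hblk_hinc_ne (fun h => hl h.2.symm) _
    · simp
    · intro k _ hk
      exact Finset.sum_eq_zero fun l _ => hblk_hinc_ne (fun h => hk h.1.symm) _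
    · simp
  have hsymm : ∀ i j, HSOp.adj _ _ (hblk j i A) = hblk i j A := fun i j => by rw [← hblk_adj, hA]
  refine ⟨Z, ⟨hsop_ext fun i j => ?_, fun i j => ⟨fun h => ?_, ?_⟩⟩, ?_⟩
  · rw [hblk_adj, hz, hz]
    simp only [z]
    by_cases h : i = j
    · subst h; simp
    · rw [if_neg h, if_neg (Ne.symm h), map_smul, hsymm, ← hsymm j i, LinearIsometry.norm_map]
  · rw [hz]
    simp only [z]
    split_ifs with h1
    · rfl
    · rw [hAS i j (h.resolve_left h1), smul_zero]
  · rw [hz]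
    simp only [z]
    split_ifs with h1
    · rw [norm_zero]; exact zero_le_one
    · rw [norm_smul, norm_inv, norm_norm]
      exact inv_mul_le_one
  · rw [inner_eq_sum_hblk]
    refine Finset.sum_congr rfl fun i _ => Finset.sum_congr rfl fun j _ => ?_
    rw [hz]
    simp only [z]
    split_ifs with h1
    · rw [inner_zero_right]
    · rw [inner_smul_right, real_inner_self_eq_norm_sq]
      rcases eq_or_ne ‖hblk i j A‖ 0 with h | h
      · rw [h]; norm_num
      · field_simp

theorem opNorm_incS_le (v : ∀ e : S, HSAt H e.1) :
    ‖(incS S v).toCLM‖ ≤ ‖incS (H := H) S‖ * ‖v‖ :=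
  (HSOp.opNorm_le _).trans ((incS S).le_opNorm v)

/-- Strong monotonicity and expansiveness of the correspondence between a dual variable and the
solution of the gradient equation on `S`. -/
theorem gradient_monotone {R Rinv J J' : PiLp 2 H →L[ℝ] PiLp 2 H}
    {Hs W Z Z' : HSOp (PiLp 2 H) (PiLp 2 H)} {v v' : ∀ e : S, HSAt H e.1} {m M lam : ℝ}
    (hHs : Hs.toCLM = Rinv - 1) (hK : HSOp.adj _ _ (Hs + incS S v) = Hs + incS S v)
    (hK' : HSOp.adj _ _ (Hs + incS S v') = Hs + incS S v') (hm : 0 < m) (hM : 0 < M)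
    (hlam : 0 < lam)
    (hc : ∀ x, m * ‖x‖ ^ 2 ≤ inner ℝ x ((Rinv + (incS S v).toCLM) x))
    (hc' : ∀ x, m * ‖x‖ ^ 2 ≤ inner ℝ x ((Rinv + (incS S v').toCLM) x))
    (h1 : J * (Rinv + (incS S v).toCLM) = 1) (h1' : J' * (Rinv + (incS S v').toCLM) = 1)
    (h2' : (Rinv + (incS S v').toCLM) * J' = 1)
    (h3 : J * (incS S v).toCLM * R = R - J) (h3' : J' * (incS S v').toCLM * R = R - J')
    (hTM : ‖Rinv + (incS S v).toCLM‖ ≤ M) (hTM' : ‖Rinv + (incS S v').toCLM‖ ≤ M)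
    (hg1 : resS S (sandwich J R (incS S v)) = -resS S (W + lam • Z))
    (hg1' : resS S (sandwich J' R (incS S v')) = -resS S (W + lam • Z'))
    (hZ : ∀ i j, (i, j) ∉ S → hblk i j Z = 0) (hZ' : ∀ i j, (i, j) ∉ S → hblk i j Z' = 0) :
    M⁻¹ * M⁻¹ * ‖incS S v - incS S v'‖ ^ 2 ≤
        -(lam * inner ℝ (incS S v - incS S v') (Z - Z')) ∧
      lam * ‖Z - Z'‖ ≤ ‖incS (H := H) S ∘L resS S‖ * (m⁻¹ * m⁻¹) * ‖incS S v - incS S v'‖ := by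
  have hT : Rinv + (incS S v).toCLM = 1 + (Hs + incS S v).toCLM := by rw [map_add, hHs]; abel
  have hT' : Rinv + (incS S v').toCLM = 1 + (Hs + incS S v').toCLM := by rw [map_add, hHs]; abel
  obtain ⟨b1, b2⟩ := inverse_sandwich_bounds hT hT' hK hK' hm hc
    hc' h1 h1' hM hTM hTM' (incS S v - incS S v')
  have hg := gradient_sub h3 h3' h1 h2'
  -- On `S`, the change of the dual variable is, up to the factor `-lam`, the image of the change of
  -- `Δ` under `D ↦ J D J'`. Its lower bound yields cocoercivity and its upper bound expansiveness.
  have hres : resS S (sandwich J J' (incS S v - incS S v')) = resS S (-(lam • (Z - Z'))) := by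
    rw [← hg, map_sub, hg1, hg1', smul_sub]
    simp only [map_add, map_neg, map_sub]
    abel
  refine ⟨?_, ?_⟩
  · have h4 : (inner ℝ (incS S v - incS S v') (-(lam • (Z - Z'))) : ℝ) =
        -(lam * inner ℝ (incS S v - incS S v') (Z - Z')) := by
      rw [inner_neg_right, inner_smul_right]
    rw [← h4]
    refine b1.trans_eq ?_
    rw [← map_sub] at hres ⊢
    exact inner_incS_congr _ hres
  · have hsupp : incS S (resS S (-(lam • (Z - Z')))) = -(lam • (Z - Z')) := by
      refine incS_resS fun i j hij => ?_
      rw [map_neg, map_smul, map_sub, hZ i j hij, hZ' i j hij, sub_zero, smul_zero, neg_zero]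
    have h5 : lam * ‖Z - Z'‖ = ‖-(lam • (Z - Z'))‖ := by
      rw [norm_neg, norm_smul, Real.norm_of_nonneg hlam.le]
    rw [h5, ← hsupp, ← hres, mul_assoc]
    exact ((incS (H := H) S ∘L resS S).le_opNorm _).trans
      (mul_le_mul_of_nonneg_left b2 (norm_nonneg _))

/-- The primal-dual witness restricted to `S`. -/
theorem exists_restricted_solution {R Rinv : PiLp 2 H →L[ℝ] PiLp 2 H} (hR : R * Rinv = 1)
    (hR' : Rinv * R = 1) (hRsa : IsSelfAdjoint R) {ρ γ d r : ℝ} (hρ1 : 1 ≤ ρ) (hρ : rowNorm R ≤ ρ)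
    (hlow : ∀ x, ρ⁻¹ * ‖x‖ ^ 2 ≤ inner ℝ x (Rinv x))
    (hS : ∀ i j, (i, j) ∈ S → (j, i) ∈ S) (hΓ : IsUnit (gammaSS (blk R) S))
    (hγ0 : 0 < γ) (hγ : ∀ v, ‖Ring.inverse (gammaSS (blk R) S) v‖ ≤ γ * ‖v‖)
    (hd0 : 0 ≤ d) (hd : ∀ v : (∀ e : S, HSAt H e.1), rowNorm (incS S v).toCLM ≤ d * ‖v‖)
    (hr : 0 ≤ r) (hx : ρ * (d * r) ≤ 1 / 6) (hx' : γ * ρ ^ 3 * d * r ≤ 1 / 6)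
    {Hs W : HSOp (PiLp 2 H) (PiLp 2 H)} (hHs : Hs.toCLM = Rinv - 1)
    {lam w : ℝ} (hlam : 0 < lam) (hW : HSOp.adj _ _ W = W) (hWw : ∀ i j, ‖hblk i j W‖ ≤ w)
    (hw : 0 ≤ w) (hrw : r = 2 * γ * (w + lam)) :
    ∃ (Δ : ∀ e : S, HSAt H e.1) (Z : HSOp (PiLp 2 H) (PiLp 2 H)), ‖Δ‖ ≤ r ∧
      HSOp.adj _ _ (incS S Δ) = incS S Δ ∧ Z ∈ dualSet S ∧
      resS S (sandwich (Ring.inverse (Rinv + (incS S Δ).toCLM)) R (incS S Δ)) =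
        -resS S (W + lam • Z) ∧
      ∀ Z' ∈ dualSet S, inner ℝ (Hs + incS S Δ) Z' ≤ (inner ℝ (Hs + incS S Δ) Z : ℝ) := by
  have hρ0 : 0 < ρ := by linarith
  -- The solution map is made total so that it can be chosen as a function; values outside the dual
  -- set play no role. The radius fits since `γ(w + lam) = r/2`.
  have hex : ∀ Z : HSOp (PiLp 2 H) (PiLp 2 H), ∃ Δ : ∀ e : S, HSAt H e.1, Z ∈ dualSet S →
      ‖Δ‖ ≤ r ∧ HSOp.adj _ _ (incS S Δ) = incS S Δ ∧
      resS S (sandwich (Ring.inverse (Rinv + (incS S Δ).toCLM)) R (incS S Δ)) =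
        -resS S (W + lam • Z) := by
    intro Z
    by_cases hZ : Z ∈ dualSet S
    · have hadj : HSOp.adj _ _ (W + lam • Z) = W + lam • Z := by
        rw [map_add, map_smul, hW, hZ.1]
      have hn : ‖resS S (W + lam • Z)‖ ≤ w + lam := by
        refine norm_resS_le (by positivity) fun i j => ?_
        rw [map_add, map_smul]
        refine (norm_add_le _ _).trans (add_le_add (hWw i j) ?_)
        rw [norm_smul, Real.norm_of_nonneg hlam.le]
        nlinarith [(hZ.2 i j).2]
      obtain ⟨Δ, h1, h2, h3⟩ := exists_gradient_eq hR hR' hRsa hρ1 hρ hlow hS hΓ hγ0 hγ hd0 hd hr hx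
        hx' (resS S (W + lam • Z)) (adj_incS_resS hS hadj) (by rw [hrw]; nlinarith)
      exact ⟨Δ, fun _ => ⟨h1, h2, h3⟩⟩
    · exact ⟨0, fun h => absurd h hZ⟩
  choose Δ hΔ using hex
  have hP : ∀ Z ∈ dualSet S, _ := fun Z hZ => perturbed_inverse hR hR' hRsa hρ1 hρ hlow
    (isSelfAdjoint_toCLM (hΔ Z hZ).2.1)
    ((hd (Δ Z)).trans (mul_le_mul_of_nonneg_left (hΔ Z hZ).1 hd0)) hx
  let m := 5 / 6 * ρ⁻¹
  -- Any finite bound suffices here: `M` enters only the convergence of the iteration, not the error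
  -- bound.
  let M := ‖Rinv‖ + ‖incS (H := H) S‖ * r + 1
  have hm : 0 < m := by positivity
  have hM : 0 < M := by positivity
  have hHsa : HSOp.adj _ _ Hs = Hs := by
    apply HSOp.toCLM_injective
    have h1 : IsSelfAdjoint (Rinv - 1) :=
      (selfAdjoint_of_mul_eq_one hRsa hR).sub (IsSelfAdjoint.one (PiLp 2 H →L[ℝ] PiLp 2 H))
    rw [HSOp.adj_toCLM, hHs, ContinuousLinearMap.isSelfAdjoint_iff'.1 h1]
  have hTM : ∀ Z ∈ dualSet S, ‖Rinv + (incS S (Δ Z)).toCLM‖ ≤ M := fun Z hZ => by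
    have h1 : ‖(incS S (Δ Z)).toCLM‖ ≤ ‖incS (H := H) S‖ * r :=
      (opNorm_incS_le _).trans (mul_le_mul_of_nonneg_left (hΔ Z hZ).1 (norm_nonneg _))
    have h2 := norm_add_le Rinv (incS S (Δ Z)).toCLM
    simp only [M]; linarith
  have hKadj : ∀ Z ∈ dualSet S, HSOp.adj _ _ (Hs + incS S (Δ Z)) = Hs + incS S (Δ Z) := by
    intro Z hZ; rw [map_add, hHsa, (hΔ Z hZ).2.1]
  have hkey : ∀ Z ∈ dualSet S, ∀ Z' ∈ dualSet S,
      M⁻¹ * M⁻¹ * ‖incS S (Δ Z) - incS S (Δ Z')‖ ^ 2 ≤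
        -(lam * inner ℝ (incS S (Δ Z) - incS S (Δ Z')) (Z - Z')) ∧
      lam * ‖Z - Z'‖ ≤ ‖incS (H := H) S ∘L resS S‖ * (m⁻¹ * m⁻¹) *
        ‖incS S (Δ Z) - incS S (Δ Z')‖ := by
    intro Z hZ Z' hZ'
    obtain ⟨-, hc, h1, -, -, -, h3, -⟩ := hP Z hZ
    obtain ⟨-, hc', h1', h2', -, -, h3', -⟩ := hP Z' hZ'
    exact gradient_monotone hHs (hKadj Z hZ) (hKadj Z' hZ') hm hM hlam hc hc' h1 h1' h2' h3 h3'
      (hTM Z hZ) (hTM Z' hZ') (hΔ Z hZ).2.2 (hΔ Z' hZ').2.2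
      (fun i j h => (hZ.2 i j).1 (Or.inr h)) (fun i j h => (hZ'.2 i j).1 (Or.inr h))
  -- The minus sign makes the map monotone and turns the variational inequality into the statement
  -- that `Z` maximizes the pairing with `Hs + incS S (Δ Z)`.
  obtain ⟨Z, hZ, hvi⟩ := exists_variational_inequality (convex_dualSet (S := S) (H := H))
    ⟨0, zero_mem_dualSet⟩ isClosed_dualSet (fun Z => -(Hs + incS S (Δ Z)))
    (c := M⁻¹ * M⁻¹ / lam) (L := ‖incS (H := H) S ∘L resS S‖ * (m⁻¹ * m⁻¹) / lam) (by positivity)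
    (fun Z hZ Z' hZ' => by
      have e : -(Hs + incS S (Δ Z)) - -(Hs + incS S (Δ Z')) =
        -(incS S (Δ Z) - incS S (Δ Z')) := by abel
      have h1 := (hkey Z hZ Z' hZ').1
      rw [e, norm_neg, inner_neg_left, div_mul_eq_mul_div, div_le_iff₀ hlam]
      linarith)
    (fun Z hZ Z' hZ' => by
      have e : -(Hs + incS S (Δ Z)) - -(Hs + incS S (Δ Z')) =
        -(incS S (Δ Z) - incS S (Δ Z')) := by abel
      have h1 := (hkey Z hZ Z' hZ').2
      rw [e, norm_neg, div_mul_eq_mul_div, le_div_iff₀ hlam]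
      linarith)
  refine ⟨Δ Z, Z, (hΔ Z hZ).1, (hΔ Z hZ).2.1, hZ, (hΔ Z hZ).2.2, fun Z' hZ' => ?_⟩
  have h1 := hvi Z' hZ'
  rw [inner_neg_left, inner_sub_right] at h1
  linarith

end DualWitness

/-! ### Dual feasibility, certificate and unique minimizer -/

section Certificate

variable {p : ℕ} {H : Fin p → Type*} [∀ j, NormedAddCommGroup (H j)]
  [∀ j, InnerProductSpace ℝ (H j)] [∀ j, CompleteSpace (H j)] {S : Finset (Fin p × Fin p)}

theorem sandwich_eq_add_remainder (R J : PiLp 2 H →L[ℝ] PiLp 2 H)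
    (A : HSOp (PiLp 2 H) (PiLp 2 H)) :
    sandwich R R A = sandwich J R A + sandwich (R - J) R A := by
  apply HSOp.toCLM_injective
  rw [map_add]
  change R * (A.toCLM * R) = J * (A.toCLM * R) + (R - J) * (A.toCLM * R)
  rw [sub_mul, add_sub_cancel]

/-- Strict dual feasibility outside `S` from incoherence. -/
theorem norm_hblk_off_le {R J : PiLp 2 H →L[ℝ] PiLp 2 H} (hΓ : IsUnit (gammaSS (blk R) S))
    {α w lam : ℝ} (hα : 0 < α) (hlam : 0 < lam) (hw : w = α * lam / 8)
    (hinc : ∀ e ∉ S, 0 ≤ 1 - α ∧ ∀ v,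
      ‖gammaRow (blk R) S e (Ring.inverse (gammaSS (blk R) S) v)‖ ≤ (1 - α) * ‖v‖)
    {Δ : ∀ e : S, HSAt H e.1} {W Z : HSOp (PiLp 2 H) (PiLp 2 H)}
    (hWw : ∀ i j, ‖hblk i j W‖ ≤ w) (hZ : ∀ i j, ‖hblk i j Z‖ ≤ 1)
    (hrem : ∀ i j, ‖hblk i j (sandwich (R - J) R (incS S Δ))‖ ≤ w)
    (hg : resS S (sandwich J R (incS S Δ)) = -resS S (W + lam • Z)) {i j : Fin p}
    (hij : (i, j) ∉ S) : ‖hblk i j (W + sandwich J R (incS S Δ))‖ ≤ lam := by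
  have hdec := sandwich_eq_add_remainder R J (incS S Δ)
  set U := sandwich J R (incS S Δ)
  set rem := sandwich (R - J) R (incS S Δ)
  have hw0 : 0 ≤ w := by rw [hw]; positivity
  -- The equation on `S` expresses `Δ` through `Γ_SS⁻¹`, so entries of `RΔR` outside `S` become
  -- entries of `Γ_{eS} Γ_SS⁻¹` applied to an array of norm at most `2w + lam`.
  have hv : gammaSS (blk R) S Δ = resS S (rem - (W + lam • Z)) := by
    rw [gammaSS_blk, hdec, map_add, hg, map_sub]; abel
  have hΔ : Δ = Ring.inverse (gammaSS (blk R) S) (resS S (rem - (W + lam • Z))) := by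
    rw [← hv]
    exact (congrArg (fun T => T Δ) (Ring.inverse_mul_cancel _ hΓ)).symm
  have hn : ‖resS S (rem - (W + lam • Z))‖ ≤ w + (w + lam) := by
    refine norm_resS_le (by positivity) fun i j => ?_
    rw [map_sub, map_add, map_smul]
    refine (norm_sub_le _ _).trans (add_le_add (hrem i j)
      ((norm_add_le _ _).trans (add_le_add (hWw i j) ?_)))
    rw [norm_smul, Real.norm_of_nonneg hlam.le]
    nlinarith [hZ i j]
  obtain ⟨hα1, hin⟩ := hinc _ hij
  have hrow : ‖hblk i j (sandwich R R (incS S Δ))‖ ≤ (1 - α) * (w + (w + lam)) := by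
    have e := gammaRow_blk (S := S) R (i, j) Δ
    rw [← e, hΔ]
    exact (hin _).trans (mul_le_mul_of_nonneg_left hn hα1)
  have hU : W + U = W + sandwich R R (incS S Δ) - rem := by rw [hdec]; abel
  rw [hU, map_sub, map_add]
  refine (norm_sub_le _ _).trans ((add_le_add ((norm_add_le _ _).trans
    (add_le_add (hWw i j) hrow)) (hrem i j)).trans ?_)
  rw [hw]
  -- With `w = α lam / 8` the total `2w + (1 - α)(2w + lam)` is at most `(1 - α/2) lam`.
  nlinarith [mul_pos hα hlam, mul_pos (mul_pos hα hα) hlam]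

/-- The primal-dual certificate. -/
theorem exists_certificate {R Rinv : PiLp 2 H →L[ℝ] PiLp 2 H} (hR : R * Rinv = 1)
    (hR' : Rinv * R = 1) (hRsa : IsSelfAdjoint R) {ρ γ d r : ℝ} (hρ1 : 1 ≤ ρ) (hρ : rowNorm R ≤ ρ)
    (hlow : ∀ x, ρ⁻¹ * ‖x‖ ^ 2 ≤ inner ℝ x (Rinv x))
    (hS : ∀ i j, (i, j) ∈ S → (j, i) ∈ S) (hSd : ∀ i, (i, i) ∈ S)
    (hΓ : IsUnit (gammaSS (blk R) S))
    (hγ0 : 0 < γ) (hγ : ∀ v, ‖Ring.inverse (gammaSS (blk R) S) v‖ ≤ γ * ‖v‖)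
    (hd0 : 0 ≤ d) (hd : ∀ v : (∀ e : S, HSAt H e.1), rowNorm (incS S v).toCLM ≤ d * ‖v‖)
    (hr : 0 ≤ r) (hx : ρ * (d * r) ≤ 1 / 6) (hx' : γ * ρ ^ 3 * d * r ≤ 1 / 6)
    {Hs W R0 : HSOp (PiLp 2 H) (PiLp 2 H)} (hHs : Hs.toCLM = Rinv - 1) (hR0 : R0.toCLM = R - 1)
    (hHsS : ∀ i j, (i, j) ∉ S → hblk i j Hs = 0)
    {α lam w : ℝ} (hα : 0 < α) (hlam : 0 < lam) (hW : HSOp.adj _ _ W = W)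
    (hWw : ∀ i j, ‖hblk i j W‖ ≤ w) (hw : w = α * lam / 8) (hrw : r = 2 * γ * (w + lam))
    (hrem : 6 / 5 * ρ ^ 3 * d * r ^ 2 ≤ w)
    (hinc : ∀ e ∉ S, 0 ≤ 1 - α ∧ ∀ v,
      ‖gammaRow (blk R) S e (Ring.inverse (gammaSS (blk R) S) v)‖ ≤ (1 - α) * ‖v‖) :
    ∃ (Hh G Y : HSOp (PiLp 2 H) (PiLp 2 H)) (J : PiLp 2 H →L[ℝ] PiLp 2 H) (m : ℝ),
      HSOp.adj _ _ Hh = Hh ∧ 0 < m ∧ (∀ x, m * ‖x‖ ^ 2 ≤ inner ℝ x (x + Hh.toCLM x)) ∧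
      (∀ x, J (x + Hh.toCLM x) = x) ∧ G.toCLM = 1 - J ∧ R0 + W = -Y - G ∧
      (∀ i j, ‖hblk i j Y‖ ≤ lam) ∧ (∀ i, hblk i i Y = 0) ∧
      lam * (∑ i, ∑ j, if i = j then 0 else ‖hblk i j Hh‖) ≤ inner ℝ Hh Y ∧
      ∀ i j, ‖hblk i j Hh - hblk i j Hs‖ ≤ r := by
  have hw0 : 0 ≤ w := by rw [hw]; positivity
  obtain ⟨Δ, Z, hΔr, hΔa, hZ, hg, hvi⟩ := exists_restricted_solution hR hR' hRsa hρ1 hρ hlow hS hΓ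
    hγ0 hγ hd0 hd hr hx hx' hHs hlam hW hWw hw0 hrw
  obtain ⟨-, hc, h1, h2, -, -, h3, h4⟩ := perturbed_inverse hR hR' hRsa hρ1 hρ hlow
    (isSelfAdjoint_toCLM hΔa) ((hd Δ).trans (mul_le_mul_of_nonneg_left hΔr hd0)) hx
  set J := Ring.inverse (Rinv + (incS S Δ).toCLM)
  have hremb : ∀ i j, ‖hblk i j (sandwich (R - J) R (incS S Δ))‖ ≤ w := by
    intro i j
    refine (norm_hblk_sandwich_le hRsa
      (fun k l => (norm_hblk_incS_le Δ k l).trans hΔr) i j).trans (le_trans ?_ hrem)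
    have := rowNorm_nonneg R
    have h5 : rowNorm (R - J) * r * rowNorm R ≤ (6 / 5 * ρ * (ρ * (d * r))) * r * ρ := by
      gcongr
    refine h5.trans_eq (by ring)
  have hHsa : HSOp.adj _ _ Hs = Hs := by
    apply HSOp.toCLM_injective
    have h1 : IsSelfAdjoint (Rinv - 1) :=
      (selfAdjoint_of_mul_eq_one hRsa hR).sub (IsSelfAdjoint.one (PiLp 2 H →L[ℝ] PiLp 2 H))
    rw [HSOp.adj_toCLM, hHs, ContinuousLinearMap.isSelfAdjoint_iff'.1 h1]
  have hT : ∀ x, x + (Hs + incS S Δ).toCLM x = (Rinv + (incS S Δ).toCLM) x := by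
    intro x
    rw [map_add, hHs, _root_.add_apply, _root_.sub_apply, _root_.add_apply,
      one_apply_eq_self]
    abel
  have hHh : HSOp.adj _ _ (Hs + incS S Δ) = Hs + incS S Δ := by rw [map_add, hHsa, hΔa]
  have hHhS : ∀ i j, (i, j) ∉ S → hblk i j (Hs + incS S Δ) = 0 := fun i j h => by
    rw [map_add, hHsS i j h, hblk_incS_notMem _ h, add_zero]
  have hYS : ∀ i j, (i, j) ∈ S →
      hblk i j (-(W + sandwich J R (incS S Δ))) = lam • hblk i j Z := by
    intro i j hij
    have := congrFun hg ⟨(i, j), hij⟩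
    rw [resS_apply, Pi.neg_apply, resS_apply] at this
    rw [map_neg, map_add]
    dsimp only at this
    rw [this, map_add, map_smul]
    abel
  -- The second witness is `1 - J`, because `JΔR = R - J` and `R0 = R - 1`. The third is then forced
  -- by stationarity on every entry.
  refine ⟨Hs + incS S Δ, sandwich J R (incS S Δ) - R0, -(W + sandwich J R (incS S Δ)), J,
    5 / 6 * ρ⁻¹, hHh, by positivity, fun x => ?_, fun x => ?_, ?_, by abel, fun i j => ?_,
    fun i => ?_, ?_, fun i j => ?_⟩
  · rw [hT]; exact hc x
  · rw [hT]; exact congrArg (fun T => T x) h1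
  · rw [map_sub, hR0]
    have : (sandwich J R (incS S Δ)).toCLM = R - J := h3
    rw [this]; abel
  · by_cases hij : (i, j) ∈ S
    · rw [hYS i j hij, norm_smul, Real.norm_of_nonneg hlam.le]
      nlinarith [(hZ.2 i j).2]
    · rw [map_neg, norm_neg]
      exact norm_hblk_off_le hΓ hα hlam hw hinc hWw (fun i j => (hZ.2 i j).2) hremb hg hij
  · rw [hYS i i (hSd i), (hZ.2 i i).1 (Or.inl rfl), smul_zero]
  -- Complementary slackness: `Z` maximizes the pairing over the dual set, hence does at least as
  -- well as the normalized entries of the candidate, whose pairing is the penalty sum.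
  · obtain ⟨Z', hZ', hZe⟩ := exists_dual_attaining hHh hHhS
    rw [← hZe]
    have h6 : (inner ℝ (Hs + incS S Δ) (-(W + sandwich J R (incS S Δ))) : ℝ) =
        lam * inner ℝ (Hs + incS S Δ) Z := by
      rw [inner_eq_sum_hblk, inner_eq_sum_hblk, Finset.mul_sum]
      refine Finset.sum_congr rfl fun i _ => ?_
      rw [Finset.mul_sum]
      refine Finset.sum_congr rfl fun j _ => ?_
      by_cases hij : (i, j) ∈ S
      · rw [hYS i j hij, inner_smul_right]
      · rw [hHhS i j hij, inner_zero_left, inner_zero_left, mul_zero]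
    rw [h6]
    exact mul_le_mul_of_nonneg_left (hvi Z' hZ') hlam.le
  · rw [map_add, add_sub_cancel_left]
    exact (norm_hblk_incS_le Δ i j).trans hΔr

theorem inner_le_of_hblk_le {A Y : HSOp (PiLp 2 H) (PiLp 2 H)} {lam : ℝ}
    (hY : ∀ i j, ‖hblk i j Y‖ ≤ lam) (hYd : ∀ i, hblk i i Y = 0) :
    inner ℝ A Y ≤ lam * ∑ i, ∑ j, if i = j then 0 else ‖hblk i j A‖ := by
  rw [inner_eq_sum_hblk, Finset.mul_sum]
  refine Finset.sum_le_sum fun i _ => ?_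
  rw [Finset.mul_sum]
  refine Finset.sum_le_sum fun j _ => ?_
  split_ifs with h
  · subst h; rw [hYd, inner_zero_right, mul_zero]
  · refine (real_inner_le_norm _ _).trans ?_
    rw [mul_comm]
    exact mul_le_mul_of_nonneg_right (hY i j) (norm_nonneg _)

/-- The estimated matrix `R̂` is not assumed symmetric, but self-adjoint candidates see only its
symmetric part. -/
theorem inner_symm_part {A Q : HSOp (PiLp 2 H) (PiLp 2 H)} (hA : HSOp.adj _ _ A = A) :
    inner ℝ A ((1 / 2 : ℝ) • (Q + HSOp.adj _ _ Q)) = (inner ℝ A Q : ℝ) := by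
  rw [inner_smul_right, inner_add_right]
  have : (inner ℝ A (HSOp.adj _ _ Q) : ℝ) = inner ℝ A Q := by
    conv_lhs => rw [← hA]
    exact LinearIsometry.inner_map_map _ _ _
  rw [this]; ring

theorem adj_of_isSelfAdjoint {A : HSOp (PiLp 2 H) (PiLp 2 H)} (h : IsSelfAdjoint A.toCLM) :
    HSOp.adj _ _ A = A := by
  apply HSOp.toCLM_injective
  rw [HSOp.adj_toCLM, ContinuousLinearMap.isSelfAdjoint_iff'.1 h]

theorem objective_eq {Rhat : OpMat H} {Q A : HSOp (PiLp 2 H) (PiLp 2 H)}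
    (hQ : ∀ i j, (hblk i j Q).toCLM = offDiag Rhat i j) (hA : HSOp.adj _ _ A = A) (lam : ℝ) :
    objective Rhat lam A.toCLM =
      inner ℝ A ((1 / 2 : ℝ) • (Q + HSOp.adj _ _ Q)) - Real.log (det2 A.toCLM) +
        lam * ∑ i, ∑ j, if i = j then 0 else ‖hblk i j A‖ := by
  rw [inner_symm_part hA, objective, inner_eq_sum_hblk]
  have h1 : ∀ i j, hsInner (offDiag (blk A.toCLM) i j) (offDiag Rhat i j) =
      inner ℝ (hblk i j A) (hblk i j Q) := by
    intro i j
    rw [HSOp.inner_eq, hQ, hblk_toCLM]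
    by_cases h : i = j
    · simp [offDiag, h, hsInner]
    · simp [offDiag, h]
  have h2 : ∀ i j, (hsNorm (offDiag (blk A.toCLM) i j)).toReal =
      if i = j then 0 else ‖hblk i j A‖ := by
    intro i j
    by_cases h : i = j
    · simp [offDiag, h, hsNorm_zero]
    · simp only [offDiag, h, if_false, HSOp.norm_eq, hblk_toCLM]
  simp_rw [h1, h2]

/-- A certified operator is the unique minimizer of the objective. -/
theorem isMinimizer_of_certificate {Rhat : OpMat H} {Q Hh G Y : HSOp (PiLp 2 H) (PiLp 2 H)}
    {J : PiLp 2 H →L[ℝ] PiLp 2 H} {m lam : ℝ}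
    (hQ : ∀ i j, (hblk i j Q).toCLM = offDiag Rhat i j)
    (hHh : HSOp.adj _ _ Hh = Hh) (hm : 0 < m)
    (hc : ∀ x, m * ‖x‖ ^ 2 ≤ inner ℝ x (x + Hh.toCLM x))
    (hJ : ∀ x, J (x + Hh.toCLM x) = x) (hG : G.toCLM = 1 - J)
    (hst : (1 / 2 : ℝ) • (Q + HSOp.adj _ _ Q) = -Y - G) (hY : ∀ i j, ‖hblk i j Y‖ ≤ lam)
    (hYd : ∀ i, hblk i i Y = 0)
    (hcs : lam * (∑ i, ∑ j, if i = j then 0 else ‖hblk i j Hh‖) ≤ inner ℝ Hh Y) :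
    IsMinimizer Rhat lam Hh.toCLM ∧ ∀ T, IsMinimizer Rhat lam T → T = Hh.toCLM := by
  have hpos : ∀ x : PiLp 2 H, x ≠ 0 → 0 < (inner ℝ x (x + Hh.toCLM x) : ℝ) := fun x hx => by
    have : 0 < ‖x‖ := norm_pos_iff.2 hx
    exact lt_of_lt_of_le (by positivity) (hc x)
  have hF : Feasible Hh.toCLM := ⟨isSelfAdjoint_toCLM hHh, Hh.hsNorm_lt_top, hpos⟩
  have key : ∀ T, Feasible T → objective Rhat lam Hh.toCLM ≤ objective Rhat lam T ∧
      (objective Rhat lam T ≤ objective Rhat lam Hh.toCLM → T = Hh.toCLM) := by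
    intro T hT
    obtain ⟨A, rfl⟩ : ∃ A : HSOp (PiLp 2 H) (PiLp 2 H), T = A.toCLM := ⟨HSOp.mk T hT.2.1, rfl⟩
    have hA := adj_of_isSelfAdjoint hT.1
    -- Klein's inequality linearizes the determinant at `Hh`. Stationarity turns the linear term
    -- into a pairing with `Y`, which the penalty dominates for every competitor and does not exceed
    -- at `Hh`. Equality of objectives forces equality in Klein's inequality.
    obtain ⟨h1, h2⟩ := log_det2_le hF.1 hT.1 Hh.hsNorm_lt_top A.hsNorm_lt_top hpos hT.2.2 hJ hG
      (D := A - Hh) (map_sub _ _ _)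
    have h3 := inner_le_of_hblk_le (A := A) hY hYd
    rw [objective_eq hQ hA, objective_eq hQ hHh, hst]
    rw [inner_sub_right] at h1 h2
    simp only [inner_sub_right, inner_neg_right]
    rw [real_inner_comm A G, real_inner_comm Hh G] at h1 h2
    refine ⟨by linarith, fun h => h2 (le_antisymm h1 (by linarith))⟩
  exact ⟨⟨hF, fun T hT => (key T hT).1⟩, fun T hT => (key T hT.1).2 (hT.2 _ hF)⟩

end Certificate

/-! ### Factoring a map through the square root of its Gram operator -/

section Factorization

variable {E K κ : Type*} [NormedAddCommGroup E] [InnerProductSpace ℝ E] [CompleteSpace E]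
  [NormedAddCommGroup K] [InnerProductSpace ℝ K] [CompleteSpace K]

theorem opPow_half_mul_self {b : HilbertBasis κ ℝ E} {D : E →L[ℝ] E} {l : κ → ℝ}
    (hD : IsDiag b D l) (hpos : D.IsPositive) : opPow D (1 / 2) ∘L opPow D (1 / 2) = D := by
  have h1 := hD.opPow hpos (s := 1 / 2) (by norm_num)
  refine (h1.mul h1).eq_of ?_
  intro k
  dsimp only
  rw [hD k, ← Real.sqrt_eq_rpow, Real.mul_self_sqrt (hD.nonneg hpos k)]

theorem rangeProj_opPow {b : HilbertBasis κ ℝ E} {D : E →L[ℝ] E} {l : κ → ℝ}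
    (hD : IsDiag b D l) (hpos : D.IsPositive) {s : ℝ} (hs : 0 < s) :
    rangeProj (opPow D s) = rangeProj D := by
  have h1 := hD.opPow hpos hs
  refine ext_hilbertBasis b fun k => ?_
  rw [h1.rangeProj, hD.rangeProj]
  simp only [Real.rpow_eq_zero (hD.nonneg hpos k) hs.ne']

/-- A map whose Gram operator is `D` factors through `D ^ (1/2)`. -/
theorem exists_factor {b : HilbertBasis κ ℝ E} {D : E →L[ℝ] E} {l : κ → ℝ} (hD : IsDiag b D l)
    (hpos : D.IsPositive) (T : E →L[ℝ] K)
    (hT : ∀ u v, (inner ℝ (T u) (T v) : ℝ) = inner ℝ u (D v)) :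
    ∃ U : E →L[ℝ] K, U ∘L opPow D (1 / 2) = T ∧ U ∘L rangeProj D = U ∧ (∀ u, ‖U u‖ ≤ ‖u‖) ∧
      ∀ u, U u ∈ closure (Set.range T) := by
  have hSd := hD.opPow hpos (s := 1 / 2) (by norm_num)
  have hSS := opPow_half_mul_self hD hpos
  rw [← rangeProj_opPow hD hpos (s := 1 / 2) (by norm_num)]
  set S := opPow D (1 / 2)
  -- Equal norms make `S u ↦ T u` well defined and isometric on the range of `S`. It extends to the
  -- closure and is then composed with the orthogonal projection.
  have hn : ∀ u, ‖T u‖ = ‖S u‖ := by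
    intro u
    have h1 : ‖T u‖ ^ 2 = ‖S u‖ ^ 2 := by
      rw [← real_inner_self_eq_norm_sq, ← real_inner_self_eq_norm_sq, hT, ← hSS,
        ContinuousLinearMap.comp_apply, ← ContinuousLinearMap.adjoint_inner_left,
        ContinuousLinearMap.isSelfAdjoint_iff'.1 hSd.isSelfAdjoint]
    exact (sq_eq_sq₀ (norm_nonneg _) (norm_nonneg _)).1 h1
  let M := (LinearMap.range (S : E →ₗ[ℝ] E)).topologicalClosure
  have hmem : ∀ u, S u ∈ M := fun u =>
    Submodule.le_topologicalClosure _ (LinearMap.mem_range_self (S : E →ₗ[ℝ] E) u)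
  let e : E →ₗ[ℝ] M := (S : E →ₗ[ℝ] E).codRestrict M hmem
  have hde : DenseRange e := by
    intro y
    rw [mem_closure_iff_seq_limit]
    have hy : (y : E) ∈ closure (Set.range S) := y.2
    obtain ⟨x, hx, hlim⟩ := mem_closure_iff_seq_limit.1 hy
    choose z hz using hx
    refine ⟨fun n => e (z n), fun n => ⟨z n, rfl⟩, ?_⟩
    rw [tendsto_subtype_rng]
    refine hlim.congr fun n => (hz n).symm
  have hb : ∀ u, ‖(T : E →ₗ[ℝ] K) u‖ ≤ 1 * ‖e u‖ := fun u => by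
    rw [one_mul]; exact (hn u).le
  let V : M →L[ℝ] K := (T : E →ₗ[ℝ] K).extendOfNorm e
  have hV : ∀ u, V (e u) = T u := fun u => LinearMap.extendOfNorm_eq hde ⟨1, hb⟩ u
  have hV1 : ‖V‖ ≤ 1 := LinearMap.opNorm_extendOfNorm_le hde zero_le_one hb
  refine ⟨V ∘L M.orthogonalProjectionOnto, ?_, ?_, fun u => ?_, fun u => ?_⟩
  · ext u
    rw [ContinuousLinearMap.comp_apply, ContinuousLinearMap.comp_apply, ← hV]
    congr 1
    exact Submodule.orthogonalProjectionOnto_mem_subspace_eq_self (K := M) (e u)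
  · ext u
    simp only [ContinuousLinearMap.comp_apply]
    congr 1
    exact Submodule.orthogonalProjectionOnto_mem_subspace_eq_self (K := M) _
  · rw [ContinuousLinearMap.comp_apply]
    refine (V.le_of_opNorm_le hV1 _).trans ?_
    rw [one_mul]
    exact Submodule.norm_orthogonalProjectionOnto_apply_le M u
  · rw [ContinuousLinearMap.comp_apply]
    have h1 := V.continuous.range_subset_closure_image_dense hde
    refine closure_mono ?_ (h1 (Set.mem_range_self _))
    rintro _ ⟨_, ⟨z, rfl⟩, rfl⟩
    exact ⟨z, (hV z).symm⟩

end Factorization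

/-! ### The correlation operator and its coercivity -/

section Correlation

variable {p : ℕ} {H : Fin p → Type*} [∀ j, NormedAddCommGroup (H j)]
  [∀ j, InnerProductSpace ℝ (H j)] [∀ j, CompleteSpace (H j)]
  {K : Type*} [NormedAddCommGroup K] [InnerProductSpace ℝ K] [CompleteSpace K]

/-- The correlation operator is unique. -/
theorem IsCorr.unique {C : OpMat H} {i j : Fin p} {κ ν : Type*} {b : HilbertBasis κ ℝ (H i)}
    {b' : HilbertBasis ν ℝ (H j)} {l : κ → ℝ} {l' : ν → ℝ} (hi : IsDiag b (C i i) l)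
    (hj : IsDiag b' (C j j) l') (hpi : (C i i).IsPositive) (hpj : (C j j).IsPositive)
    {B B' : H j →L[ℝ] H i} (hB : IsCorr C i j B) (hB' : IsCorr C i j B') : B = B' := by
  have hsi := hi.opPow hpi (s := 1 / 2) (by norm_num)
  have hsj := hj.opPow hpj (s := 1 / 2) (by norm_num)
  have hPi : IsDiag b (rangeProj (C i i)) (fun k => if l k = 0 then 0 else 1) := fun k => by
    rw [hi.rangeProj]; by_cases h : l k = 0 <;> simp [h]
  -- Every matrix coefficient in the two eigenbases is determined: the projections kill it when an
  -- eigenvalue is zero, and otherwise the factorization can be divided out.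
  have main : ∀ B, IsCorr C i j B → ∀ k m, (inner ℝ (b k) (B (b' m)) : ℝ) =
      if l k = 0 ∨ l' m = 0 then 0 else
        inner ℝ (b k) (C i j (b' m)) / (l k ^ (1 / 2 : ℝ) * l' m ^ (1 / 2 : ℝ)) := by
    intro B hB k m
    have h1 : (inner ℝ (b k) (C i j (b' m)) : ℝ) =
        l k ^ (1 / 2 : ℝ) * l' m ^ (1 / 2 : ℝ) * inner ℝ (b k) (B (b' m)) := by
      conv_lhs => rw [hB.1]
      rw [ContinuousLinearMap.comp_apply, ContinuousLinearMap.comp_apply, hsi.inner_apply, hsj m,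
        map_smul, inner_smul_right]
      ring
    split_ifs with h
    · rw [hB.2, ContinuousLinearMap.comp_apply, ContinuousLinearMap.comp_apply, hPi.inner_apply,
        hj.rangeProj]
      rcases h with h | h
      · rw [if_pos h, zero_mul]
      · rw [if_pos h, map_zero, inner_zero_right, mul_zero]
    · rw [not_or] at h
      have h2 : l k ^ (1 / 2 : ℝ) ≠ 0 := (Real.rpow_ne_zero (hi.nonneg hpi k) (by norm_num)).2 h.1
      have h3 : l' m ^ (1 / 2 : ℝ) ≠ 0 := (Real.rpow_ne_zero (hj.nonneg hpj m) (by norm_num)).2 h.2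
      rw [h1]
      field_simp
  refine ext_hilbertBasis b' fun m => b.repr.injective ?_
  ext k
  rw [HilbertBasis.repr_apply_apply, HilbertBasis.repr_apply_apply, main B hB, main B' hB']

/-- The correlation operators of a covariance operator matrix given as a Gram matrix. -/
theorem exists_corr_factor {C : OpMat H} (hpos : ∀ j, (C j j).IsPositive)
    (hdiag : ∀ j, ∃ (κ : Type _) (b : HilbertBasis κ ℝ (H j)) (l : κ → ℝ), IsDiag b (C j j) l)
    (T : ∀ j, H j →L[ℝ] K)
    (hT : ∀ i j u v, (inner ℝ (T i u) (T j v) : ℝ) = inner ℝ u (C i j v)) :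
    ∃ U : ∀ j, H j →L[ℝ] K, (∀ j u, ‖U j u‖ ≤ ‖u‖) ∧
      (∀ j u, U j u ∈ closure (Set.range (T j))) ∧
      ∀ i j, i ≠ j → IsCorr C i j (corr C i j) ∧
        corr C i j = ContinuousLinearMap.adjoint (U i) ∘L U j := by
  have hex : ∀ j, ∃ U : H j →L[ℝ] K, U ∘L opPow (C j j) (1 / 2) = T j ∧
      U ∘L rangeProj (C j j) = U ∧ (∀ u, ‖U u‖ ≤ ‖u‖) ∧
      ∀ u, U u ∈ closure (Set.range (T j)) := fun j => by
    obtain ⟨κ, b, l, hb⟩ := hdiag j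
    exact exists_factor hb (hpos j) (T j) (hT j j)
  choose U hU1 hU2 hU3 hU4 using hex
  refine ⟨U, hU3, hU4, fun i j hij => ?_⟩
  obtain ⟨κ, b, l, hb⟩ := hdiag i
  obtain ⟨κ', b', l', hb'⟩ := hdiag j
  have hsi := ContinuousLinearMap.isSelfAdjoint_iff'.1
    (hb.opPow (hpos i) (s := 1 / 2) (by norm_num)).isSelfAdjoint
  have hPi : ContinuousLinearMap.adjoint (rangeProj (C i i)) = rangeProj (C i i) := by
    have : IsDiag b (rangeProj (C i i)) (fun k => if l k = 0 then 0 else 1) := fun k => by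
      rw [hb.rangeProj]; by_cases h : l k = 0 <;> simp [h]
    exact ContinuousLinearMap.isSelfAdjoint_iff'.1 this.isSelfAdjoint
  have hc : IsCorr C i j (ContinuousLinearMap.adjoint (U i) ∘L U j) := by
    constructor
    · ext v
      refine ext_inner_left ℝ fun u => ?_
      rw [← hT, ← hU1, ← hU1]
      simp only [ContinuousLinearMap.comp_apply]
      rw [← ContinuousLinearMap.adjoint_inner_left (opPow (C i i) (1 / 2)), hsi,
        ContinuousLinearMap.adjoint_inner_right]
    · conv_lhs => rw [← hU2 i, ← hU2 j]
      rw [ContinuousLinearMap.adjoint_comp, hPi]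
      rfl
  have h1 : corr C i j = (⟨_, hc⟩ : ∃ B, IsCorr C i j B).choose := by
    rw [corr, if_neg hij, dif_pos ⟨_, hc⟩]
  have h2 : IsCorr C i j (corr C i j) := by
    rw [h1]; exact (⟨_, hc⟩ : ∃ B, IsCorr C i j B).choose_spec
  exact ⟨h2, h2.unique hb hb' (hpos i) (hpos j) hc⟩

theorem corr_self (C : OpMat H) (i : Fin p) : corr C i i = 1 := by
  rw [corr, if_pos rfl, blk_one_same]

theorem isSelfAdjoint_toOp {A : OpMat H} (h : ∀ i j, ContinuousLinearMap.adjoint (A j i) = A i j) :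
    IsSelfAdjoint (toOp A) := by
  rw [ContinuousLinearMap.isSelfAdjoint_iff']
  refine blk_injective ?_
  funext i j
  rw [blk_adjoint, blk_toOp, h]

theorem isSelfAdjoint_corr {C : OpMat H} {U : ∀ j, H j →L[ℝ] K}
    (hU : ∀ i j, i ≠ j → corr C i j = ContinuousLinearMap.adjoint (U i) ∘L U j) :
    IsSelfAdjoint (toOp (corr C)) := by
  refine isSelfAdjoint_toOp fun i j => ?_
  by_cases h : i = j
  · subst h
    rw [corr_self]
    exact ContinuousLinearMap.isSelfAdjoint_iff'.1 (IsSelfAdjoint.one (H i →L[ℝ] H i))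
  · rw [hU i j h, hU j i (Ne.symm h), ContinuousLinearMap.adjoint_comp,
      ContinuousLinearMap.adjoint_adjoint]

/-- The quadratic form of the correlation operator. -/
theorem inner_corr {C : OpMat H} {U : ∀ j, H j →L[ℝ] K}
    (hU : ∀ i j, i ≠ j → corr C i j = ContinuousLinearMap.adjoint (U i) ∘L U j) (x : PiLp 2 H) :
    (inner ℝ x (toOp (corr C) x) : ℝ) =
      ‖∑ j, U j (x j)‖ ^ 2 + ∑ j, (‖x j‖ ^ 2 - ‖U j (x j)‖ ^ 2) := by
  have h1 : ∀ i j, (inner ℝ (x i) (corr C i j (x j)) : ℝ) =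
      inner ℝ (U i (x i)) (U j (x j)) + if i = j then ‖x i‖ ^ 2 - ‖U i (x i)‖ ^ 2 else 0 := by
    intro i j
    split_ifs with h
    · subst h
      rw [corr_self, one_apply_eq_self, real_inner_self_eq_norm_sq, real_inner_self_eq_norm_sq]
      ring
    · rw [hU i j h, ContinuousLinearMap.comp_apply, ContinuousLinearMap.adjoint_inner_right,
        add_zero]
  rw [← real_inner_self_eq_norm_sq, sum_inner, PiLp.inner_apply, ← Finset.sum_add_distrib]
  refine Finset.sum_congr rfl fun i _ => ?_
  rw [apply_eq_sum_blk, blk_toOp, inner_sum, inner_sum]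
  simp_rw [h1, Finset.sum_add_distrib]
  simp

theorem toOp_eq_one_add_offDiag (C : OpMat H) :
    toOp (corr C) = 1 + toOp (offDiag (corr C)) := by
  refine blk_injective ?_
  funext i j
  rw [blk_add, blk_toOp, blk_toOp]
  by_cases h : i = j
  · subst h; rw [corr_self, blk_one_same]; simp [offDiag]
  · rw [blk_one_ne h, zero_add]; simp [offDiag, h]

/-- The correlation operator is coercive if its off-diagonal part is Hilbert-Schmidt with an
eigenvalue gap. -/
theorem coercive_of_eigenvalueGap {C : OpMat H} (hsa : IsSelfAdjoint (toOp (corr C)))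
    (hgap : EigenvalueGap (corr C)) :
    ∃ c > 0, ∀ x, c * ‖x‖ ^ 2 ≤ (inner ℝ x (toOp (corr C) x) : ℝ) := by
  obtain ⟨hhs, c, hc, h⟩ := hgap
  have hdec := toOp_eq_one_add_offDiag C
  have hsa0 : IsSelfAdjoint (toOp (offDiag (corr C))) := by
    have : toOp (offDiag (corr C)) = toOp (corr C) - 1 := by rw [hdec]; abel
    rw [this]
    exact IsSelfAdjoint.sub (R := PiLp 2 H →L[ℝ] PiLp 2 H) hsa (.one _)
  obtain ⟨b, hb⟩ := exists_eigenbasis_of_hs hsa0 (hsNorm_toOp_lt_top hhs)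
  refine ⟨c, hc, fun x => ?_⟩
  rw [hdec]
  refine ((IsDiag.one b).add hb).le_inner (fun k => h k.1 ?_) x
  refine Module.End.hasEigenvalue_of_hasEigenvector (x := b k)
    ⟨Module.End.mem_eigenspace_iff.2 (hb k), fun h0 => ?_⟩
  have := b.orthonormal.1 k
  rw [h0, norm_zero] at this
  exact zero_ne_one this

/-- The correlation operator is coercive if it is injective and its off-diagonal part is
Hilbert-Schmidt. -/
theorem coercive_of_injective {C : OpMat H} {U : ∀ j, H j →L[ℝ] K}
    (hU1 : ∀ j u, ‖U j u‖ ≤ ‖u‖)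
    (hU : ∀ i j, i ≠ j → corr C i j = ContinuousLinearMap.adjoint (U i) ∘L U j)
    (hhs : IsHSMat (offDiag (corr C)))
    (hinj : ∀ x : PiLp 2 H, ∑ j, U j (x j) = 0 → ∀ j, U j (x j) = 0) :
    ∃ c > 0, ∀ x, c * ‖x‖ ^ 2 ≤ (inner ℝ x (toOp (corr C) x) : ℝ) := by
  have hdec := toOp_eq_one_add_offDiag C
  have hsa0 : IsSelfAdjoint (toOp (offDiag (corr C))) := by
    have : toOp (offDiag (corr C)) = toOp (corr C) - 1 := by rw [hdec]; abel
    rw [this]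
    exact IsSelfAdjoint.sub (R := PiLp 2 H →L[ℝ] PiLp 2 H) (isSelfAdjoint_corr hU) (.one _)
  have hlt := hsNorm_toOp_lt_top hhs
  obtain ⟨b, hb⟩ := exists_eigenbasis_of_hs hsa0 hlt
  -- A null vector annihilates both nonnegative parts of the quadratic form: `∑ U j (x j) = 0`, and
  -- each `U j` preserves the norm of `x j`. The first forces `U j (x j) = 0`, the second then `x j
  -- = 0`.
  have hpos : ∀ x : PiLp 2 H, x ≠ 0 →
      0 < (inner ℝ x (x + toOp (offDiag (corr C)) x) : ℝ) := by
    intro x hx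
    have e : x + toOp (offDiag (corr C)) x = toOp (corr C) x := by rw [hdec]; rfl
    have hnn : ∀ j, 0 ≤ ‖x j‖ ^ 2 - ‖U j (x j)‖ ^ 2 := fun j =>
      sub_nonneg.2 (pow_le_pow_left₀ (norm_nonneg _) (hU1 j _) 2)
    rw [e, inner_corr hU]
    refine lt_of_le_of_ne (add_nonneg (sq_nonneg _) (Finset.sum_nonneg fun j _ => hnn j)) ?_
    intro h0
    have h1 := (add_eq_zero_iff_of_nonneg (sq_nonneg _)
      (Finset.sum_nonneg fun j _ => hnn j)).1 h0.symm
    have h2 := hinj x (norm_eq_zero.1 (pow_eq_zero_iff two_ne_zero |>.1 h1.1))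
    refine hx (PiLp.ext fun j => ?_)
    have h3 := (Finset.sum_eq_zero_iff_of_nonneg fun j _ => hnn j).1 h1.2 j (Finset.mem_univ j)
    rw [h2 j, norm_zero] at h3
    exact norm_eq_zero.1 (pow_eq_zero_iff two_ne_zero |>.1 (by linarith))
  -- Since `R₀` is Hilbert-Schmidt, its eigenvalues cannot accumulate at `-1`, so positivity
  -- improves to a uniform lower bound.
  obtain ⟨c, hc, hck⟩ := exists_pos_le_one_add (hb.summable_sq hlt) (hb.one_add_pos hpos)
  refine ⟨c, hc, fun x => ?_⟩
  rw [hdec]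
  exact ((IsDiag.one b).add hb).le_inner hck x

end Correlation

/-! ### Linear functionals of a square integrable random element -/

section InnerLp

variable {α E F : Type*} [MeasurableSpace α] {μ : Measure α}
  [NormedAddCommGroup E] [InnerProductSpace ℝ E] [CompleteSpace E]
  [NormedAddCommGroup F] [InnerProductSpace ℝ F] [CompleteSpace F]

/-- The map `v ↦ ⟪v, Y⟫` from a Hilbert space to the square integrable functions. -/
noncomputable def innerLp {Y : α → E} (hY : MemLp Y 2 μ) : E →L[ℝ] Lp ℝ 2 μ :=
  LinearMap.mkContinuous
    { toFun := fun v => (innerSL ℝ v).compLp (hY.toLp Y)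
      map_add' := fun u v => by rw [map_add, ContinuousLinearMap.add_compLp]
      map_smul' := fun c v => by rw [map_smul, ContinuousLinearMap.smul_compLp]; rfl }
    ‖hY.toLp Y‖ (fun v => by
      refine (ContinuousLinearMap.norm_compLp_le _ _).trans ?_
      rw [innerSL_apply_norm, mul_comm])

theorem coeFn_innerLp {Y : α → E} (hY : MemLp Y 2 μ) (v : E) :
    innerLp hY v =ᵐ[μ] fun a => (inner ℝ v (Y a) : ℝ) := by
  have h1 : innerLp hY v =ᵐ[μ] fun a => innerSL ℝ v (hY.toLp Y a) :=
    ContinuousLinearMap.coeFn_compLp' _ _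
  filter_upwards [h1, hY.coeFn_toLp] with a ha hb
  rw [ha, hb, innerSL_apply_apply]

theorem inner_innerLp {Y : α → E} {Z : α → F} (hY : MemLp Y 2 μ) (hZ : MemLp Z 2 μ) (u : E)
    (v : F) : (inner ℝ (innerLp hY u) (innerLp hZ v) : ℝ) =
      ∫ a, (inner ℝ u (Y a) : ℝ) * inner ℝ v (Z a) ∂μ := by
  rw [L2.inner_def]
  refine integral_congr_ae ?_
  filter_upwards [coeFn_innerLp hY u, coeFn_innerLp hZ v] with a ha hb
  rw [ha, hb]
  simp [mul_comm]

/-- Bessel's inequality is integrated over finite subsets of the basis; the second moment of `Y`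
bounds all partial sums. -/
theorem hsNorm_innerLp_lt_top {Y : α → E} (hY : MemLp Y 2 μ) : hsNorm (innerLp hY) < ∞ := by
  have hfin : ∀ s : Finset (onbIndex E),
      ∑ k ∈ s, ‖innerLp hY (onb E k)‖ ^ 2 ≤ ∫ a, ‖Y a‖ ^ 2 ∂μ := by
    intro s
    have h1 : ∀ k, ‖innerLp hY (onb E k)‖ ^ 2 = ∫ a, (inner ℝ (onb E k) (Y a) : ℝ) ^ 2 ∂μ := by
      intro k
      rw [← real_inner_self_eq_norm_sq, inner_innerLp]
      simp_rw [sq]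
    have hi : ∀ k, Integrable (fun a => (inner ℝ (onb E k) (Y a) : ℝ) ^ 2) μ := fun k =>
      (hY.const_inner (onb E k)).integrable_sq
    simp_rw [h1]
    rw [← integral_finsetSum _ fun k _ => hi k]
    refine integral_mono (integrable_finsetSum _ fun k _ => hi k) hY.norm.integrable_sq fun a => ?_
    have h2 := (onb E).orthonormal.sum_inner_products_le (s := s) (Y a)
    simpa using h2
  have h2 : hsNorm (innerLp hY) ^ 2 ≤ ENNReal.ofReal (∫ a, ‖Y a‖ ^ 2 ∂μ) := by
    rw [hsNorm_sq, ENNReal.tsum_eq_iSup_sum]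
    refine iSup_le fun s => ?_
    refine le_trans (le_of_eq ?_) (ENNReal.ofReal_le_ofReal (hfin s))
    rw [ENNReal.ofReal_sum_of_nonneg fun _ _ => sq_nonneg _]
    refine Finset.sum_congr rfl fun k _ => ?_
    rw [ENNReal.ofReal_pow (norm_nonneg _), ofReal_norm]
  exact (ENNReal.pow_lt_top_iff.1 (h2.trans_lt ENNReal.ofReal_lt_top)).resolve_right two_ne_zero

theorem integrable_rankOne {Y : α → E} {Z : α → F} (hY : MemLp Y 2 μ) (hZ : MemLp Z 2 μ) :
    Integrable (fun a => InnerProductSpace.rankOne ℝ (Y a) (Z a)) μ := by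
  refine (hY.norm.integrable_mul hZ.norm).mono' ?_ (ae_of_all _ fun a => ?_)
  · have h1 : Continuous fun y : F => ContinuousLinearMap.smulRightL ℝ F E (innerSL ℝ y) :=
      (ContinuousLinearMap.smulRightL ℝ F E).continuous.comp (innerSL ℝ).continuous
    have hc : Continuous fun q : E × F => ContinuousLinearMap.smulRightL ℝ F E (innerSL ℝ q.2) q.1 :=
      (h1.comp continuous_snd).clm_apply continuous_fst
    exact hc.comp_aestronglyMeasurable (hY.1.prodMk hZ.1)
  · rw [InnerProductSpace.norm_rankOne]; rfl

theorem inner_integral_rankOne {Y : α → E} {Z : α → F} (hY : MemLp Y 2 μ) (hZ : MemLp Z 2 μ)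
    (u : E) (v : F) :
    inner ℝ u ((∫ a, InnerProductSpace.rankOne ℝ (Y a) (Z a) ∂μ) v) =
      ∫ a, (inner ℝ u (Y a) : ℝ) * inner ℝ v (Z a) ∂μ := by
  have hint := integrable_rankOne hY hZ
  rw [ContinuousLinearMap.integral_apply hint,
    ← integral_inner (hint.apply_continuousLinearMap v)]
  refine integral_congr_ae (ae_of_all _ fun a => ?_)
  simp only [InnerProductSpace.rankOne_apply, inner_smul_right]
  rw [real_inner_comm, mul_comm]

end InnerLp

/-! ### Covariance as a Gram matrix and independence of coordinates -/

section Covariance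

variable {p : ℕ} {H : Fin p → Type*} [∀ j, NormedAddCommGroup (H j)]
  [∀ j, InnerProductSpace ℝ (H j)] [∀ j, CompleteSpace (H j)] [∀ j, SecondCountableTopology (H j)]
  [∀ j, MeasurableSpace (H j)] [∀ j, BorelSpace (H j)]
  {Ω : Type*} [MeasurableSpace Ω] {P : Measure Ω} [IsProbabilityMeasure P] {X : Ω → PiLp 2 H}

theorem memLp_apply (hX : MemLp X 2 P) (j : Fin p) : MemLp (fun ω => X ω j) 2 P :=
  (PiLp.proj (𝕜 := ℝ) 2 H j).comp_memLp' hX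

theorem aemeasurable_coord (hX : MemLp X 2 P) : AEMeasurable (fun ω j => X ω j) P :=
  aemeasurable_pi_lambda _ fun j => (memLp_apply hX j).1.aemeasurable

theorem memLp_centered_eval (hX : MemLp X 2 P) (j : Fin p) :
    MemLp (fun x : ∀ j, H j => x j - ∫ ω, X ω j ∂P) 2 (P.map fun ω j => X ω j) := by
  have h1 : Measurable (fun x : ∀ j, H j => x j - ∫ ω, X ω j ∂P) :=
    (measurable_pi_apply j).sub_const _
  rw [memLp_map_measure_iff h1.aestronglyMeasurable (aemeasurable_coord hX)]
  exact (memLp_apply hX j).sub (memLp_const _)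

theorem memLp_centered_marginal (hX : MemLp X 2 P) (j : Fin p) :
    MemLp (fun y : H j => y - ∫ ω, X ω j ∂P) 2 (P.map fun ω => X ω j) := by
  have h1 : Measurable (fun y : H j => y - ∫ ω, X ω j ∂P) := measurable_id.sub_const _
  rw [memLp_map_measure_iff h1.aestronglyMeasurable (memLp_apply hX j).1.aemeasurable]
  exact (memLp_apply hX j).sub (memLp_const _)

/-- Exhibits the covariance as a Gram matrix in `L²` of the joint law. Working on that space rather
than on `Ω` lets null sets be compared with those of the product law. -/
theorem inner_covOp (hX : MemLp X 2 P) (i j : Fin p) (u : H i) (v : H j) :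
    (inner ℝ (innerLp (memLp_centered_eval hX i) u) (innerLp (memLp_centered_eval hX j) v) : ℝ) =
      inner ℝ u (covOp P X i j v) := by
  have hY : ∀ j, MemLp (fun ω => X ω j - ∫ ω', X ω' j ∂P) 2 P := fun j =>
    (memLp_apply hX j).sub (memLp_const _)
  rw [inner_innerLp, covOp, inner_integral_rankOne (hY i) (hY j),
    integral_map (aemeasurable_coord hX)]
  exact ((memLp_centered_eval hX i).const_inner u).1.mul ((memLp_centered_eval hX j).const_inner v).1

theorem covOp_self_eq (hX : MemLp X 2 P) (j : Fin p) :
    covOp P X j j = ContinuousLinearMap.adjoint (innerLp (memLp_centered_eval hX j)) ∘L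
      innerLp (memLp_centered_eval hX j) := by
  ext v
  refine ext_inner_left ℝ fun u => ?_
  rw [← inner_covOp hX, ContinuousLinearMap.comp_apply, ContinuousLinearMap.adjoint_inner_right]

theorem isPositive_covOp (hX : MemLp X 2 P) (j : Fin p) : (covOp P X j j).IsPositive := by
  rw [covOp_self_eq hX]
  exact ContinuousLinearMap.isPositive_adjoint_comp_self _

/-- `C j j = T* T` with `T` Hilbert-Schmidt; hence it has an eigenbasis. -/
theorem hsNorm_covOp_self_lt_top (hX : MemLp X 2 P) (j : Fin p) :
    hsNorm (covOp P X j j) < ∞ := by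
  rw [covOp_self_eq hX]
  exact (hsNorm_comp_left _ _).trans_lt
    (ENNReal.mul_lt_top enorm_lt_top (hsNorm_innerLp_lt_top _))

/-- Elements of the closed span of the components of `X j` are centered functions of `X j`. -/
theorem exists_of_mem_closure_range (hX : MemLp X 2 P) {j : Fin p}
    {w : Lp ℝ 2 (P.map fun ω j => X ω j)}
    (hw : w ∈ closure (Set.range (innerLp (memLp_centered_eval hX j)))) :
    ∃ g : Lp ℝ 2 (P.map fun ω => X ω j), ∫ y, g y ∂(P.map fun ω => X ω j) = 0 ∧
      (w =ᵐ[P.map fun ω j => X ω j] fun x => g (x j)) ∧ ‖w‖ = ‖g‖ := by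
  have hae := aemeasurable_coord hX
  have : IsProbabilityMeasure (P.map fun ω j => X ω j) := Measure.isProbabilityMeasure_map hae
  have : IsProbabilityMeasure (P.map fun ω => X ω j) :=
    Measure.isProbabilityMeasure_map (memLp_apply hX j).1.aemeasurable
  have hmp : MeasurePreserving (Function.eval j) (P.map fun ω j => X ω j) (P.map fun ω => X ω j) :=
    ⟨measurable_pi_apply j,
      AEMeasurable.map_map_of_aemeasurable (measurable_pi_apply j).aemeasurable hae⟩
  let ι := Lp.compMeasurePreservingₗᵢ (p := 2) (E := ℝ) ℝ (Function.eval j) hmp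
  have hι : ∀ g, ι g =ᵐ[P.map fun ω j => X ω j] fun x => g (x j) := fun g =>
    Lp.coeFn_compMeasurePreserving g hmp
  let M : Set (Lp ℝ 2 (P.map fun ω => X ω j)) := {g | ∫ y, g y ∂(P.map fun ω => X ω j) = 0}
  have hM : IsClosed M := by
    have h1 : ∀ g : Lp ℝ 2 (P.map fun ω => X ω j), ∫ y, g y ∂(P.map fun ω => X ω j) =
        inner ℝ (indicatorConstLp 2 MeasurableSet.univ (measure_ne_top _ _) (1 : ℝ)) g := by
      intro g
      rw [L2.inner_indicatorConstLp_one, setIntegral_univ]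
    simp only [M, h1]
    exact isClosed_eq (by fun_prop) continuous_const
  -- Composition with the coordinate is an isometry, so its image of the closed set of centered
  -- functions is closed. Limits of linear functionals of `X j` thus remain functions of `X j`.
  have hcl : IsClosed (ι '' M) := ι.isometry.isClosedEmbedding.isClosedMap _ hM
  have hsub : Set.range (innerLp (memLp_centered_eval hX j)) ⊆ ι '' M := by
    rintro _ ⟨v, rfl⟩
    refine ⟨innerLp (memLp_centered_marginal hX j) v, ?_, ?_⟩
    · change ∫ y, innerLp (memLp_centered_marginal hX j) v y ∂(P.map fun ω => X ω j) = 0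
      have hid : Integrable (fun ω => X ω j) P := (memLp_apply hX j).integrable one_le_two
      rw [integral_congr_ae (coeFn_innerLp (memLp_centered_marginal hX j) v),
        integral_map (memLp_apply hX j).1.aemeasurable
          (((memLp_centered_marginal hX j).const_inner v).1),
        integral_inner (f := fun ω => X ω j - ∫ ω', X ω' j ∂P)
          (hid.sub (integrable_const _)), integral_sub hid (integrable_const _)]
      simp
    · refine Lp.ext ?_
      have h2 := hmp.quasiMeasurePreserving.ae_eq_comp
        (coeFn_innerLp (memLp_centered_marginal hX j) v)
      filter_upwards [hι (innerLp (memLp_centered_marginal hX j) v), h2,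
        coeFn_innerLp (memLp_centered_eval hX j) v] with x h3 h4 h5
      rw [h3, h5]
      exact h4
  obtain ⟨g, hg, rfl⟩ := closure_minimal hsub hcl hw
  exact ⟨g, hg, hι g, ι.norm_map g⟩

/-- Centered functions of independent coordinates are linearly independent. -/
theorem eq_zero_of_sum_eq_zero {ν : ∀ j, Measure (H j)} [∀ j, IsProbabilityMeasure (ν j)]
    (g : ∀ j, Lp ℝ 2 (ν j)) (hg : ∀ j, ∫ y, g j y ∂ν j = 0)
    (h : ∀ᵐ x ∂Measure.pi ν, ∑ j, g j (x j) = 0) (i : Fin p) : g i = 0 := by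
  have hmp : ∀ j, MeasurePreserving (Function.eval j) (Measure.pi ν) (ν j) := fun j =>
    measurePreserving_eval ν j
  have hL : ∀ j, MemLp (fun x : ∀ j, H j => g j (x j)) 2 (Measure.pi ν) := fun j =>
    (Lp.memLp (g j)).comp_measurePreserving (hmp j)
  have hmap : ∀ j (f : H j → ℝ), AEStronglyMeasurable f (ν j) →
      ∫ x, f (x j) ∂Measure.pi ν = ∫ y, f y ∂ν j := by
    intro j f hf
    conv_rhs => rw [← (hmp j).map_eq]
    rw [integral_map (hmp j).measurable.aemeasurable (by rwa [(hmp j).map_eq])]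
  have hind := iIndepFun_pi (μ := ν) (X := fun j => (g j : H j → ℝ))
    fun j => (Lp.aestronglyMeasurable (g j)).aemeasurable
  -- Multiplying the vanishing sum by `g i` and integrating leaves only `‖g i‖²`, since independence
  -- and centering remove the cross terms.
  have hcross : ∀ j, j ≠ i → ∫ x, g j (x j) * g i (x i) ∂Measure.pi ν = 0 := by
    intro j hj
    have h1 := (hind.indepFun hj).integral_mul_eq_mul_integral (hL j).1 (hL i).1
    rw [hmap j _ (Lp.aestronglyMeasurable (g j)), hg j, zero_mul] at h1
    exact h1
  have h0 : ∫ x, (∑ j, g j (x j)) * g i (x i) ∂Measure.pi ν = 0 := by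
    rw [integral_eq_zero_of_ae]
    filter_upwards [h] with x hx
    rw [hx, zero_mul]; rfl
  simp_rw [Finset.sum_mul] at h0
  have hi : ∀ j, Integrable (fun x : ∀ j, H j => g j (x j) * g i (x i)) (Measure.pi ν) :=
    fun j => (hL j).integrable_mul (hL i)
  rw [integral_finsetSum _ fun j _ => hi j,
    Finset.sum_eq_single i (fun j _ hj => hcross j hj) (by simp),
    hmap i (fun y => g i y * g i y)
      ((Lp.aestronglyMeasurable (g i)).mul (Lp.aestronglyMeasurable (g i)))] at h0
  rw [← norm_eq_zero, ← sq_eq_zero_iff, ← real_inner_self_eq_norm_sq, L2.inner_def]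
  exact h0

/-- The correlation operators of a square integrable random element. -/
theorem corr_covOp (hX : MemLp X 2 P) (hhs : IsHSMat (offDiag (corr (covOp P X))))
    (hequiv : GaussianEquivalence P X ∨ EigenvalueGap (corr (covOp P X))) :
    (∀ i j, i ≠ j → IsCorr (covOp P X) i j (corr (covOp P X) i j)) ∧
      IsSelfAdjoint (toOp (corr (covOp P X))) ∧
      ∃ c > 0, ∀ x, c * ‖x‖ ^ 2 ≤ (inner ℝ x (toOp (corr (covOp P X)) x) : ℝ) := by
  obtain ⟨U, hU1, hU2, hU3⟩ := exists_corr_factor (isPositive_covOp hX)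
    (fun j => by
      obtain ⟨b, hb⟩ := exists_eigenbasis_of_hs (isPositive_covOp hX j).isSelfAdjoint
        (hsNorm_covOp_self_lt_top hX j)
      exact ⟨_, b, _, hb⟩)
    (fun j => innerLp (memLp_centered_eval hX j)) (inner_covOp hX)
  have hU := fun i j h => (hU3 i j h).2
  refine ⟨fun i j h => (hU3 i j h).1, isSelfAdjoint_corr hU, ?_⟩
  rcases hequiv with hG | hgap
  · refine coercive_of_injective hU1 hU hhs fun x hx => ?_
    have := fun j : Fin p => Measure.isProbabilityMeasure_map (μ := P)
      (memLp_apply hX j).1.aemeasurable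
    choose g hg0 hgU hgn using fun j => exists_of_mem_closure_range hX (hU2 j (x j))
    -- The relation holds for the joint law; absolute continuity transports it to the product law,
    -- under which the coordinates are independent.
    have hsum : ∀ᵐ y ∂(P.map fun ω j => X ω j), ∑ j, g j (y j) = 0 := by
      have h1 := Lp.coeFn_finsetSum (s := Finset.univ) (fun j => U j (x j))
      rw [hx] at h1
      filter_upwards [h1, Lp.coeFn_zero ℝ 2 (P.map fun ω j => X ω j), ae_all_iff.2 hgU] with y h2 h3 h4
      rw [h3, Finset.sum_apply] at h2
      simp_rw [← h4]
      exact h2.symm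
    intro j
    rw [← norm_eq_zero, hgn, eq_zero_of_sum_eq_zero g hg0 (hG.2.2.ae_le hsum) j, norm_zero]
  · exact coercive_of_eigenvalueGap (isSelfAdjoint_corr hU) hgap

end Covariance

/-! ### Scalar and operator bounds for the regularized inverse square root -/

section Estimator

variable {E F κ ν : Type*} [NormedAddCommGroup E] [InnerProductSpace ℝ E] [CompleteSpace E]
  [NormedAddCommGroup F] [InnerProductSpace ℝ F] [CompleteSpace F]

theorem rpow_neg_half {x : ℝ} (hx : 0 < x) : x ^ (-(1 / 2) : ℝ) = (√x)⁻¹ := by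
  rw [Real.rpow_neg hx.le, Real.sqrt_eq_rpow]

/-- With `x = √(ε+s)` and `y = √(ε+t)`, the quantity is `(t-s)(√t/y)/(x(x+y))`. The damping `√t ≤ y`
saves a factor, so the constant is of order `1/ε` instead of `ε^(-3/2)`. -/
theorem abs_regInvSqrt_sub_le {ε s t : ℝ} (hε : 0 < ε) (hs : 0 ≤ s) (ht : 0 ≤ t) :
    |((ε + s) ^ (-(1 / 2) : ℝ) - (ε + t) ^ (-(1 / 2) : ℝ)) * t ^ (1 / 2 : ℝ)| ≤
      (2 * ε)⁻¹ * |s - t| := by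
  rw [rpow_neg_half (by positivity), rpow_neg_half (by positivity), ← Real.sqrt_eq_rpow]
  have hx : √ε ≤ √(ε + s) := Real.sqrt_le_sqrt (by linarith)
  have hy : √ε ≤ √(ε + t) := Real.sqrt_le_sqrt (by linarith)
  have hty : √t ≤ √(ε + t) := Real.sqrt_le_sqrt (by linarith)
  have he : √ε * √ε = ε := Real.mul_self_sqrt hε.le
  have hx2 : √(ε + s) * √(ε + s) = ε + s := Real.mul_self_sqrt (by positivity)
  have hy2 : √(ε + t) * √(ε + t) = ε + t := Real.mul_self_sqrt (by positivity)
  have he0 : 0 < √ε := Real.sqrt_pos.2 hε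
  set x := √(ε + s)
  set y := √(ε + t)
  have hx0 : 0 < x := he0.trans_le hx
  have hy0 : 0 < y := he0.trans_le hy
  have e1 : (x⁻¹ - y⁻¹) * √t = (t - s) * (√t / y) * (x * (x + y))⁻¹ := by
    have : t - s = (y - x) * (x + y) := by linear_combination hx2 - hy2
    rw [this]
    field_simp
  rw [e1, abs_mul, abs_mul, abs_of_nonneg (by positivity : 0 ≤ √t / y),
    abs_of_nonneg (by positivity : 0 ≤ (x * (x + y))⁻¹), abs_sub_comm t s, mul_comm (2 * ε)⁻¹]
  have h1 : √t / y ≤ 1 := (div_le_one hy0).2 hty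
  have h2 : (x * (x + y))⁻¹ ≤ (2 * ε)⁻¹ := by
    refine inv_anti₀ (by positivity) ?_
    nlinarith [mul_le_mul hx hx he0.le hx0.le, mul_le_mul hx hy he0.le hx0.le]
  calc |s - t| * (√t / y) * (x * (x + y))⁻¹ ≤ |s - t| * 1 * (2 * ε)⁻¹ := by gcongr
    _ = _ := by rw [mul_one]

/-- The product is the square root of `t/(ε+t)`, a number in `[0, 1]`. -/
theorem regInvSqrt_mul_sqrt_mem {ε t : ℝ} (hε : 0 < ε) (ht : 0 ≤ t) :
    0 ≤ (ε + t) ^ (-(1 / 2) : ℝ) * t ^ (1 / 2 : ℝ) ∧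
      (ε + t) ^ (-(1 / 2) : ℝ) * t ^ (1 / 2 : ℝ) ≤ 1 ∧
      t / (ε + t) ≤ (ε + t) ^ (-(1 / 2) : ℝ) * t ^ (1 / 2 : ℝ) := by
  have h0 : 0 < ε + t := by positivity
  rw [rpow_neg_half h0, ← Real.sqrt_eq_rpow, ← Real.sqrt_inv, ← Real.sqrt_mul (by positivity),
    inv_mul_eq_div]
  have h1 : t / (ε + t) ≤ 1 := (div_le_one h0).2 (by linarith)
  have h2 : 0 ≤ t / (ε + t) := by positivity
  refine ⟨Real.sqrt_nonneg _, Real.sqrt_le_one.2 h1, Real.le_sqrt_of_sq_le ?_⟩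
  nlinarith

/-- The deviation from `1` is at most `ε/(ε+t)`, and weighted AM-GM gives `t^β ε^(1-β) ≤ ε + t`. The
smoothing factor `t^β` thus buys the rate `ε^β`. -/
theorem abs_bias_le {ε t β : ℝ} (hε : 0 < ε) (ht : 0 ≤ t) (hβ0 : 0 < β) (hβ1 : β ≤ 1) :
    |((ε + t) ^ (-(1 / 2) : ℝ) * t ^ (1 / 2 : ℝ) - 1) * t ^ β| ≤ ε ^ β := by
  obtain ⟨-, h1, h2⟩ := regInvSqrt_mul_sqrt_mem hε ht
  set q := (ε + t) ^ (-(1 / 2) : ℝ) * t ^ (1 / 2 : ℝ)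
  have h0 : 0 < ε + t := by positivity
  have hg := Real.geom_mean_le_arith_mean2_weighted hβ0.le (sub_nonneg.2 hβ1) ht hε.le (by ring)
  rw [abs_mul, abs_of_nonpos (by linarith), abs_of_nonneg (by positivity)]
  have h3 : -(q - 1) ≤ ε / (ε + t) := by
    have : ε / (ε + t) = 1 - t / (ε + t) := by field_simp; ring
    linarith
  calc -(q - 1) * t ^ β ≤ ε / (ε + t) * t ^ β := by gcongr
    _ = ε ^ β * (t ^ β * ε ^ (1 - β)) / (ε + t) := by
        have h5 : ε ^ β * ε ^ (1 - β) = ε := by rw [← Real.rpow_add hε]; simp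
        calc _ = ε ^ β * ε ^ (1 - β) / (ε + t) * t ^ β := by rw [h5]
          _ = _ := by ring
    _ ≤ ε ^ β * (ε + t) / (ε + t) := by
        gcongr
        nlinarith
    _ = _ := by field_simp

variable {a : HilbertBasis κ ℝ E} {A : E →L[ℝ] E} {t : κ → ℝ}
  {c : HilbertBasis ν ℝ E} {A' : E →L[ℝ] E} {s : ν → ℝ}

theorem norm_regInvSqrt_le (hA : IsDiag a A t) (hpos : A.IsPositive) {ε : ℝ} (hε : 0 < ε) :
    ‖regInvSqrt ε A‖ ≤ (√ε)⁻¹ := by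
  refine (hA.regInvSqrt hpos hε).norm_le (by positivity) fun k => ?_
  have ht := hA.nonneg hpos k
  rw [rpow_neg_half (by positivity), abs_of_nonneg (by positivity)]
  exact inv_anti₀ (Real.sqrt_pos.2 hε) (Real.sqrt_le_sqrt (by linarith))

theorem norm_regInvSqrt_mul_sqrt_le (hA : IsDiag a A t) (hpos : A.IsPositive) {ε : ℝ}
    (hε : 0 < ε) : ‖regInvSqrt ε A ∘L opPow A (1 / 2)‖ ≤ 1 := by
  refine ((hA.regInvSqrt hpos hε).mul (hA.opPow hpos (by norm_num))).norm_le zero_le_one fun k => ?_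
  obtain ⟨h1, h2, -⟩ := regInvSqrt_mul_sqrt_mem hε (hA.nonneg hpos k)
  rwa [abs_of_nonneg h1]

theorem norm_opPow_le (hA : IsDiag a A t) (hpos : A.IsPositive) {β : ℝ} (hβ0 : 0 < β)
    (hβ1 : β ≤ 1) : ‖opPow A β‖ ≤ max 1 ‖A‖ := by
  refine (hA.opPow hpos hβ0).norm_le (by positivity) fun k => ?_
  have ht := hA.nonneg hpos k
  rw [abs_of_nonneg (by positivity)]
  rcases le_total (t k) 1 with h | h
  · exact (Real.rpow_le_one ht h hβ0.le).trans (le_max_left _ _)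
  · calc t k ^ β ≤ t k ^ (1 : ℝ) := Real.rpow_le_rpow_of_exponent_le h hβ1
      _ = t k := Real.rpow_one _
      _ ≤ ‖A‖ := (hA.mem_Icc hpos k).2
      _ ≤ _ := le_max_right _ _

theorem norm_bias_le (hA : IsDiag a A t) (hpos : A.IsPositive) {ε β : ℝ} (hε : 0 < ε)
    (hβ0 : 0 < β) (hβ1 : β ≤ 1) :
    ‖(regInvSqrt ε A ∘L opPow A (1 / 2) - 1) ∘L opPow A β‖ ≤ ε ^ β :=
  ((((hA.regInvSqrt hpos hε).mul (hA.opPow hpos (by norm_num))).sub (IsDiag.one a)).mul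
    (hA.opPow hpos hβ0)).norm_le (by positivity)
    fun k => abs_bias_le hε (hA.nonneg hpos k) hβ0 hβ1

/-- `A` and `A'` need not commute. In their two eigenbases the difference is a Schur multiplier of
`A' - A`, bounded by the scalar estimate. This controls its Hilbert-Schmidt norm, hence its operator
norm. -/
theorem norm_regInvSqrt_sub_le (hA : IsDiag a A t) (hpos : A.IsPositive) (hA' : IsDiag c A' s)
    (hpos' : A'.IsPositive) {ε δ : ℝ} (hε : 0 < ε) (hδ : 0 ≤ δ)
    (hd : hsNorm (A' - A) ≤ ENNReal.ofReal δ) :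
    ‖regInvSqrt ε A' ∘L opPow A (1 / 2) - regInvSqrt ε A ∘L opPow A (1 / 2)‖ ≤ δ / (2 * ε) := by
  have h1 := hsNorm_le_of_inner_le a c
    (regInvSqrt ε A' ∘L opPow A (1 / 2) - regInvSqrt ε A ∘L opPow A (1 / 2)) (A' - A)
    (M := (2 * ε)⁻¹) (by positivity) (fun k j => by
      have hS := hA.regInvSqrt hpos hε
      have hS' := hA'.regInvSqrt hpos' hε
      have hP := hA.opPow hpos (s := 1 / 2) (by norm_num)
      have e1 : (inner ℝ (c j) ((regInvSqrt ε A' ∘L opPow A (1 / 2) -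
          regInvSqrt ε A ∘L opPow A (1 / 2)) (a k)) : ℝ) =
          ((ε + s j) ^ (-(1 / 2) : ℝ) - (ε + t k) ^ (-(1 / 2) : ℝ)) * t k ^ (1 / 2 : ℝ) *
            inner ℝ (c j) (a k) := by
        rw [_root_.sub_apply, ContinuousLinearMap.comp_apply, ContinuousLinearMap.comp_apply,
          inner_sub_right, hS'.inner_apply, hP k, map_smul, hS k, inner_smul_right,
          inner_smul_right, inner_smul_right]
        ring
      have e2 : (inner ℝ (c j) ((A' - A) (a k)) : ℝ) = (s j - t k) * inner ℝ (c j) (a k) := by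
        rw [_root_.sub_apply, inner_sub_right, hA'.inner_apply, hA k, inner_smul_right]
        ring
      rw [e1, e2, abs_mul, abs_mul (s j - t k), ← mul_assoc]
      exact mul_le_mul_of_nonneg_right
        (abs_regInvSqrt_sub_le hε (hA'.nonneg hpos' j) (hA.nonneg hpos k)) (abs_nonneg _))
  have h2 : hsNorm (regInvSqrt ε A' ∘L opPow A (1 / 2) - regInvSqrt ε A ∘L opPow A (1 / 2)) ≤
      ENNReal.ofReal (δ / (2 * ε)) := by
    refine h1.trans ?_
    rw [div_eq_inv_mul, ENNReal.ofReal_mul (by positivity)]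
    gcongr
  have hlt := h2.trans_lt ENNReal.ofReal_lt_top
  exact (HSOp.opNorm_le (HSOp.mk _ hlt)).trans ((HSOp.norm_le_iff _ (by positivity)).2 h2)

theorem norm_comp_symm {S T : E →L[ℝ] E} (hS : IsSelfAdjoint S) (hT : IsSelfAdjoint T) :
    ‖S ∘L T‖ = ‖T ∘L S‖ := by
  rw [← LinearIsometryEquiv.norm_map ContinuousLinearMap.adjoint (S ∘L T),
    ContinuousLinearMap.adjoint_comp, ContinuousLinearMap.isSelfAdjoint_iff'.1 hS,
    ContinuousLinearMap.isSelfAdjoint_iff'.1 hT]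

end Estimator

/-! ### Error of the estimated correlation entries -/

section EstimatorError

variable {E F κ₁ κ₂ κ₃ κ₄ : Type*}
  [NormedAddCommGroup E] [InnerProductSpace ℝ E] [CompleteSpace E]
  [NormedAddCommGroup F] [InnerProductSpace ℝ F] [CompleteSpace F]
  {a : HilbertBasis κ₁ ℝ F} {A : F →L[ℝ] F} {t : κ₁ → ℝ}
  {a' : HilbertBasis κ₂ ℝ F} {A' : F →L[ℝ] F} {t' : κ₂ → ℝ}
  {b : HilbertBasis κ₃ ℝ E} {B : E →L[ℝ] E} {s : κ₃ → ℝ}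
  {b' : HilbertBasis κ₄ ℝ E} {B' : E →L[ℝ] E} {s' : κ₄ → ℝ}

theorem sandwich_sub_left {E' F' : Type*} [NormedAddCommGroup E'] [InnerProductSpace ℝ E']
    [CompleteSpace E'] [NormedAddCommGroup F'] [InnerProductSpace ℝ F'] [CompleteSpace F']
    (S S' : F →L[ℝ] F') (T : E' →L[ℝ] E) (M : HSOp E F) :
    sandwich S T M - sandwich S' T M = sandwich (S - S') T M := by
  apply HSOp.toCLM_injective
  ext x
  rfl

theorem sandwich_sub_right {E' F' : Type*} [NormedAddCommGroup E'] [InnerProductSpace ℝ E']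
    [CompleteSpace E'] [NormedAddCommGroup F'] [InnerProductSpace ℝ F'] [CompleteSpace F']
    (S : F →L[ℝ] F') (T T' : E' →L[ℝ] E) (M : HSOp E F) :
    sandwich S T M - sandwich S T' M = sandwich S (T - T') M := by
  apply HSOp.toCLM_injective
  ext x
  change S (M.toCLM (T x)) - S (M.toCLM (T' x)) = S (M.toCLM (T x - T' x))
  rw [map_sub, map_sub]

/-- The error of the regularized estimator of a correlation operator. -/
theorem norm_estimator_sub_le (hA : IsDiag a A t) (hAp : A.IsPositive) (hA' : IsDiag a' A' t')
    (hAp' : A'.IsPositive) (hB : IsDiag b B s) (hBp : B.IsPositive) (hB' : IsDiag b' B' s')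
    (hBp' : B'.IsPositive) {ε δ η β N : ℝ} (hε : 0 < ε) (hδ : 0 ≤ δ) (hβ0 : 0 < β) (hβ1 : β ≤ 1)
    (hη : ε ^ β = η) (hη' : δ / ε = η) (hNA : ‖A‖ ≤ N) (hNB : ‖B‖ ≤ N)
    (hdA : hsNorm (A' - A) ≤ ENNReal.ofReal δ) (hdB : hsNorm (B' - B) ≤ ENNReal.ofReal δ)
    {D M Φ : HSOp E F} (hD : ‖D‖ ≤ δ) (hM : M = sandwich (opPow A β) (opPow B β) Φ) :
    ‖sandwich (regInvSqrt ε A') (regInvSqrt ε B')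
        (D + sandwich (opPow A (1 / 2)) (opPow B (1 / 2)) M) - M‖ ≤
      η + η * ‖M‖ * (1 + η / 4) + η * ‖Φ‖ * (2 * max 1 N) := by
  have hη0 : 0 < η := by rw [← hη]; positivity
  have sB := (hB.regInvSqrt hBp hε).isSelfAdjoint
  have sB' := (hB'.regInvSqrt hBp' hε).isSelfAdjoint
  have sBh := (hB.opPow hBp (s := 1 / 2) (by norm_num)).isSelfAdjoint
  have sBβ := (hB.opPow hBp hβ0).isSelfAdjoint
  have hKA := norm_regInvSqrt_mul_sqrt_le hA hAp hε
  have hKA' := norm_regInvSqrt_sub_le hA hAp hA' hAp' hε hδ hdA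
  have hKB := norm_regInvSqrt_mul_sqrt_le hB hBp hε
  have hKB' := norm_regInvSqrt_sub_le hB hBp hB' hBp' hε hδ hdB
  have hbA := norm_bias_le hA hAp hε hβ0 hβ1
  have hbB := norm_bias_le hB hBp hε hβ0 hβ1
  have hpA := (norm_opPow_le hA hAp hβ0 hβ1).trans (max_le_max le_rfl hNA)
  have hpB := (norm_opPow_le hB hBp hβ0 hβ1).trans (max_le_max le_rfl hNB)
  have h2 : δ / (2 * ε) = η / 2 := by rw [← hη']; field_simp
  rw [h2] at hKA' hKB'
  rw [hη] at hbA hbB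
  set SA' := regInvSqrt ε A'
  set SB' := regInvSqrt ε B'
  set SA := regInvSqrt ε A
  set SB := regInvSqrt ε B
  set PA := opPow A (1 / 2)
  set PB := opPow B (1 / 2)
  have hLB : ‖PB ∘L SB‖ ≤ 1 := by rwa [norm_comp_symm sBh sB]
  have hLB' : ‖PB ∘L SB' - PB ∘L SB‖ ≤ η / 2 := by
    have e : PB ∘L SB' - PB ∘L SB = PB ∘L (SB' - SB) := by ext x; simp
    have e' : SB' ∘L PB - SB ∘L PB = (SB' - SB) ∘L PB := by ext x; simp
    have hs : IsSelfAdjoint (SB' - SB) := sB'.sub sB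
    rw [e, norm_comp_symm sBh hs, ← e']
    exact hKB'
  have hLBn : ‖PB ∘L SB'‖ ≤ 1 + η / 2 := by
    calc ‖PB ∘L SB'‖ = ‖PB ∘L SB + (PB ∘L SB' - PB ∘L SB)‖ := by rw [add_sub_cancel]
      _ ≤ _ := (norm_add_le _ _).trans (add_le_add hLB hLB')
  have hcomm : PB ∘L SB = SB ∘L PB := by
    refine (((hB.opPow hBp (s := 1 / 2) (by norm_num)).mul (hB.regInvSqrt hBp hε))).eq_of ?_
    intro k
    rw [((hB.regInvSqrt hBp hε).mul (hB.opPow hBp (s := 1 / 2) (by norm_num))) k]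
    dsimp only
    rw [mul_comm]
  have hbB' : ‖opPow B β ∘L (PB ∘L SB - 1)‖ ≤ η := by
    have hs : IsSelfAdjoint (PB ∘L SB - 1) :=
      (((hB.opPow hBp (s := 1 / 2) (by norm_num)).mul (hB.regInvSqrt hBp hε)).sub
        (IsDiag.one b)).isSelfAdjoint
    rw [norm_comp_symm sBβ hs, hcomm]
    exact hbB
  have t1 : ‖sandwich SA' SB' D‖ ≤ η := by
    refine (norm_sandwich_apply_le _ _ _).trans ?_
    have h1 := norm_regInvSqrt_le hA' hAp' hε
    have h3 := norm_regInvSqrt_le hB' hBp' hε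
    calc ‖SA'‖ * ‖D‖ * ‖SB'‖ ≤ (√ε)⁻¹ * δ * (√ε)⁻¹ := by gcongr
      _ = δ / (√ε * √ε) := by field_simp
      _ = η := by rw [Real.mul_self_sqrt hε.le, hη']
  have t2 : ‖sandwich (SA' ∘L PA - SA ∘L PA) (PB ∘L SB') M‖ ≤ η / 2 * ‖M‖ * (1 + η / 2) :=
    (norm_sandwich_apply_le _ _ _).trans (by gcongr)
  have t3 : ‖sandwich (SA ∘L PA) (PB ∘L SB' - PB ∘L SB) M‖ ≤ 1 * ‖M‖ * (η / 2) :=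
    (norm_sandwich_apply_le _ _ _).trans (by gcongr)
  have t4 : ‖sandwich ((SA ∘L PA - 1) ∘L opPow A β) (opPow B β ∘L (PB ∘L SB)) Φ‖ ≤
      η * ‖Φ‖ * (max 1 N * 1) := by
    refine (norm_sandwich_apply_le _ _ _).trans ?_
    have : ‖opPow B β ∘L (PB ∘L SB)‖ ≤ max 1 N * 1 :=
      (ContinuousLinearMap.opNorm_comp_le _ _).trans (by gcongr)
    gcongr
  have t5 : ‖sandwich (opPow A β) (opPow B β ∘L (PB ∘L SB - 1)) Φ‖ ≤ max 1 N * ‖Φ‖ * η :=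
    (norm_sandwich_apply_le _ _ _).trans (by gcongr)
  -- The five terms are the covariance noise, the replacement of each estimated regularizer by the
  -- true one, and the bias on each side. Only the bias terms use the factorization of `M` through
  -- `Φ`.
  have hdec : sandwich SA' SB' (D + sandwich PA PB M) - M =
      sandwich SA' SB' D + (sandwich (SA' ∘L PA - SA ∘L PA) (PB ∘L SB') M +
        (sandwich (SA ∘L PA) (PB ∘L SB' - PB ∘L SB) M +
        (sandwich ((SA ∘L PA - 1) ∘L opPow A β) (opPow B β ∘L (PB ∘L SB)) Φ +
        sandwich (opPow A β) (opPow B β ∘L (PB ∘L SB - 1)) Φ))) := by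
    have e4 : sandwich ((SA ∘L PA - 1) ∘L opPow A β) (opPow B β ∘L (PB ∘L SB)) Φ =
        sandwich (SA ∘L PA - 1) (PB ∘L SB) M := by rw [hM]; rfl
    have e5 : sandwich (opPow A β) (opPow B β ∘L (PB ∘L SB - 1)) Φ =
        sandwich 1 (PB ∘L SB - 1) M := by rw [hM]; rfl
    have e1 : sandwich SA' SB' (sandwich PA PB M) = sandwich (SA' ∘L PA) (PB ∘L SB') M := rfl
    have e0 : sandwich (1 : F →L[ℝ] F) (1 : E →L[ℝ] E) M = M := rfl
    rw [e4, e5, map_add, e1, ← sandwich_sub_left, ← sandwich_sub_right, ← sandwich_sub_left,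
      ← sandwich_sub_right 1, e0]
    abel
  rw [hdec]
  refine (norm_add_le _ _).trans ((add_le_add t1 ((norm_add_le _ _).trans (add_le_add t2
    ((norm_add_le _ _).trans (add_le_add t3 ((norm_add_le _ _).trans
      (add_le_add t4 t5))))))).trans_eq ?_)
  ring

end EstimatorError

/-! ### Comparing the constants with the norms in the proof -/

section Constants

variable {p : ℕ} {H : Fin p → Type*} [∀ j, NormedAddCommGroup (H j)]
  [∀ j, InnerProductSpace ℝ (H j)] [∀ j, CompleteSpace (H j)] {S : Finset (Fin p × Fin p)}

/-- Each row has at most `maxDegree S` nonzero entries; this is how sparsity enters. -/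
theorem rowNorm_incS_le (v : ∀ e : S, HSAt H e.1) :
    rowNorm (incS S v).toCLM ≤ maxDegree S * ‖v‖ := by
  refine rowNorm_le (by positivity) fun i => ?_
  have h1 : ∀ j, ‖blk (incS S v).toCLM i j‖ ≤ if (i, j) ∈ S then ‖v‖ else 0 := by
    intro j
    rw [← hblk_toCLM]
    split_ifs with h
    · exact (HSOp.opNorm_le _).trans (norm_hblk_incS_le v i j)
    · rw [hblk_incS_notMem v h, map_zero, norm_zero]
  refine (Finset.sum_le_sum fun j _ => h1 j).trans ?_
  rw [← Finset.sum_filter, Finset.sum_const, nsmul_eq_mul]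
  gcongr
  exact Finset.le_sup (f := fun i : Fin p => (Finset.univ.filter fun j : Fin p => (i, j) ∈ S).card)
    (Finset.mem_univ i)

theorem one_le_maxDegree (hp : 1 ≤ p) (hS : ∀ i, (i, i) ∈ S) : 1 ≤ maxDegree S := by
  have h := Finset.le_sup
    (f := fun i : Fin p => (Finset.univ.filter fun j : Fin p => (i, j) ∈ S).card)
    (Finset.mem_univ (⟨0, hp⟩ : Fin p))
  refine le_trans (Finset.card_pos.2 ⟨⟨0, hp⟩, ?_⟩) h
  simpa using hS _

theorem one_le_rhoConst (R : OpMat H) : 1 ≤ rhoConst R :=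
  le_add_of_nonneg_right (Real.iSup_nonneg fun _ => Finset.sum_nonneg fun _ _ =>
    ENNReal.toReal_nonneg)

theorem opNorm_le_hsNorm_toReal {E F : Type*} [NormedAddCommGroup E] [InnerProductSpace ℝ E]
    [CompleteSpace E] [NormedAddCommGroup F] [InnerProductSpace ℝ F] [CompleteSpace F]
    {A : E →L[ℝ] F} (hA : hsNorm A < ∞) : ‖A‖ ≤ (hsNorm A).toReal := by
  rw [← HSOp.toCLM_mk A hA, ← HSOp.norm_eq]
  exact HSOp.opNorm_le _

theorem rowNorm_corr_le {C : OpMat H} (hhs : IsHSMat (offDiag (corr C))) :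
    rowNorm (toOp (corr C)) ≤ rhoConst (corr C) := by
  refine rowNorm_le (zero_le_one.trans (one_le_rhoConst _)) fun i => ?_
  have h1 : ∀ j, ‖blk (toOp (corr C)) i j‖ ≤
      (if j = i then 1 else 0) + (hsNorm (offDiag (corr C) i j)).toReal := by
    intro j
    rw [blk_toOp]
    split_ifs with h
    · subst h
      rw [corr_self]
      exact (ContinuousLinearMap.norm_id_le).trans (le_add_of_nonneg_right ENNReal.toReal_nonneg)
    · have e : corr C i j = offDiag (corr C) i j := by simp [offDiag, Ne.symm h]
      rw [zero_add, e]
      exact opNorm_le_hsNorm_toReal (hhs i j)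
  refine (Finset.sum_le_sum fun j _ => h1 j).trans ?_
  rw [Finset.sum_add_distrib, Finset.sum_ite_eq' Finset.univ i, if_pos (Finset.mem_univ _)]
  exact add_le_add_right (le_ciSup (f := fun i => ∑ j, (hsNorm (offDiag (corr C) i j)).toReal)
    (Set.finite_range _).bddAbove i) _

/-- The eigenvalues of `T` are at most `ρ`, so those of `J` are at least `ρ⁻¹`. The lower bound `c`
is needed only for invertibility and does not reach the final constants. -/
theorem le_inner_inverse {E : Type*} [NormedAddCommGroup E] [InnerProductSpace ℝ E]
    [CompleteSpace E] {K T J : E →L[ℝ] E} (hK : IsSelfAdjoint K) (hs : hsNorm K < ∞)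
    (hT : T = 1 + K) {c ρ : ℝ} (hc : 0 < c) (hcT : ∀ x, c * ‖x‖ ^ 2 ≤ inner ℝ x (T x))
    (hρ : ∀ x, |(inner ℝ x (T x) : ℝ)| ≤ ρ * ‖x‖ ^ 2) (hJ : J * T = 1) (x : E) :
    ρ⁻¹ * ‖x‖ ^ 2 ≤ inner ℝ x (J x) := by
  obtain ⟨b, l, hbT, hbJ, hl⟩ := exists_isDiag_inverse hK hs hT hc hcT hJ
  refine hbJ.le_inner (fun k => inv_anti₀ (hc.trans_le (hl k).1) ?_) x
  have h1 := hρ (b k)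
  rw [hbT.eigenvalue_eq, b.orthonormal.1 k, one_pow, mul_one] at h1
  exact (le_abs_self _).trans h1

theorem rowSum_nonneg {e : Fin p × Fin p} (L : (∀ e' : S, HSAt H e'.1) →L[ℝ] HSAt H e) :
    0 ≤ rowSum L := Finset.sum_nonneg fun _ _ => norm_nonneg _

theorem one_le_gammaConst (R : OpMat H) : 1 ≤ gammaConst R :=
  le_add_of_nonneg_right (Real.iSup_nonneg fun _ => rowSum_nonneg _)

theorem norm_apply_le_of_rowSum_le (M : (∀ e : S, HSAt H e.1) →L[ℝ] (∀ e : S, HSAt H e.1))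
    {m : ℝ} (hm : 0 ≤ m) (h : ∀ e : S, rowSum (e := e.1) (ContinuousLinearMap.proj e ∘L M) ≤ m)
    (v : ∀ e : S, HSAt H e.1) : ‖M v‖ ≤ m * ‖v‖ := by
  refine (pi_norm_le_iff_of_nonneg (mul_nonneg hm (norm_nonneg _))).2 fun e => ?_
  have h0 := h e
  generalize hL : (ContinuousLinearMap.proj e ∘L M : (∀ e : S, HSAt H e.1) →L[ℝ] HSAt H e.1) = L at h0
  have h1 : ‖L v‖ ≤ rowSum (e := e.1) L * ‖v‖ := norm_apply_le_rowSum (e := e.1) L v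
  have h2 : L v = M v e := by rw [← hL]; rfl
  rw [← h2]
  exact h1.trans (mul_le_mul_of_nonneg_right h0 (norm_nonneg v))

theorem le_iSup_of_finite {ι : Type*} [Finite ι] (f : ι → ℝ) (i : ι) : f i ≤ ⨆ i, f i :=
  le_ciSup (Set.finite_range f).bddAbove i

theorem gammaConst_eq (R : OpMat H) : ∃ f : edgeSet R → ℝ, gammaConst R = 1 + ⨆ e, f e ∧
    ∀ e : edgeSet R, rowSum (ContinuousLinearMap.proj e ∘L
      (Ring.inverse (gammaSS R (edgeSet R)) - 1)) = f e := ⟨_, rfl, fun _ => rfl⟩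

theorem rowSum_le_gammaConst (R : OpMat H) (e : edgeSet R) :
    rowSum (ContinuousLinearMap.proj e ∘L
      (Ring.inverse (gammaSS R (edgeSet R)) - 1)) ≤ gammaConst R - 1 := by
  obtain ⟨f, h1, h2⟩ := gammaConst_eq R
  rw [h1, h2, add_sub_cancel_left]
  exact le_iSup_of_finite f e

/-- `Γ_SS⁻¹ = 1 + Λ_SS`: the identity accounts for the summand `1` in `gammaConst`, and the row sums
bound the rest in the maximum norm. -/
theorem norm_inverse_gammaSS_le (R : OpMat H) (v : ∀ e : edgeSet R, HSAt H e.1) :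
    ‖Ring.inverse (gammaSS R (edgeSet R)) v‖ ≤ gammaConst R * ‖v‖ := by
  have h1 := norm_apply_le_of_rowSum_le (Ring.inverse (gammaSS R (edgeSet R)) - 1)
    (sub_nonneg.2 (one_le_gammaConst R)) (rowSum_le_gammaConst R) v
  have h2 : Ring.inverse (gammaSS R (edgeSet R)) v =
      v + (Ring.inverse (gammaSS R (edgeSet R)) - 1) v := by
    rw [_root_.sub_apply, one_apply_eq_self, add_sub_cancel]
  rw [h2]
  refine (norm_add_le _ _).trans ((add_le_add_right h1 _).trans_eq ?_)
  ring

theorem diag_mem_edgeSet (R : OpMat H) (i : Fin p) : (i, i) ∈ edgeSet R := by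
  simp [edgeSet]

theorem edgeSet_symm {R : OpMat H} (hR : IsSelfAdjoint (toOp R)) {Rinv : PiLp 2 H →L[ℝ] PiLp 2 H}
    (hRi : Ring.inverse (toOp R) = Rinv) (h1 : toOp R * Rinv = 1) (i j : Fin p)
    (h : (i, j) ∈ edgeSet R) : (j, i) ∈ edgeSet R := by
  have hsa : IsSelfAdjoint (precision R) := by
    rw [precision, hRi]
    exact IsSelfAdjoint.sub (R := PiLp 2 H →L[ℝ] PiLp 2 H) (selfAdjoint_of_mul_eq_one hR h1) (.one _)
  simp only [edgeSet, Finset.mem_filter, Finset.mem_univ, true_and] at h ⊢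
  refine h.imp Eq.symm fun h0 h2 => h0 ?_
  rw [← norm_eq_zero, norm_blk_selfAdjoint hsa, h2, norm_zero]

theorem blk_precision_eq_zero {R : OpMat H} {i j : Fin p} (h : (i, j) ∉ edgeSet R) :
    blk (precision R) i j = 0 := by
  simp only [edgeSet, Finset.mem_filter, Finset.mem_univ, true_and, not_or, not_not] at h
  exact h.2

theorem isHSMat_offDiag_corr {C Φ : OpMat H} {β : ℝ} (h : Regularity C β Φ) :
    IsHSMat (offDiag (corr C)) := fun i j => by
  rw [h.2.2.2.2 i j]
  exact (hsNorm_sandwich _ _ _).trans_lt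
    (ENNReal.mul_lt_top (ENNReal.mul_lt_top enorm_lt_top (h.2.2.1 i j)) enorm_lt_top)

theorem le_maxOff (A : OpMat H) (i j : Fin p) : (hsNorm (offDiag A i j)).toReal ≤ maxOff A :=
  (le_ciSup (f := fun j => (hsNorm (offDiag A i j)).toReal) (Set.finite_range _).bddAbove j).trans
    (le_ciSup (f := fun i => ⨆ j, (hsNorm (offDiag A i j)).toReal)
      (Set.finite_range _).bddAbove i)

/-- With `q` the maximum on the right, the error is at most `(13/4) q η`, which leaves ample room
below `16 √2 q η`. -/
theorem kappa_bound {η m φ N m' φ' : ℝ} (hη0 : 0 ≤ η) (hη : η ≤ 1) (hm : m ≤ m') (hφ : φ ≤ φ') :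
    η + η * m * (1 + η / 4) + η * φ * (2 * max 1 N) ≤
      16 * √2 * max (max 1 m') (φ' * max 2 (2 * N)) * η := by
  have hN : 2 * max 1 N = max 2 (2 * N) := by rw [mul_max_of_nonneg _ _ zero_le_two, mul_one]
  rw [hN]
  have hN0 : 0 ≤ max 2 (2 * N) := zero_le_two.trans (le_max_left _ _)
  have h1 : 1 ≤ max (max 1 m') (φ' * max 2 (2 * N)) := (le_max_left _ _).trans (le_max_left _ _)
  have h2 : m ≤ max (max 1 m') (φ' * max 2 (2 * N)) :=
    hm.trans ((le_max_right _ _).trans (le_max_left _ _))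
  have h3 : φ * max 2 (2 * N) ≤ max (max 1 m') (φ' * max 2 (2 * N)) :=
    (mul_le_mul_of_nonneg_right hφ hN0).trans (le_max_right _ _)
  set q := max (max 1 m') (φ' * max 2 (2 * N))
  have hs : (1 : ℝ) ≤ √2 := Real.one_le_sqrt.2 one_le_two
  calc _ = η * (1 + m * (1 + η / 4) + φ * max 2 (2 * N)) := by ring
    _ ≤ η * (q + q * (1 + 1 / 4) + q) := by gcongr
    _ ≤ η * (16 * 1 * q) := by gcongr; linarith
    _ ≤ η * (16 * √2 * q) := by gcongr
    _ = _ := by ring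

/-- Smallness of the radius from the sample size condition. -/
theorem radius_bounds {d κ ρ γ η a x : ℝ} (hd : 1 ≤ d) (hκ : 1 ≤ κ) (hρ : 1 ≤ ρ) (hγ : 1 ≤ γ)
    (ha : 0 < a) (hη : 0 ≤ η) (hx : x = 1 + 8 / a)
    (h : 12 * d * κ * x ^ 2 * max (ρ * γ) (ρ ^ 3 * γ ^ 2) * η ≤ 1) :
    η ≤ 1 ∧ ρ * (d * (2 * γ * (x * (κ * η)))) ≤ 1 / 6 ∧
      γ * ρ ^ 3 * d * (2 * γ * (x * (κ * η))) ≤ 1 / 6 ∧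
      6 / 5 * ρ ^ 3 * d * (2 * γ * (x * (κ * η))) ^ 2 ≤ κ * η := by
  have hx1 : 1 ≤ x := by rw [hx]; exact le_add_of_nonneg_right (by positivity)
  have hxx : x ≤ x ^ 2 := by nlinarith
  have key : ∀ m, 0 ≤ m → m ≤ max (ρ * γ) (ρ ^ 3 * γ ^ 2) → 12 * d * κ * x ^ 2 * m * η ≤ 1 :=
    fun m _ hm => le_trans (by gcongr) h
  have k1 := key (ρ * γ) (by positivity) (le_max_left _ _)
  have k2 := key (ρ ^ 3 * γ ^ 2) (by positivity) (le_max_right _ _)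
  have k3 := key 1 zero_le_one ((one_le_mul_of_one_le_of_one_le hρ hγ).trans (le_max_left _ _))
  refine ⟨?_, ?_, ?_, ?_⟩
  · calc η = 1 * 1 * 1 * 1 ^ 2 * 1 * η := by ring
      _ ≤ 12 * d * κ * x ^ 2 * 1 * η := by gcongr; norm_num
      _ ≤ 1 := k3
  · calc _ = (12 * d * κ * x * (ρ * γ) * η) / 6 := by ring
      _ ≤ (12 * d * κ * x ^ 2 * (ρ * γ) * η) / 6 := by gcongr
      _ ≤ _ := by linarith
  · calc _ = (12 * d * κ * x * (ρ ^ 3 * γ ^ 2) * η) / 6 := by ring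
      _ ≤ (12 * d * κ * x ^ 2 * (ρ ^ 3 * γ ^ 2) * η) / 6 := by gcongr
      _ ≤ _ := by linarith
  -- Only this quadratic remainder requires `x ^ 2`; the preceding bounds use one factor `x`.
  · calc _ = 2 / 5 * (12 * d * κ * x ^ 2 * (ρ ^ 3 * γ ^ 2) * η) * (κ * η) := by ring
      _ ≤ 2 / 5 * 1 * (κ * η) := by gcongr
      _ ≤ _ := by nlinarith [mul_nonneg (zero_le_one.trans hκ) hη]

end Constants

/-! ### Deterministic recovery from an accurate covariance estimate -/

section Recovery

variable {p : ℕ} {H : Fin p → Type*} [∀ j, NormedAddCommGroup (H j)]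
  [∀ j, InnerProductSpace ℝ (H j)] [∀ j, CompleteSpace (H j)] {S : Finset (Fin p × Fin p)}

/-- Existence, uniqueness and accuracy of the minimizer for an accurate input. -/
theorem exists_unique_minimizer {R Rinv : PiLp 2 H →L[ℝ] PiLp 2 H} (hR : R * Rinv = 1)
    (hR' : Rinv * R = 1) (hRsa : IsSelfAdjoint R) {ρ γ d r : ℝ} (hρ1 : 1 ≤ ρ) (hρ : rowNorm R ≤ ρ)
    (hlow : ∀ x, ρ⁻¹ * ‖x‖ ^ 2 ≤ inner ℝ x (Rinv x))
    (hS : ∀ i j, (i, j) ∈ S → (j, i) ∈ S) (hSd : ∀ i, (i, i) ∈ S)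
    (hΓ : IsUnit (gammaSS (blk R) S))
    (hγ0 : 0 < γ) (hγ : ∀ v, ‖Ring.inverse (gammaSS (blk R) S) v‖ ≤ γ * ‖v‖)
    (hd0 : 0 ≤ d) (hd : ∀ v : (∀ e : S, HSAt H e.1), rowNorm (incS S v).toCLM ≤ d * ‖v‖)
    (hr : 0 ≤ r) (hx : ρ * (d * r) ≤ 1 / 6) (hx' : γ * ρ ^ 3 * d * r ≤ 1 / 6)
    {Hs Q R0 : HSOp (PiLp 2 H) (PiLp 2 H)} (hHs : Hs.toCLM = Rinv - 1) (hR0 : R0.toCLM = R - 1)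
    (hHsS : ∀ i j, (i, j) ∉ S → hblk i j Hs = 0)
    {α lam w : ℝ} (hα : 0 < α) (hlam : 0 < lam) {Rhat : OpMat H}
    (hQ : ∀ i j, (hblk i j Q).toCLM = offDiag Rhat i j)
    (hQw : ∀ i j, ‖hblk i j Q - hblk i j R0‖ ≤ w) (hw : w = α * lam / 8)
    (hrw : r = 2 * γ * (w + lam)) (hrem : 6 / 5 * ρ ^ 3 * d * r ^ 2 ≤ w)
    (hinc : ∀ e ∉ S, 0 ≤ 1 - α ∧ ∀ v,
      ‖gammaRow (blk R) S e (Ring.inverse (gammaSS (blk R) S) v)‖ ≤ (1 - α) * ‖v‖) :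
    ∃ Hh : HSOp (PiLp 2 H) (PiLp 2 H), IsMinimizer Rhat lam Hh.toCLM ∧
      (∀ T, IsMinimizer Rhat lam T → T = Hh.toCLM) ∧
      ∀ i j, ‖hblk i j Hh - hblk i j Hs‖ ≤ r := by
  have hR0a : HSOp.adj _ _ R0 = R0 := by
    refine adj_of_isSelfAdjoint ?_
    rw [hR0]
    exact IsSelfAdjoint.sub (R := PiLp 2 H →L[ℝ] PiLp 2 H) hRsa (.one _)
  have hblkR0 : ∀ i j, HSOp.adj _ _ (hblk j i R0) = hblk i j R0 := fun i j => by
    rw [← hblk_adj, hR0a]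
  -- Symmetrizing averages an entry error with the adjoint of the transposed entry's error, so the
  -- entrywise bound `w` survives.
  let W := (1 / 2 : ℝ) • (Q + HSOp.adj _ _ Q) - R0
  have hW : HSOp.adj _ _ W = W := by
    have h1 : HSOp.adj _ _ (HSOp.adj _ _ Q) = Q := by
      apply HSOp.toCLM_injective
      rw [HSOp.adj_toCLM, HSOp.adj_toCLM, ContinuousLinearMap.adjoint_adjoint]
    simp only [W]
    rw [map_sub, map_smul, map_add, h1, hR0a, add_comm Q]
  have hWw : ∀ i j, ‖hblk i j W‖ ≤ w := by
    intro i j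
    have e : hblk i j W = (1 / 2 : ℝ) • ((hblk i j Q - hblk i j R0) +
        HSOp.adj _ _ (hblk j i Q - hblk j i R0)) := by
      simp only [W]
      rw [map_sub, map_smul, map_add, hblk_adj, map_sub (HSOp.adj _ _), hblkR0]
      module
    rw [e, norm_smul, Real.norm_of_nonneg (by norm_num)]
    have h1 := norm_add_le (hblk i j Q - hblk i j R0) (HSOp.adj _ _ (hblk j i Q - hblk j i R0))
    rw [LinearIsometry.norm_map] at h1
    have h2 := hQw i j
    have h3 := hQw j i
    linarith
  obtain ⟨Hh, G, Y, J, m, h1, h2, h3, h4, h5, h6, h7, h8, h9, h10⟩ := exists_certificate hR hR'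
    hRsa hρ1 hρ hlow hS hSd hΓ hγ0 hγ hd0 hd hr hx hx' hHs hR0 hHsS hα hlam hW hWw hw hrw hrem hinc
  have hst : (1 / 2 : ℝ) • (Q + HSOp.adj _ _ Q) = -Y - G := by
    rw [← h6]
    simp only [W]
    rw [add_sub_cancel]
  obtain ⟨h11, h12⟩ := isMinimizer_of_certificate hQ h1 h2 h3 h4 h5 hst h7 h8 h9
  exact ⟨Hh, h11, h12, h10⟩

/-- The estimator of the correlation operator matrix is accurate if the estimator of the covariance
operator matrix is. -/
theorem exists_offDiag_corrEst {C Φ Chat : OpMat H} {ε δ η β : ℝ}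
    (hpos : ∀ j, (C j j).IsPositive) (hhs : ∀ j, hsNorm (C j j) < ∞)
    (hcorr : ∀ i j, i ≠ j → IsCorr C i j (corr C i j)) (hreg : Regularity C β Φ)
    (hpos' : ∀ j, (Chat j j).IsPositive)
    (hd : ∀ i j, hsNorm (Chat i j - C i j) ≤ ENNReal.ofReal δ) (hε : 0 < ε) (hδ : 0 ≤ δ)
    (hη : ε ^ β = η) (hη' : δ / ε = η) (hη1 : η ≤ 1) {R0 : HSOp (PiLp 2 H) (PiLp 2 H)}
    (hR0 : R0.toCLM = toOp (offDiag (corr C))) :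
    ∃ Q : HSOp (PiLp 2 H) (PiLp 2 H),
      (∀ i j, (hblk i j Q).toCLM = offDiag (corrEst ε Chat) i j) ∧
      ∀ i j, ‖hblk i j Q - hblk i j R0‖ ≤ kappaConst C Φ * η := by
  have hη0 : 0 < η := by rw [← hη]; positivity
  have hdlt : ∀ i j, hsNorm (Chat i j - C i j) < ∞ := fun i j =>
    (hd i j).trans_lt ENNReal.ofReal_lt_top
  -- The estimator is not assumed Hilbert-Schmidt; on the good event it is, as a Hilbert-Schmidt
  -- perturbation of `C j j`. This supplies its eigenbasis.
  have hhs' : ∀ j, hsNorm (Chat j j) < ∞ := fun j => by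
    have := (HSOp.mk _ (hdlt j j) + HSOp.mk _ (hhs j)).hsNorm_lt_top
    rwa [map_add, HSOp.toCLM_mk, HSOp.toCLM_mk, sub_add_cancel] at this
  have hR0b : ∀ i j, (hblk i j R0).toCLM = offDiag (corr C) i j := fun i j => by
    rw [hblk_toCLM, hR0, blk_toOp]
  let q : ∀ i j, HSOp (H j) (H i) := fun i j => if i = j then 0 else
    sandwich (regInvSqrt ε (Chat i i)) (regInvSqrt ε (Chat j j))
      (HSOp.mk _ (hdlt i j) + sandwich (opPow (C i i) (1 / 2)) (opPow (C j j) (1 / 2))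
        (hblk i j R0))
  have hq : ∀ i j, (q i j).toCLM = offDiag (corrEst ε Chat) i j := by
    intro i j
    by_cases h : i = j
    · simp [q, h, offDiag]
    · simp only [q, h, if_false, offDiag, corrEst]
      have e : (hblk i j R0).toCLM = corr C i j := by rw [hR0b, offDiag, if_neg h]
      rw [sandwich_toCLM, map_add, sandwich_toCLM, HSOp.toCLM_mk, e, ← (hcorr i j h).1,
        sub_add_cancel]
  have hQhs : IsHSMat (offDiag (corrEst ε Chat)) := fun i j => by
    rw [← hq]; exact HSOp.hsNorm_lt_top _
  let Q := HSOp.mk _ (hsNorm_toOp_lt_top hQhs)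
  have hQ : ∀ i j, (hblk i j Q).toCLM = offDiag (corrEst ε Chat) i j := fun i j => by
    rw [hblk_toCLM, HSOp.toCLM_mk, blk_toOp]
  refine ⟨Q, hQ, fun i j => ?_⟩
  have hκ0 : 0 ≤ kappaConst C Φ * η :=
    mul_nonneg (mul_nonneg (by positivity)
      (zero_le_one.trans ((le_max_left _ _).trans (le_max_left _ _)))) hη0.le
  have hQq : hblk i j Q = q i j := HSOp.toCLM_injective (by rw [hQ, hq])
  rw [hQq]
  by_cases h : i = j
  · have e : hblk i j R0 = 0 := HSOp.toCLM_injective (by rw [hR0b, offDiag, if_pos h, map_zero])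
    simp only [q, h, if_true]
    subst h
    rw [e, sub_zero, norm_zero]
    exact hκ0
  · simp only [q, h, if_false]
    obtain ⟨a, ha⟩ := exists_eigenbasis_of_hs (hpos i).isSelfAdjoint (hhs i)
    obtain ⟨a', ha'⟩ := exists_eigenbasis_of_hs (hpos' i).isSelfAdjoint (hhs' i)
    obtain ⟨b, hb⟩ := exists_eigenbasis_of_hs (hpos j).isSelfAdjoint (hhs j)
    obtain ⟨b', hb'⟩ := exists_eigenbasis_of_hs (hpos' j).isSelfAdjoint (hhs' j)
    have hN : ∀ j, ‖C j j‖ ≤ ⨆ j, ‖C j j‖ := le_iSup_of_finite _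
    have hDn : ‖HSOp.mk _ (hdlt i j)‖ ≤ δ := (HSOp.norm_le_iff _ hδ).2 (hd i j)
    have hM : hblk i j R0 = sandwich (opPow (C i i) β) (opPow (C j j) β)
        (HSOp.mk (Φ i j) (hreg.2.2.1 i j)) :=
      HSOp.toCLM_injective (by rw [hR0b, sandwich_toCLM, hreg.2.2.2.2 i j]; rfl)
    refine (norm_estimator_sub_le ha (hpos i) ha' (hpos' i) hb (hpos j) hb' (hpos' j) hε hδ hreg.1
      hreg.2.1 hη hη' (hN i) (hN j) (hd i i) (hd j j) hDn hM).trans ?_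
    refine kappa_bound hη0.le hη1 ?_ ?_
    · rw [HSOp.norm_eq, hR0b]; exact le_maxOff _ i j
    · have e : Φ i j = offDiag Φ i j := by rw [offDiag, if_neg h]
      rw [HSOp.norm_eq, HSOp.toCLM_mk, e]; exact le_maxOff _ i j

theorem one_le_kappaConst (C Φ : OpMat H) : 1 ≤ kappaConst C Φ := by
  have h1 : (1 : ℝ) ≤ max (max 1 (maxOff (corr C))) (maxOff Φ * max 2 (2 * ⨆ j, ‖C j j‖)) :=
    (le_max_left _ _).trans (le_max_left _ _)
  have hs : (1 : ℝ) ≤ √2 := Real.one_le_sqrt.2 one_le_two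
  unfold kappaConst
  nlinarith

/-- Incoherence bounds the action of `Γ_{eS} Γ_{SS}⁻¹`. -/
theorem Incoherence.norm_le {R : OpMat H} {α : ℝ} (h : Incoherence R α) (e : Fin p × Fin p)
    (he : e ∉ edgeSet R) : 0 ≤ 1 - α ∧ ∀ v,
      ‖gammaRow R (edgeSet R) e (Ring.inverse (gammaSS R (edgeSet R)) v)‖ ≤ (1 - α) * ‖v‖ := by
  have h1 := h e he
  refine ⟨(rowSum_nonneg _).trans h1, fun v => ?_⟩
  generalize hL : gammaRow R (edgeSet R) e ∘L Ring.inverse (gammaSS R (edgeSet R)) = L at h1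
  have h2 : gammaRow R (edgeSet R) e (Ring.inverse (gammaSS R (edgeSet R)) v) = L v := by
    rw [← hL]; rfl
  rw [h2]
  exact (norm_apply_le_rowSum L v).trans (mul_le_mul_of_nonneg_right h1 (norm_nonneg v))

theorem sub_one_eq_neg_mul {A : Type*} [Ring A] {T J : A} (h : J * T = 1) :
    J - 1 = -J * (T - 1) := by
  rw [mul_sub, neg_mul, h, mul_one]; abel

theorem hsNorm_inverse_sub_one_lt_top {E : Type*} [NormedAddCommGroup E] [InnerProductSpace ℝ E]
    [CompleteSpace E] {T J : E →L[ℝ] E} (h : J * T = 1) (hT : hsNorm (T - 1) < ∞) :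
    hsNorm (J - 1) < ∞ := by
  rw [sub_one_eq_neg_mul h]
  exact (hsNorm_comp_left (-J) (T - 1)).trans_lt (ENNReal.mul_lt_top enorm_lt_top hT)

/-- Recovery on the event that the covariance estimator is accurate. -/
theorem recovery_of_accurate (hp : 1 ≤ p) {C Φ Chat : OpMat H} {ε δ η β α : ℝ}
    (hpos : ∀ j, (C j j).IsPositive) (hhs : ∀ j, hsNorm (C j j) < ∞)
    (hcorr : ∀ i j, i ≠ j → IsCorr C i j (corr C i j)) (hreg : Regularity C β Φ)
    (hsa : IsSelfAdjoint (toOp (corr C))) {c : ℝ} (hc : 0 < c)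
    (hcoer : ∀ x, c * ‖x‖ ^ 2 ≤ (inner ℝ x (toOp (corr C) x) : ℝ))
    (hα : 0 < α) (hinc : Incoherence (corr C) α)
    (hpos' : ∀ j, (Chat j j).IsPositive)
    (hd : ∀ i j, hsNorm (Chat i j - C i j) ≤ ENNReal.ofReal δ) (hε : 0 < ε) (hδ : 0 ≤ δ)
    (hη : ε ^ β = η) (hη' : δ / ε = η)
    (hsmall : 12 * (maxDegree (edgeSet (corr C)) : ℝ) * kappaConst C Φ * (1 + 8 / α) ^ 2 *
      max (rhoConst (corr C) * gammaConst (corr C))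
        (rhoConst (corr C) ^ 3 * gammaConst (corr C) ^ 2) * η ≤ 1) :
    ∃ Hh : HSOp (PiLp 2 H) (PiLp 2 H),
      IsMinimizer (corrEst ε Chat) (8 / α * kappaConst C Φ * η) Hh.toCLM ∧
      (∀ T, IsMinimizer (corrEst ε Chat) (8 / α * kappaConst C Φ * η) T → T = Hh.toCLM) ∧
      ∀ i j, hsNorm (blk Hh.toCLM i j - blk (precision (corr C)) i j) ≤
        ENNReal.ofReal (2 * gammaConst (corr C) * (1 + 8 / α) * kappaConst C Φ * η) := by
  have hη0 : 0 < η := by rw [← hη]; positivity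
  have hoff := isHSMat_offDiag_corr hreg
  have hκ1 := one_le_kappaConst C Φ
  have hγ1 := one_le_gammaConst (corr C)
  have hρ1 := one_le_rhoConst (corr C)
  have hd1 : (1 : ℝ) ≤ maxDegree (edgeSet (corr C)) := by
    exact_mod_cast one_le_maxDegree hp (diag_mem_edgeSet (corr C))
  obtain ⟨hη1, hx1, hx2, hx3⟩ := radius_bounds hd1 hκ1 hρ1 hγ1 hα hη0.le rfl hsmall
  have hu := isUnit_of_coercive hc hcoer
  have hR' := Ring.inverse_mul_cancel _ hu
  have hR := Ring.mul_inverse_cancel _ hu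
  have hdec := toOp_eq_one_add_offDiag C
  let R0 := HSOp.mk _ (hsNorm_toOp_lt_top hoff)
  have hR0 : R0.toCLM = toOp (corr C) - 1 := by
    rw [hdec, add_sub_cancel_left]; rfl
  have hsa0 : IsSelfAdjoint R0.toCLM := by
    rw [hR0]
    exact IsSelfAdjoint.sub (R := PiLp 2 H →L[ℝ] PiLp 2 H) hsa (.one _)
  have hHslt : hsNorm (precision (corr C)) < ∞ :=
    hsNorm_inverse_sub_one_lt_top hR' (by rw [← hR0]; exact R0.hsNorm_lt_top)
  obtain ⟨Q, hQ, hQw⟩ := exists_offDiag_corrEst hpos hhs hcorr hreg hpos' hd hε hδ hη hη' hη1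
    (R0 := R0) rfl
  obtain ⟨b, hb⟩ := exists_eigenbasis_of_hs hsa0 R0.hsNorm_lt_top
  have hT : toOp (corr C) = 1 + R0.toCLM := hdec
  have hRd : IsDiag b (toOp (corr C)) (fun k => 1 + k.1) := by
    rw [hT]; exact (IsDiag.one b).add hb
  have hck : ∀ k : EigIdx R0.toCLM, c ≤ 1 + k.1 := fun k => by
    have h1 := hcoer (b k)
    rwa [hRd.eigenvalue_eq, b.orthonormal.1 k, one_pow, mul_one] at h1
  have hΓ : IsUnit (gammaSS (blk (toOp (corr C))) (edgeSet (corr C))) :=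
    isUnit_gammaSS (mul_pos hc hc) fun A => le_inner_sandwich hRd hc.le hcoer hck A hc.le
  have hrowR := rowNorm_corr_le hoff
  have hlow := le_inner_inverse hsa0 R0.hsNorm_lt_top hT hc hcoer
    (fun x => (abs_inner_le_rowNorm hsa x).trans
      (mul_le_mul_of_nonneg_right hrowR (sq_nonneg _))) hR'
  obtain ⟨Hh, h1, h2, h3⟩ := exists_unique_minimizer (S := edgeSet (corr C)) hR hR' hsa hρ1 hrowR
    hlow (edgeSet_symm hsa rfl hR) (diag_mem_edgeSet _) hΓ (γ := gammaConst (corr C))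
    (zero_lt_one.trans_le hγ1) (by rw [blk_toOp]; exact norm_inverse_gammaSS_le _)
    (zero_le_one.trans hd1) rowNorm_incS_le
    -- The choice of `lam` makes `w = α lam / 8` equal to `κη`, so `r = 2γ(w + lam)` takes this
    -- form.
    (r := 2 * gammaConst (corr C) * ((1 + 8 / α) * (kappaConst C Φ * η))) (by positivity) hx1 hx2
    (Hs := HSOp.mk _ hHslt) rfl hR0
    (fun i j hij => HSOp.toCLM_injective (by
      rw [hblk_toCLM, HSOp.toCLM_mk, blk_precision_eq_zero hij, map_zero]))
    hα (lam := 8 / α * kappaConst C Φ * η) (by positivity) hQ hQw (by field_simp)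
    (by ring) hx3 (by rw [blk_toOp]; exact hinc.norm_le)
  refine ⟨Hh, h1, h2, fun i j => ?_⟩
  have h4 := (HSOp.norm_le_iff _ (by positivity)).1 (h3 i j)
  rw [map_sub, hblk_toCLM, hblk_toCLM, HSOp.toCLM_mk] at h4
  refine h4.trans_eq ?_
  congr 1
  ring

end Recovery

theorem hsNorm_neg {E F : Type*} [NormedAddCommGroup E] [InnerProductSpace ℝ E]
    [CompleteSpace E] [NormedAddCommGroup F] [InnerProductSpace ℝ F] [CompleteSpace F]
    (A : E →L[ℝ] F) : hsNorm (-A) = hsNorm A := by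
  simp [hsNorm]

/-! ### Sample size condition and the event of accuracy -/

section Tail

variable {p : ℕ} {H : Fin p → Type*} [∀ j, NormedAddCommGroup (H j)]
  [∀ j, InnerProductSpace ℝ (H j)] [∀ j, CompleteSpace (H j)]
  {Ω : Type*} [MeasurableSpace Ω] {P : Measure Ω} {f : ℕ → ℝ → ℝ}

/-- A strict lower bound in `ℕ∞` already excludes `n = 0`, as the tail condition requires. -/
theorem lt_of_nBar_lt {δ r : ℝ} {n : ℕ} (h : nBar f δ r < n) : 1 ≤ n ∧ r < f n δ := by
  refine ⟨?_, ?_⟩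
  · rcases Nat.eq_zero_or_pos n with rfl | hn
    · exact absurd h (by simp)
    · exact hn
  · by_contra! hle
    refine absurd h (not_lt.2 ?_)
    exact le_iSup₂ (f := fun (n : ℕ) (_ : n ∈ {n : ℕ | f n δ ≤ r}) => (n : ℕ∞)) n hle

theorem IsDeltaBar.lt {n : ℕ} {r δbar δ : ℝ} (hf : IsTailFunction f) (h : IsDeltaBar f n r δbar)
    (hδ : 0 < δ) (hr : r < f n δ) : δbar < δ := by
  by_contra! hle
  exact absurd (hf.2.2 n δ δbar hδ hle) (not_le.2 (h.1.2.trans_lt hr))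

/-- The tail bound at the critical level. -/
theorem measure_lt_hsNorm_le {C : OpMat H} {Chat : ℕ → Ω → OpMat H} {δs : ℝ}
    (htail : TailCondition P C Chat f δs) {n : ℕ} (hn : 1 ≤ n) {r δbar : ℝ}
    (hδbar : IsDeltaBar f n r δbar) (hδs : δbar < δs) (i j : Fin p) :
    P {ω | ENNReal.ofReal δbar < hsNorm (Chat n ω i j - C i j)} ≤ (ENNReal.ofReal r)⁻¹ := by
  -- The tail condition bounds `P[error ≥ δ]` usefully only for `δ > δbar`. The strict event `error
  -- > δbar` is the increasing union of the events at levels `s k ↓ δbar`, all below `δs`.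
  let s : ℕ → ℝ := fun k => δbar + (δs - δbar) * (1 / ((k : ℝ) + 2))
  have hpos : 0 < δs - δbar := sub_pos.2 hδs
  have hs1 : ∀ k, δbar < s k := fun k => lt_add_of_pos_right _ (by positivity)
  have hs2 : ∀ k, s k < δs := fun k => by
    have h1 : 1 / ((k : ℝ) + 2) < 1 := by
      rw [div_lt_one (by positivity)]
      have : (0 : ℝ) ≤ k := Nat.cast_nonneg k
      linarith
    have h2 := mul_lt_mul_of_pos_left h1 hpos
    simp only [s]
    linarith
  have hlim : Filter.Tendsto s Filter.atTop (nhds δbar) := by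
    have h1 : Filter.Tendsto (fun k : ℕ => 1 / ((k : ℝ) + 2)) Filter.atTop (nhds 0) := by
      have := (Filter.tendsto_add_atTop_iff_nat 1).2
        (tendsto_one_div_add_atTop_nhds_zero_nat (𝕜 := ℝ))
      refine this.congr fun k => ?_
      push_cast
      ring
    simpa [s] using (h1.const_mul (δs - δbar)).const_add δbar
  have hanti : Antitone s := fun k l hkl => by
    have h1 : 1 / ((l : ℝ) + 2) ≤ 1 / ((k : ℝ) + 2) := by gcongr
    exact add_le_add_right (mul_le_mul_of_nonneg_left h1 hpos.le) _
  let t : ℕ → Set Ω := fun k => {ω | ENNReal.ofReal (s k) ≤ hsNorm (Chat n ω i j - C i j)}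
  have hmono : Monotone t := fun k l hkl ω hω =>
    (ENNReal.ofReal_le_ofReal (hanti hkl)).trans hω
  have hsub : {ω | ENNReal.ofReal δbar < hsNorm (Chat n ω i j - C i j)} ⊆ ⋃ k, t k := by
    intro ω hω
    have h1 := ((ENNReal.continuous_ofReal.tendsto δbar).comp hlim).eventually_lt_const hω
    obtain ⟨k, hk⟩ := h1.exists
    exact Set.mem_iUnion.2 ⟨k, hk.le⟩
  refine (measure_mono hsub).trans ?_
  rw [hmono.measure_iUnion]
  refine iSup_le fun k => ?_
  have hk0 : 0 < s k := hδbar.1.1.trans (hs1 k)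
  refine (htail n hn (s k) hk0 (hs2 k) i j).trans (ENNReal.inv_le_inv.2
    (ENNReal.ofReal_le_ofReal ?_))
  -- Maximality of `δbar` forces `f n (s k) > r`.
  by_contra! hlt
  exact absurd (hδbar.2 ⟨hk0, hlt.le⟩) (not_le.2 (hs1 k))

/-- The event on which the covariance estimator is accurate. -/
theorem exists_accurate_event [IsProbabilityMeasure P] (hp : 1 ≤ p) {C : OpMat H}
    {Chat : ℕ → Ω → OpMat H} {δs : ℝ} (htail : TailCondition P C Chat f δs) {n : ℕ} (hn : 1 ≤ n)
    {τ δbar : ℝ} (hδbar : IsDeltaBar f n ((p : ℝ) ^ τ) δbar) (hδs : δbar < δs)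
    (hpos : ∀ᵐ ω ∂P, ∀ j, (Chat n ω j j).IsPositive) :
    ∃ G : Set Ω, MeasurableSet G ∧ ENNReal.ofReal (1 - 1 / (p : ℝ) ^ (τ - 2)) ≤ P G ∧
      ∀ ω ∈ G, (∀ j, (Chat n ω j j).IsPositive) ∧
        ∀ i j, hsNorm (Chat n ω i j - C i j) ≤ ENNReal.ofReal δbar := by
  have hp0 : (0 : ℝ) < p := by exact_mod_cast hp
  let N : Set Ω := {ω | ¬∀ j, (Chat n ω j j).IsPositive}
  let B : Fin p → Fin p → Set Ω := fun i j =>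
    {ω | ENNReal.ofReal δbar < hsNorm (Chat n ω i j - C i j)}
  let A : Set Ω := N ∪ ⋃ i, ⋃ j, B i j
  have hA : P A ≤ ENNReal.ofReal (1 / (p : ℝ) ^ (τ - 2)) := by
    have hN : P N = 0 := ae_iff.1 hpos
    have h1 : P (⋃ i, ⋃ j, B i j) ≤ ∑ i : Fin p, ∑ j : Fin p, (ENNReal.ofReal ((p : ℝ) ^ τ))⁻¹ := by
      refine (measure_iUnion_fintype_le _ _).trans (Finset.sum_le_sum fun i _ => ?_)
      refine (measure_iUnion_fintype_le _ _).trans (Finset.sum_le_sum fun j _ => ?_)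
      exact measure_lt_hsNorm_le htail hn hδbar hδs i j
    have h2 : ∑ i : Fin p, ∑ j : Fin p, (ENNReal.ofReal ((p : ℝ) ^ τ))⁻¹ =
        ENNReal.ofReal (1 / (p : ℝ) ^ (τ - 2)) := by
      simp only [Finset.sum_const, Finset.card_univ, Fintype.card_fin, nsmul_eq_mul]
      rw [← ENNReal.ofReal_inv_of_pos (by positivity), ← ENNReal.ofReal_natCast,
        ← ENNReal.ofReal_mul hp0.le, ← ENNReal.ofReal_mul hp0.le]
      congr 1
      rw [Real.rpow_sub hp0, Real.rpow_two]
      field_simp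
    calc P A ≤ P N + P (⋃ i, ⋃ j, B i j) := measure_union_le _ _
      _ ≤ _ := by rw [hN, zero_add, ← h2]; exact h1
  -- Neither the estimator nor positivity is assumed measurable, so the bad set is replaced by a
  -- measurable hull of the same measure.
  refine ⟨(toMeasurable P A)ᶜ, (measurableSet_toMeasurable P A).compl, ?_, fun ω hω => ?_⟩
  · rw [prob_compl_eq_one_sub (measurableSet_toMeasurable P A), measure_toMeasurable,
      ENNReal.ofReal_sub _ (by positivity), ENNReal.ofReal_one]
    exact tsub_le_tsub_left hA _
  · have h1 : ω ∉ A := fun h => hω (subset_toMeasurable P A h)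
    refine ⟨by_contra fun h => h1 (Or.inl h), fun i j => ?_⟩
    by_contra! h
    exact h1 (Or.inr (Set.mem_iUnion₂.2 ⟨i, j, h⟩))

/-- The exponents `1 + 1/β` and `β/(1+β)` are reciprocal, which explains the power in the sample
size condition. -/
theorem mul_rpow_le_one {c δ β : ℝ} (hc : 0 < c) (hβ : 0 < β) (hδ : 0 < δ)
    (h : δ ≤ 1 / c ^ (1 + 1 / β)) : c * δ ^ (β / (1 + β)) ≤ 1 := by
  have h1 : δ ^ (β / (1 + β)) ≤ (1 / c ^ (1 + 1 / β)) ^ (β / (1 + β)) := by gcongr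
  have h2 : (1 / c ^ (1 + 1 / β)) ^ (β / (1 + β)) = c⁻¹ := by
    rw [one_div, ← Real.rpow_neg hc.le, ← Real.rpow_mul hc.le, ← Real.rpow_neg_one c]
    congr 1
    field_simp
    ring
  rw [h2] at h1
  calc c * δ ^ (β / (1 + β)) ≤ c * c⁻¹ := by gcongr
    _ = 1 := mul_inv_cancel₀ hc.ne'

end Tail

end FGL

/-! ### Assembly of the main theorem -/

theorem mainTheorem3 {p : ℕ} (hp : 1 ≤ p)
    (H : Fin p → Type*) [∀ j, NormedAddCommGroup (H j)] [∀ j, InnerProductSpace ℝ (H j)]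
    [∀ j, CompleteSpace (H j)] [∀ j, SecondCountableTopology (H j)]
    [∀ j, MeasurableSpace (H j)] [∀ j, BorelSpace (H j)]
    {Ω : Type*} [MeasurableSpace Ω] (P : Measure Ω) [IsProbabilityMeasure P]
    (X : Ω → PiLp 2 H) (hX : MemLp X 2 P)
    (Chat : ℕ → Ω → FGL.OpMat H)
    (hpos : ∀ n, ∀ᵐ ω ∂P, ∀ j, (Chat n ω j j).IsPositive)
    (f : ℕ → ℝ → ℝ) (hf : FGL.IsTailFunction f) (δs : ℝ) (hδs : 0 < δs)
    (htail : FGL.TailCondition P (FGL.covOp P X) Chat f δs)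
    (τ : ℝ) (hτ : 2 < τ)
    (hequiv : FGL.GaussianEquivalence P X ∨ FGL.EigenvalueGap (FGL.corr (FGL.covOp P X)))
    (α : ℝ) (hα : 0 < α) (hinc : FGL.Incoherence (FGL.corr (FGL.covOp P X)) α)
    (β : ℝ) (Φ : FGL.OpMat H) (hreg : FGL.Regularity (FGL.covOp P X) β Φ)
    (κ ρ γ d : ℝ)
    (hκ : κ = FGL.kappaConst (FGL.covOp P X) Φ)
    (hρ : ρ = FGL.rhoConst (FGL.corr (FGL.covOp P X)))
    (hγ : γ = FGL.gammaConst (FGL.corr (FGL.covOp P X)))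
    (hd : d = FGL.maxDegree (FGL.edgeSet (FGL.corr (FGL.covOp P X))))
    (n : ℕ) (δbar : ℝ) (hδbar : FGL.IsDeltaBar f n ((p : ℝ) ^ τ) δbar)
    (hn : FGL.nBar f
      (1 / max (1 / δs)
        ((12 * d * κ * (1 + 8 / α) ^ 2 * max (ρ * γ) (ρ ^ 3 * γ ^ 2)) ^ (1 + 1 / β)))
      ((p : ℝ) ^ τ) < n)
    (ε lam : ℝ) (hε : ε = δbar ^ (1 / (1 + β)))
    (hlam : lam = 8 / α * κ * δbar ^ (β / (1 + β))) :
    ∃ G : Set Ω, MeasurableSet G ∧ ENNReal.ofReal (1 - 1 / (p : ℝ) ^ (τ - 2)) ≤ P G ∧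
      ∀ ω ∈ G, ∃ Hhat : PiLp 2 H →L[ℝ] PiLp 2 H,
        FGL.IsMinimizer (FGL.corrEst ε (Chat n ω)) lam Hhat ∧
        (∀ T, FGL.IsMinimizer (FGL.corrEst ε (Chat n ω)) lam T → T = Hhat) ∧
        (∀ i j, FGL.hsNorm (FGL.blk Hhat i j -
            FGL.blk (FGL.precision (FGL.corr (FGL.covOp P X))) i j) ≤
          ENNReal.ofReal (2 * γ * (1 + 8 / α) * κ * δbar ^ (β / (1 + β)))) ∧
        (∀ i j, ENNReal.ofReal (2 * γ * (1 + 8 / α) * κ * δbar ^ (β / (1 + β))) <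
            FGL.hsNorm (FGL.blk (FGL.precision (FGL.corr (FGL.covOp P X))) i j) →
          FGL.blk Hhat i j ≠ 0) := by
  subst hκ hρ hγ hd
  have hβ0 : 0 < β := hreg.1
  obtain ⟨hcorr, hsa, c, hc, hcoer⟩ := FGL.corr_covOp hX (FGL.isHSMat_offDiag_corr hreg) hequiv
  obtain ⟨hn1, hfn⟩ := FGL.lt_of_nBar_lt hn
  have hδ0 : 0 < δbar := hδbar.1.1
  have hκ1 := FGL.one_le_kappaConst (FGL.covOp P X) Φ
  have hγ1 := FGL.one_le_gammaConst (FGL.corr (FGL.covOp P X))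
  have hρ1 := FGL.one_le_rhoConst (FGL.corr (FGL.covOp P X))
  have hd1 : (1 : ℝ) ≤ FGL.maxDegree (FGL.edgeSet (FGL.corr (FGL.covOp P X))) := by
    exact_mod_cast FGL.one_le_maxDegree hp (FGL.diag_mem_edgeSet (FGL.corr (FGL.covOp P X)))
  set R := FGL.corr (FGL.covOp P X)
  set κ := FGL.kappaConst (FGL.covOp P X) Φ
  set ρ := FGL.rhoConst R
  set γ := FGL.gammaConst R
  set d : ℝ := ((FGL.maxDegree (FGL.edgeSet R) : ℕ) : ℝ)
  set q := 12 * d * κ * (1 + 8 / α) ^ 2 * max (ρ * γ) (ρ ^ 3 * γ ^ 2)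
  have hq : 0 < q := by
    have h1 : 0 < max (ρ * γ) (ρ ^ 3 * γ ^ 2) := lt_max_of_lt_left (by positivity)
    positivity
  have hM : 0 < max (1 / δs) (q ^ (1 + 1 / β)) := lt_max_of_lt_left (by positivity)
  -- The sample size condition gives `f n δ > p^τ` at its critical level `δ`, and monotonicity in
  -- `δ` then places `δbar` below that level. The two arguments of the maximum yield `δbar < δs` and
  -- the smallness of `η`.
  have hδ' := hδbar.lt hf (by positivity) hfn
  have hδs' : δbar < δs := by
    refine hδ'.trans_le ?_
    rw [one_div_le hM hδs]
    exact le_max_left _ _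
  have hsmall : q * δbar ^ (β / (1 + β)) ≤ 1 := by
    refine FGL.mul_rpow_le_one hq hβ0 hδ0 (hδ'.le.trans ?_)
    exact one_div_le_one_div_of_le (by positivity) (le_max_right _ _)
  obtain ⟨G, hG, hPG, hGω⟩ := FGL.exists_accurate_event hp htail hn1 hδbar hδs' (hpos n)
  refine ⟨G, hG, hPG, fun ω hω => ?_⟩
  obtain ⟨hpω, hdω⟩ := hGω ω hω
  -- The choice of `ε` makes the bias `ε^β` and the variance `δbar/ε` coincide.
  have hη : ε ^ β = δbar ^ (β / (1 + β)) := by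
    rw [hε, ← Real.rpow_mul hδ0.le]
    congr 1
    ring
  have hη' : δbar / ε = δbar ^ (β / (1 + β)) := by
    have e : β / (1 + β) = 1 - 1 / (1 + β) := by field_simp; ring
    rw [hε, e, Real.rpow_sub hδ0, Real.rpow_one]
  have hε0 : 0 < ε := by rw [hε]; positivity
  obtain ⟨Hh, h1, h2, h3⟩ := FGL.recovery_of_accurate hp (FGL.isPositive_covOp hX)
    (FGL.hsNorm_covOp_self_lt_top hX) hcorr hreg hsa hc hcoer hα hinc hpω hdω hε0 hδ0.le hη hη'
    hsmall
  rw [← hlam] at h1 h2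
  -- If the estimated entry vanished, the error bound would bound the true entry itself and
  -- contradict its size.
  refine ⟨Hh.toCLM, h1, h2, h3, fun i j hij h0 => ?_⟩
  have h4 := h3 i j
  rw [h0, zero_sub, FGL.hsNorm_neg] at h4
  exact absurd h4 (not_le.2 hij)
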